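/- **Setting.** Let $d\ge 1$, $\mathcal F[f](\xi)=(2\pi)^{-d/2}\int_{\mathbb R^d}e^{-i\xi\cdot x}f(x)\,dx$, and let $(f*g)(x)=\langle f,g(x-\cdot)\rangle$ for $f\in\mathcal S'(\mathbb R^d)$, $g\in\mathcal S(\mathbb R^d)$ (complex-valued). A *scaling triple* $\boldsymbol s=(s,s_L,s_U)$ consists of measurable functions $(0,\infty)\to(0,\infty)$ such that $s_L,s_U$ are non-decreasing, tend to $0$ at $0$ and to $\infty$ at $\infty$, and $s_L(R/r)\le s(R)/s(r)\le s_U(R/r)$ for all $0<r\le R$. Put $m_s=\min\{m\in\{1,2,\dots\}:s_L(2^m)>1\}$, $c_s=2^{m_s}$, $\theta_0=\log_{c_s}s_L(c_s)$, $\theta_1=\log_{c_s}s_U(c_s)$. For an integer $n\ge2$, $\Phi_n(\mathbb R^d)$ is the set of $\zeta\in\mathcal S(\mathbb R^d)$ with $\mathcal F[\zeta]>0$ on $\{n^{-1}<|\xi|<n\}$, $\operatorname{supp}\mathcal F[\zeta]=\{n^{-1}\le|\xi|\le n\}$ and $\sum_{j\in\mathbb Z}\mathcal F[\zeta](n^{-j}\xi)=1$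 for $\xi\ne0$; put $\zeta_0=\mathcal F^{-1}[1-\sum_{j\ge1}\mathcal F[\zeta](n^{-j}\cdot)]$ and $\zeta_j=n^{jd}\zeta(n^j\cdot)$ for $j\ge1$. For $\gamma\in\mathbb R$, $q\in(0,\infty]$ and a Banach space $B$, $l_q^{s;\gamma}(B)$ is the space of sequences in $B$ with $$\|x\|_{l_q^{s;\gamma}(B)}=\|x_0\|_B+\Big(\sum_{j\ge1}s(c_s^{-j})^{-q\gamma/2}\|x_j\|_B^q\Big)^{1/q}<\infty$$ (with $\sup_{j\ge1}s(c_s^{-j})^{-\gamma/2}\|x_j\|_B$ in place of the second term if $q=\infty$). For $\varphi\in\Phi_{c_s}(\mathbb R^d)$ and $f\in\mathcal S'(\mathbb R^d)$ put $I(f)=(f*\varphi_0,f*\varphi_1,\dots)$ and $$\|f\|_{B_{p,q}^{s,\varphi;\gamma}}=\|f*\varphi_0\|_{L_p}+\Big(\sum_{j\ge1}s(c_s^{-j})^{-q\gamma/2}\|f*\varphi_j\|_{L_p}^q\Big)^{1/q}$$ (with the supremum if $q=\infty$), and let $B_{p,q}^{s,\varphi;\gamma}(\mathbb R^d)$ be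 the space of all $f\in\mathcal S'(\mathbb R^d)$ for which this is finite. The classical Besov quasi-norm $\|f\|_{B_{p,q}^{\sigma}}$ is the case $s(x)=x$, with some $\zeta\in\Phi_2(\mathbb R^d)$ in place of $\varphi$ and $2$ in place of $c_s$; that is, it is normalized to have the weights $2^{j\sigma/2}$. $\tilde C^\infty(\mathbb R^d)$ is the space of smooth functions all of whose derivatives lie in $L_p(\mathbb R^d)$ for every $p\in[1,\infty)$. For a couple of complex Banach spaces $A_0,A_1$, $[A_0,A_1]_\theta$ is the complex interpolation space, consisting of the values $f(\theta)$ of the functions $f$ that are bounded and continuous on $0\le\operatorname{Re}z\le1$ and analytic on $0<\operatorname{Re}z<1$ with values in $A_0+A_1$ and for which $t\mapsto f(j+it)$ is continuous into $A_j$ and tends to $0$ there as $|t|\to\infty$ ($j=0,1$), with the norm $\|a\|=\inf_{f(\theta)=a}\max_j\sup_t\|f(j+it)\|_{A_j}$. **Proposition.** Let $\gamma\in\mathbb R$, let $\boldsymbol s$ be a scaling triple, and let $\varphi\in\Phi_{c_s}(\mathbb R^d)$. (i) For $p\in[1,\infty]$, $q\in(0,\infty]$ there is $N>0$ such that for all $f\in\mathcal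 S'(\mathbb R^d)$ $$N^{-1}\|f\|_{B_{p,q}^{\sigma_-}}\le\|I(f)\|_{l_q^{s;\gamma}(L_p)}=\|f\|_{B_{p,q}^{s,\varphi;\gamma}}\le N\|f\|_{B_{p,q}^{\sigma_+}},\qquad \sigma_-=\min(\theta_0\gamma,\theta_1\gamma),\ \sigma_+=\max(\theta_0\gamma,\theta_1\gamma)$$ (so $\sigma_-=\theta_0\gamma$ and $\sigma_+=\theta_1\gamma$ for $\gamma\ge0$). (ii) For $p\in[1,\infty]$, $q\in(0,\infty]$, $B_{p,q}^{s,\varphi;\gamma}(\mathbb R^d)$ is a quasi-Banach space, and it is a Banach space if $q\ge1$. (iii) For $p\in[1,\infty]$, $q\in(0,\infty]$, $\tilde C^\infty(\mathbb R^d)\subseteq B_{p,q}^{s,\varphi;\gamma}(\mathbb R^d)$; if $p,q<\infty$, then $C_c^\infty(\mathbb R^d)$ is dense in $B_{p,q}^{s,\varphi;\gamma}(\mathbb R^d)$. (iv) For $p\in[1,\infty]$, $q\in(0,\infty]$ and $\vartheta\in\Phi_{c_s}(\mathbb R^d)$, the quasi-norms $\|\cdot\|_{B_{p,q}^{s,\varphi;\gamma}}$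 and $\|\cdot\|_{B_{p,q}^{s,\vartheta;\gamma}}$ are equivalent. (v) For $p\in[1,\infty)$ and $f\in\mathcal S'(\mathbb R^d)$, $$\|f\|_{B_{p,q}^{s,\varphi;\gamma_1}}\le\max\{1,s(c_s^{-1})^{(\gamma_2-\gamma_1)/2}\}\,\|f\|_{B_{p,q}^{s,\varphi;\gamma_2}},\qquad q\in(0,\infty],\ \gamma_1\le\gamma_2,$$ (the constant is $1$ if $s(c_s^{-1})\le1$), and $$\|f\|_{B_{p,q_2}^{s,\varphi;\gamma}}\le\|f\|_{B_{p,q_1}^{s,\varphi;\gamma}},\qquad 0<q_1\le q_2\le\infty.$$ (vi) For $p,q\in[1,\infty)$, the topological dual of $B_{p,q}^{s,\varphi;\gamma}(\mathbb R^d)$ is a subspace of $\mathcal S'(\mathbb R^d)$: $\mathcal S(\mathbb R^d)\subseteq B_{p,q}^{s,\varphi;\gamma}(\mathbb R^d)$, and restricting functionals to $\mathcal S(\mathbb R^d)$ is a linear injection of the dual into $\mathcal S'(\mathbb R^d)$. (vii) Let $q_0,q_1\in[1,\infty)$, $\gamma_0,\gamma_1\in\mathbb R$, $\theta\in[0,1]$,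 $\frac1q=\frac{1-\theta}{q_0}+\frac{\theta}{q_1}$, and let $B$ be a complex Banach space. Then, with equivalent norms, $$[l_{q_0}^{s;\gamma_0}(B),l_{q_1}^{s;\gamma_1}(B)]_\theta=l_q^{s;(1-\theta)\gamma_0+\theta\gamma_1}(B).$$ (viii) Let moreover $p\in[1,\infty]$. Then, with equivalent norms, $$[B_{p,q_0}^{s,\varphi;\gamma_0}(\mathbb R^d),B_{p,q_1}^{s,\varphi;\gamma_1}(\mathbb R^d)]_\theta=B_{p,q}^{s,\varphi;(1-\theta)\gamma_0+\theta\gamma_1}(\mathbb R^d).$$ -/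

import Mathlib

open scoped SchwartzMap FourierTransform ENNReal NNReal Topology
open MeasureTheory Filter

noncomputable section

namespace ScaledBesov

/-- `ℝ^d` with the Euclidean norm. -/
abbrev E (d : ℕ) : Type := EuclideanSpace ℝ (Fin d)

/-! ### Scaling triples -/

/-- A scaling triple `(s, s_L, s_U)` of functions on `(0, ∞)`; the values of the three functions
outside `(0, ∞)` are irrelevant. -/
structure ScalingTriple where
  s : ℝ → ℝ
  sL : ℝ → ℝ
  sU : ℝ → ℝ
  s_pos : ∀ r, 0 < r → 0 < s r
  sL_pos : ∀ r, 0 < r → 0 < sL r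
  sU_pos : ∀ r, 0 < r → 0 < sU r
  s_meas : Measurable ((Set.Ioi (0 : ℝ)).domRestrict s)
  sL_meas : Measurable ((Set.Ioi (0 : ℝ)).domRestrict sL)
  sU_meas : Measurable ((Set.Ioi (0 : ℝ)).domRestrict sU)
  sL_mono : MonotoneOn sL (Set.Ioi 0)
  sU_mono : MonotoneOn sU (Set.Ioi 0)
  sL_zero : Tendsto sL (𝓝[>] 0) (𝓝 0)
  sU_zero : Tendsto sU (𝓝[>] 0) (𝓝 0)
  sL_top : Tendsto sL atTop atTop
  sU_top : Tendsto sU atTop atTop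
  le_ratio : ∀ r R, 0 < r → r ≤ R → sL (R / r) ≤ s R / s r
  ratio_le : ∀ r R, 0 < r → r ≤ R → s R / s r ≤ sU (R / r)

namespace ScalingTriple

/-- `m_s = min {m ∈ {1, 2, …} : s_L(2^m) > 1}` (the set is non-empty since `s_L → ∞`). -/
def m (S : ScalingTriple) : ℕ := sInf {m : ℕ | 1 ≤ m ∧ 1 < S.sL (2 ^ m)}

/-- `c_s = 2^{m_s}`. -/
def c (S : ScalingTriple) : ℕ := 2 ^ S.m

/-- `θ₀ = log_{c_s} (s_L(c_s))`. -/
def θ₀ (S : ScalingTriple) : ℝ := Real.logb S.c (S.sL S.c)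

/-- `θ₁ = log_{c_s} (s_U(c_s))`. -/
def θ₁ (S : ScalingTriple) : ℝ := Real.logb S.c (S.sU S.c)

end ScalingTriple

/-! ### Fourier transform, dilations and convolution -/

/-- The dilation `f ↦ f(a ·)` of a Schwartz function, `a ≠ 0`. -/
def dilate {d : ℕ} (a : ℝ) (ha : a ≠ 0) (f : 𝓢(E d, ℂ)) : 𝓢(E d, ℂ) :=
  SchwartzMap.compCLMOfContinuousLinearEquiv ℂ
    (ContinuousLinearEquiv.smulLeft (R₁ := ℝ) (M₁ := E d) (Units.mk0 a ha)) f

theorem dilate_apply {d : ℕ} (a : ℝ) (ha : a ≠ 0) (f : 𝓢(E d, ℂ)) (x : E d) :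
    dilate a ha f x = f (a • x) := rfl

theorem two_pi_inv_ne_zero : (2 * Real.pi)⁻¹ ≠ 0 := inv_ne_zero (by positivity)

/-- The Fourier transform `(2π)^{-d/2} ∫ e^{-i ξ·x} f(x) dx` on Schwartz functions
(see `fourierS_apply`). -/
def fourierS {d : ℕ} (f : 𝓢(E d, ℂ)) : 𝓢(E d, ℂ) :=
  (((2 * Real.pi) ^ (-(d : ℝ) / 2) : ℝ) : ℂ) • dilate (2 * Real.pi)⁻¹ two_pi_inv_ne_zero (𝓕 f)

/-- The inverse Fourier transform `(2π)^{-d/2} ∫ e^{i x·ξ} f(ξ) dξ` on Schwartz functions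
(see `fourierInvS_apply`). -/
def fourierInvS {d : ℕ} (f : 𝓢(E d, ℂ)) : 𝓢(E d, ℂ) :=
  (((2 * Real.pi) ^ (-(d : ℝ) / 2) : ℝ) : ℂ) • dilate (2 * Real.pi)⁻¹ two_pi_inv_ne_zero (𝓕⁻ f)

theorem fourierS_apply {d : ℕ} (f : 𝓢(E d, ℂ)) (ξ : E d) :
    fourierS f ξ = (((2 * Real.pi) ^ (-(d : ℝ) / 2) : ℝ) : ℂ) *
      ∫ x : E d, Complex.exp (-(Complex.I * (inner ℝ ξ x : ℝ))) * f x := by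
  have h : fourierS f ξ = (((2 * Real.pi) ^ (-(d : ℝ) / 2) : ℝ) : ℂ) *
      (𝓕 f) ((2 * Real.pi)⁻¹ • ξ) := rfl
  rw [h, SchwartzMap.fourier_coe, Real.fourier_eq']
  congr 2
  funext x
  have hpi : (Real.pi : ℂ) ≠ 0 := by exact_mod_cast Real.pi_ne_zero
  rw [smul_eq_mul, real_inner_smul_right, real_inner_comm]
  congr 2
  push_cast
  field_simp

theorem fourierInvS_apply {d : ℕ} (f : 𝓢(E d, ℂ)) (x : E d) :
    fourierInvS f x = (((2 * Real.pi) ^ (-(d : ℝ) / 2) : ℝ) : ℂ) *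
      ∫ ξ : E d, Complex.exp (Complex.I * (inner ℝ x ξ : ℝ)) * f ξ := by
  have h : fourierInvS f x = (((2 * Real.pi) ^ (-(d : ℝ) / 2) : ℝ) : ℂ) *
      (𝓕⁻ f) ((2 * Real.pi)⁻¹ • x) := rfl
  rw [h, SchwartzMap.fourierInv_coe, Real.fourierInv_eq']
  congr 2
  funext ξ
  have hpi : (Real.pi : ℂ) ≠ 0 := by exact_mod_cast Real.pi_ne_zero
  rw [smul_eq_mul, real_inner_smul_right, real_inner_comm]
  congr 2
  push_cast
  field_simp

/-- The Schwartz function `y ↦ g(x - y)`. -/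
def reflectTranslate {d : ℕ} (g : 𝓢(E d, ℂ)) (x : E d) : 𝓢(E d, ℂ) :=
  SchwartzMap.compSubConstCLM ℂ x (dilate (-1) (by norm_num) g)

theorem reflectTranslate_apply {d : ℕ} (g : 𝓢(E d, ℂ)) (x y : E d) :
    reflectTranslate g x y = g (x - y) := by
  have h : reflectTranslate g x y = g ((-1 : ℝ) • (y - x)) := rfl
  rw [h, neg_one_smul, neg_sub]

/-- The convolution `(f ∗ g)(x) = ⟨f, g(x - ·)⟩` of a tempered distribution with a
Schwartz function; it is a function on `ℝ^d`. -/
def conv {d : ℕ} (f : 𝓢'(E d, ℂ)) (g : 𝓢(E d, ℂ)) (x : E d) : ℂ := f (reflectTranslate g x)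

theorem continuous_translate {d : ℕ} (g : 𝓢(E d, ℂ)) :
    Continuous fun x : E d => SchwartzMap.compSubConstCLM ℂ x g := by
  rw [continuous_iff_continuousAt]
  intro x₀
  rw [ContinuousAt, (schwartz_withSeminorms ℂ (E d) ℂ).tendsto_nhds]
  rintro ⟨k, n⟩ ε hε
  set M : ℝ := 2 ^ k * ((Finset.Iic (k, n + 1)).sup
    fun m => SchwartzMap.seminorm ℂ m.1 m.2) g with hM
  have hM0 : 0 ≤ M := by positivity
  set R : ℝ := ‖x₀‖ + 1 with hR
  have hR1 : 1 ≤ R := by rw [hR]; linarith [norm_nonneg x₀]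
  set C : ℝ := R ^ k * M with hC
  have hC0 : 0 ≤ C := by positivity
  have key : ∀ x : E d, ‖x - x₀‖ ≤ 1 →
      SchwartzMap.seminorm ℂ k n (SchwartzMap.compSubConstCLM ℂ x g
        - SchwartzMap.compSubConstCLM ℂ x₀ g) ≤ C * ‖x - x₀‖ := by
    intro x hx
    refine SchwartzMap.seminorm_le_bound ℂ k n _ (by positivity) fun y => ?_
    have hsub : iteratedFDeriv ℝ n (⇑(SchwartzMap.compSubConstCLM ℂ x g
        - SchwartzMap.compSubConstCLM ℂ x₀ g)) y
        = iteratedFDeriv ℝ n g (y - x) - iteratedFDeriv ℝ n g (y - x₀) := by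
      have h1 : (⇑(SchwartzMap.compSubConstCLM ℂ x g - SchwartzMap.compSubConstCLM ℂ x₀ g))
          = (fun z => g (z - x)) - fun z => g (z - x₀) := rfl
      have c1 : ∀ a : E d, ContDiff ℝ n fun z => g (z - a) := fun a =>
        (g.smooth n).comp (contDiff_id.sub contDiff_const)
      rw [h1, iteratedFDeriv_sub_apply (c1 x).contDiffAt (c1 x₀).contDiffAt,
        iteratedFDeriv_comp_sub, iteratedFDeriv_comp_sub]
    rw [hsub]
    have hy0 : 0 ≤ ‖y‖ ^ k := by positivity
    by_cases hyk : ‖y‖ ^ k = 0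
    · rw [hyk, zero_mul]; positivity
    have hyp : 0 < ‖y‖ ^ k := lt_of_le_of_ne hy0 (Ne.symm hyk)
    have hbd : ∀ w ∈ segment ℝ (y - x₀) (y - x),
        ‖fderiv ℝ (iteratedFDeriv ℝ n g) w‖ ≤ C / ‖y‖ ^ k := by
      intro w hw
      have hdist : ‖w - (y - x₀)‖ ≤ 1 := by
        have : w ∈ Metric.closedBall (y - x₀) 1 := by
          refine (convex_closedBall _ _).segment_subset (by simp) ?_ hw
          rw [mem_closedBall_iff_norm]
          have : y - x - (y - x₀) = -(x - x₀) := by abel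
          rw [this, norm_neg]; exact hx
        rwa [mem_closedBall_iff_norm] at this
      have hyw : ‖y‖ ≤ R * (1 + ‖w‖) := by
        have : y = w - (w - (y - x₀)) + x₀ := by abel
        have h2 : ‖y‖ ≤ ‖w‖ + ‖w - (y - x₀)‖ + ‖x₀‖ := by
          calc ‖y‖ = ‖w - (w - (y - x₀)) + x₀‖ := by rw [← this]
            _ ≤ _ := (norm_add_le _ _).trans (by gcongr; exact norm_sub_le _ _)
        nlinarith [norm_nonneg w, norm_nonneg x₀]
      rw [norm_fderiv_iteratedFDeriv, le_div_iff₀ hyp, mul_comm]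
      have h3 := SchwartzMap.one_add_le_sup_seminorm_apply (𝕜 := ℂ) (m := (k, n + 1))
        (k := k) (n := n + 1) le_rfl le_rfl g w
      calc ‖y‖ ^ k * ‖iteratedFDeriv ℝ (n + 1) g w‖
          ≤ (R * (1 + ‖w‖)) ^ k * ‖iteratedFDeriv ℝ (n + 1) g w‖ := by gcongr
        _ = R ^ k * ((1 + ‖w‖) ^ k * ‖iteratedFDeriv ℝ (n + 1) g w‖) := by rw [mul_pow]; ring
        _ ≤ R ^ k * M := by gcongr
    have hmv := (convex_segment (y - x₀) (y - x)).norm_image_sub_le_of_norm_fderiv_le (𝕜 := ℝ)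
      (f := iteratedFDeriv ℝ n g)
      (fun w _ => (g.smooth (n + 1)).differentiable_iteratedFDeriv (by exact_mod_cast Nat.lt_succ_self n) w) hbd
      (left_mem_segment ℝ _ _) (right_mem_segment ℝ _ _)
    have hxx : ‖y - x - (y - x₀)‖ = ‖x - x₀‖ := by
      have : y - x - (y - x₀) = -(x - x₀) := by abel
      rw [this, norm_neg]
    rw [hxx] at hmv
    calc ‖y‖ ^ k * ‖iteratedFDeriv ℝ n g (y - x) - iteratedFDeriv ℝ n g (y - x₀)‖
        ≤ ‖y‖ ^ k * (C / ‖y‖ ^ k * ‖x - x₀‖) := by gcongr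
      _ = C * ‖x - x₀‖ := by field_simp
  have hball : ∀ᶠ x in 𝓝 x₀, ‖x - x₀‖ < min 1 (ε / (C + 1)) := by
    have := Metric.ball_mem_nhds x₀ (show 0 < min 1 (ε / (C + 1)) by positivity)
    filter_upwards [this] with x hx
    rwa [mem_ball_iff_norm] at hx
  filter_upwards [hball] with x hx
  have h1 : ‖x - x₀‖ ≤ 1 := (hx.trans_le (min_le_left _ _)).le
  have h2 : ‖x - x₀‖ < ε / (C + 1) := hx.trans_le (min_le_right _ _)
  rw [lt_div_iff₀ (by positivity)] at h2
  refine (key x h1).trans_lt ?_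
  nlinarith [norm_nonneg (x - x₀)]

theorem continuous_conv {d : ℕ} (f : 𝓢'(E d, ℂ)) (g : 𝓢(E d, ℂ)) : Continuous (conv f g) :=
  f.continuous.comp (continuous_translate (dilate (-1) (by norm_num) g))

/-! ### Littlewood-Paley functions -/

/-- The class `Φ_n(ℝ^d)` of Littlewood-Paley functions, `n ≥ 2`. -/
structure LittlewoodPaley (d n : ℕ) where
  ζ : 𝓢(E d, ℂ)
  two_le : 2 ≤ n
  pos : ∀ ξ : E d, (n : ℝ)⁻¹ < ‖ξ‖ → ‖ξ‖ < n → ∃ r : ℝ, 0 < r ∧ fourierS ζ ξ = r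
  supp : tsupport (fourierS ζ) = {ξ : E d | (n : ℝ)⁻¹ ≤ ‖ξ‖ ∧ ‖ξ‖ ≤ n}
  sum_eq_one : ∀ ξ : E d, ξ ≠ 0 → HasSum (fun j : ℤ => fourierS ζ ((n : ℝ) ^ (-j) • ξ)) 1

namespace LittlewoodPaley

variable {d n : ℕ}

/-- The frequency function `1 - ∑_{j ≥ 1} F[ζ](n^{-j} ·)` of `ζ₀`. -/
def lowSymbol (φ : LittlewoodPaley d n) (ξ : E d) : ℂ :=
  1 - ∑' j : ℕ, fourierS φ.ζ ((n : ℝ) ^ (-((j : ℤ) + 1)) • ξ)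

theorem cast_ne_zero (φ : LittlewoodPaley d n) : (n : ℝ) ≠ 0 := by
  have := φ.two_le
  positivity

theorem fourierS_eq_zero (φ : LittlewoodPaley d n) {ξ : E d}
    (h : ‖ξ‖ < (n : ℝ)⁻¹ ∨ (n : ℝ) < ‖ξ‖) : fourierS φ.ζ ξ = 0 := by
  refine image_eq_zero_of_notMem_tsupport ?_
  rw [φ.supp]
  rintro ⟨h1, h2⟩
  rcases h with h | h <;> linarith

theorem contDiff_lowSymbol (φ : LittlewoodPaley d n) :
    ContDiff ℝ ((⊤ : ℕ∞) : WithTop ℕ∞) φ.lowSymbol := by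
  rw [contDiff_iff_contDiffAt]
  intro ξ₀
  have hn1 : (1 : ℝ) < n := by exact_mod_cast φ.two_le
  obtain ⟨J, hJ⟩ := pow_unbounded_of_one_lt (‖ξ₀‖ + 1) hn1
  have hfin : ContDiff ℝ ((⊤ : ℕ∞) : WithTop ℕ∞) fun ξ : E d =>
      (1 : ℂ) - ∑ j ∈ Finset.range J, fourierS φ.ζ ((n : ℝ) ^ (-((j : ℤ) + 1)) • ξ) := by
    refine contDiff_const.sub (ContDiff.sum fun j _ => ?_)
    exact ((fourierS φ.ζ).smooth ⊤).comp (contDiff_const_smul _)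
  refine hfin.contDiffAt.congr_of_eventuallyEq ?_
  filter_upwards [Metric.ball_mem_nhds ξ₀ one_pos] with ξ hξ
  rw [mem_ball_iff_norm] at hξ
  have hξJ : ‖ξ‖ < (n : ℝ) ^ J := by
    have : ‖ξ‖ ≤ ‖ξ - ξ₀‖ + ‖ξ₀‖ := by simpa using norm_add_le (ξ - ξ₀) ξ₀
    linarith
  unfold lowSymbol
  rw [tsum_eq_sum]
  intro j hj
  rw [Finset.mem_range, not_lt] at hj
  apply φ.fourierS_eq_zero
  left
  have hn0 : (0 : ℝ) < n := by linarith
  rw [norm_smul, Real.norm_of_nonneg (by positivity)]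
  have hz : (n : ℝ) ^ (-((j : ℤ) + 1)) = ((n : ℝ) ^ j)⁻¹ * (n : ℝ)⁻¹ := by
    rw [zpow_neg, ← mul_inv, zpow_add_one₀ hn0.ne', zpow_natCast]
  rw [hz]
  have hlt : ‖ξ‖ < (n : ℝ) ^ j := hξJ.trans_le (pow_le_pow_right₀ hn1.le hj)
  have hpj : (0 : ℝ) < (n : ℝ) ^ j := by positivity
  calc ((n : ℝ) ^ j)⁻¹ * (n : ℝ)⁻¹ * ‖ξ‖ < ((n : ℝ) ^ j)⁻¹ * (n : ℝ)⁻¹ * (n : ℝ) ^ j := by gcongr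
    _ = (n : ℝ)⁻¹ := by field_simp

theorem hasCompactSupport_lowSymbol (φ : LittlewoodPaley d n) :
    HasCompactSupport φ.lowSymbol := by
  have hn1 : (1 : ℝ) < n := by exact_mod_cast φ.two_le
  refine HasCompactSupport.intro (isCompact_closedBall (0 : E d) n) fun ξ hξ => ?_
  rw [mem_closedBall_zero_iff, not_le] at hξ
  have hξ0 : ξ ≠ 0 := by
    rintro rfl
    rw [norm_zero] at hξ
    linarith
  have hinj : Function.Injective fun j : ℕ => (j : ℤ) + 1 := fun a b hab => by
    simpa using hab
  have hsum := (hinj.hasSum_iff (f := fun j : ℤ => fourierS φ.ζ ((n : ℝ) ^ (-j) • ξ))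
    (a := (1 : ℂ)) ?_).2 (φ.sum_eq_one ξ hξ0)
  · have : ∑' j : ℕ, fourierS φ.ζ ((n : ℝ) ^ (-((j : ℤ) + 1)) • ξ) = 1 := hsum.tsum_eq
    rw [lowSymbol, this, sub_self]
  · intro j hj
    have hj0 : j ≤ 0 := by
      by_contra h
      exact hj ⟨(j - 1).toNat, by simp only; omega⟩
    apply φ.fourierS_eq_zero
    right
    rw [norm_smul, Real.norm_of_nonneg (by positivity)]
    have : (1 : ℝ) ≤ (n : ℝ) ^ (-j) := one_le_zpow₀ hn1.le (by omega)
    nlinarith [norm_nonneg ξ]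

/-- The sequence `(ζ₀, ζ₁, …)` attached to a Littlewood-Paley function `ζ`:
`ζ₀ = F⁻¹[1 - ∑_{j ≥ 1} F[ζ](n^{-j} ·)]` and `ζ_j = n^{jd} ζ(n^j ·)` for `j ≥ 1`. -/
def block (φ : LittlewoodPaley d n) : ℕ → 𝓢(E d, ℂ)
  | 0 => fourierInvS (φ.hasCompactSupport_lowSymbol.toSchwartzMap φ.contDiff_lowSymbol)
  | j + 1 => ((n : ℂ) ^ ((j + 1) * d)) •
      dilate ((n : ℝ) ^ (j + 1)) (pow_ne_zero _ φ.cast_ne_zero) φ.ζ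

end LittlewoodPaley

/-! ### Weighted sequence norms and scaled Besov norms -/

/-- The extended norm of `l_q^{s;γ}`, `q ∈ (0, ∞]`, with base `c`, as a function of the sequence
`a_j = ‖x_j‖_B` of the norms of the entries:
`a_0 + (∑_{j ≥ 1} s(c^{-j})^{-qγ/2} a_j^q)^{1/q}`, resp. `a_0 + sup_{j ≥ 1} s(c^{-j})^{-γ/2} a_j`. -/
def lqENorm (c : ℕ) (s : ℝ → ℝ) (γ : ℝ) (q : ℝ≥0∞) (a : ℕ → ℝ≥0∞) : ℝ≥0∞ :=
  a 0 +
    if q = ∞ then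
      ⨆ j : ℕ, ENNReal.ofReal (s ((c : ℝ) ^ (-((j : ℤ) + 1))) ^ (-γ / 2)) * a (j + 1)
    else
      (∑' j : ℕ, ENNReal.ofReal (s ((c : ℝ) ^ (-((j : ℤ) + 1))) ^ (-(q.toReal * γ) / 2)) *
        a (j + 1) ^ q.toReal) ^ (1 / q.toReal)

/-- The extended norm of `l_q^{s;γ}(B)` on sequences in a Banach space `B`. -/
def seqENorm (S : ScalingTriple) (γ : ℝ) (q : ℝ≥0∞) {B : Type*} [NormedAddCommGroup B]
    (x : ℕ → B) : ℝ≥0∞ :=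
  lqENorm S.c S.s γ q (fun j => ‖x j‖ₑ)

/-- The extended norm of `l_q^{s;γ}(L_p(ℝ^d))` on sequences of functions on `ℝ^d`. -/
def seqLpENorm (S : ScalingTriple) (γ : ℝ) (p q : ℝ≥0∞) {d : ℕ} (x : ℕ → E d → ℂ) : ℝ≥0∞ :=
  lqENorm S.c S.s γ q (fun j => eLpNorm (x j) p volume)

/-- The map `I(f) = (f ∗ φ₀, f ∗ φ₁, …)`. -/
def blocks {d n : ℕ} (φ : LittlewoodPaley d n) (f : 𝓢'(E d, ℂ)) (j : ℕ) : E d → ℂ :=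
  conv f (φ.block j)

/-- The extended Besov quasi-norm attached to a Littlewood-Paley function `φ ∈ Φ_n(ℝ^d)`, a weight
function `s` and an order `γ`:
`‖f ∗ φ₀‖_p + (∑_{j ≥ 1} s(n^{-j})^{-qγ/2} ‖f ∗ φ_j‖_p^q)^{1/q}`, with a supremum for `q = ∞`. -/
def besovENorm {d n : ℕ} (φ : LittlewoodPaley d n) (s : ℝ → ℝ) (γ : ℝ) (p q : ℝ≥0∞)
    (f : 𝓢'(E d, ℂ)) : ℝ≥0∞ :=
  eLpNorm (conv f (φ.block 0)) p volume +
    if q = ∞ then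
      ⨆ j : ℕ, ENNReal.ofReal (s ((n : ℝ) ^ (-((j : ℤ) + 1))) ^ (-γ / 2)) *
        eLpNorm (conv f (φ.block (j + 1))) p volume
    else
      (∑' j : ℕ, ENNReal.ofReal (s ((n : ℝ) ^ (-((j : ℤ) + 1))) ^ (-(q.toReal * γ) / 2)) *
        eLpNorm (conv f (φ.block (j + 1))) p volume ^ q.toReal) ^ (1 / q.toReal)

/-- The scaled Besov quasi-norm `‖f‖_{B_{p,q}^{s,φ;γ}}`, `φ ∈ Φ_{c_s}(ℝ^d)`. -/
def scaledBesovENorm (S : ScalingTriple) {d : ℕ} (φ : LittlewoodPaley d S.c) (γ : ℝ)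
    (p q : ℝ≥0∞) (f : 𝓢'(E d, ℂ)) : ℝ≥0∞ :=
  besovENorm φ S.s γ p q f

/-- The classical Besov quasi-norm `‖f‖_{B_{p,q}^σ}`: the case `s(x) = x`, `ζ ∈ Φ_2(ℝ^d)`. In this
normalization the weights are `2^{jσ/2}`. -/
def classicalBesovENorm {d : ℕ} (ζ : LittlewoodPaley d 2) (σ : ℝ) (p q : ℝ≥0∞)
    (f : 𝓢'(E d, ℂ)) : ℝ≥0∞ :=
  besovENorm ζ (fun x => x) σ p q f

theorem conv_add {d : ℕ} (f f' : 𝓢'(E d, ℂ)) (g : 𝓢(E d, ℂ)) :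
    conv (f + f') g = conv f g + conv f' g := rfl

theorem conv_smul {d : ℕ} (a : ℂ) (f : 𝓢'(E d, ℂ)) (g : 𝓢(E d, ℂ)) :
    conv (a • f) g = a • conv f g := rfl

theorem lqENorm_lt_top_of_le {c : ℕ} {s : ℝ → ℝ} {γ : ℝ} {q K : ℝ≥0∞} (hK : K ≠ ∞)
    {a b e : ℕ → ℝ≥0∞} (ha : lqENorm c s γ q a < ∞) (hb : lqENorm c s γ q b < ∞)
    (h : ∀ j, e j ≤ K * (a j + b j)) : lqENorm c s γ q e < ∞ := by
  unfold lqENorm at *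
  rw [ENNReal.add_lt_top] at *
  refine ⟨(h 0).trans_lt (ENNReal.mul_lt_top hK.lt_top (ENNReal.add_lt_top.2 ⟨ha.1, hb.1⟩)), ?_⟩
  have ha2 := ha.2
  have hb2 := hb.2
  split_ifs at * with hq
  · refine lt_of_le_of_lt (iSup_le fun j => ?_)
      (ENNReal.mul_lt_top hK.lt_top (ENNReal.add_lt_top.2 ⟨ha2, hb2⟩))
    refine (mul_le_mul_right (h (j + 1)) _).trans ?_
    rw [mul_left_comm, mul_add]
    gcongr
    · exact le_iSup (fun j : ℕ =>
        ENNReal.ofReal (s ((c : ℝ) ^ (-((j : ℤ) + 1))) ^ (-γ / 2)) * a (j + 1)) j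
    · exact le_iSup (fun j : ℕ =>
        ENNReal.ofReal (s ((c : ℝ) ^ (-((j : ℤ) + 1))) ^ (-γ / 2)) * b (j + 1)) j
  · rcases eq_or_lt_of_le (ENNReal.toReal_nonneg (a := q)) with hr | hr
    · simp [← hr]
    have hr' : 0 < 1 / q.toReal := by positivity
    rw [ENNReal.rpow_lt_top_iff_of_pos hr'] at ha2 hb2 ⊢
    have hKq : (K * 2) ^ q.toReal < ∞ :=
      ENNReal.rpow_lt_top_of_nonneg hr.le (ENNReal.mul_ne_top hK (by simp))
    refine lt_of_le_of_lt (b := (K * 2) ^ q.toReal *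
      ((∑' j : ℕ, ENNReal.ofReal (s ((c : ℝ) ^ (-((j : ℤ) + 1))) ^ (-(q.toReal * γ) / 2)) *
        a (j + 1) ^ q.toReal) +
      ∑' j : ℕ, ENNReal.ofReal (s ((c : ℝ) ^ (-((j : ℤ) + 1))) ^ (-(q.toReal * γ) / 2)) *
        b (j + 1) ^ q.toReal)) ?_ (ENNReal.mul_lt_top hKq (ENNReal.add_lt_top.2 ⟨ha2, hb2⟩))
    rw [← ENNReal.tsum_add, ← ENNReal.tsum_mul_left]
    refine ENNReal.tsum_le_tsum fun j => ?_
    rw [← mul_add, mul_left_comm]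
    gcongr
    have hmax : ∀ x y : ℝ≥0∞, (K * (x + y)) ^ q.toReal
        ≤ (K * 2) ^ q.toReal * (x ^ q.toReal + y ^ q.toReal) := by
      intro x y
      wlog hxy : x ≤ y generalizing x y
      · rw [add_comm x y, add_comm (x ^ q.toReal)]
        exact this y x (le_of_not_ge hxy)
      calc (K * (x + y)) ^ q.toReal ≤ (K * 2 * y) ^ q.toReal := by
            refine ENNReal.rpow_le_rpow ?_ hr.le
            rw [mul_assoc, two_mul]
            gcongr
        _ = (K * 2) ^ q.toReal * y ^ q.toReal := ENNReal.mul_rpow_of_nonneg _ _ hr.le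
        _ ≤ _ := by gcongr; exact le_add_self
    exact (ENNReal.rpow_le_rpow (h (j + 1)) hr.le).trans (hmax _ _)

/-- The scaled Besov space `B_{p,q}^{s,φ;γ}(ℝ^d)` of tempered distributions with finite
quasi-norm. -/
def scaledBesovSpace (S : ScalingTriple) {d : ℕ} (φ : LittlewoodPaley d S.c) (γ : ℝ)
    (p q : ℝ≥0∞) : Submodule ℂ 𝓢'(E d, ℂ) where
  carrier := {f | scaledBesovENorm S φ γ p q f < ∞}
  add_mem' := by
    intro f g hf hg
    refine lqENorm_lt_top_of_le (c := S.c) (s := S.s) (γ := γ) (q := q) (K := p.LpAddConst)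
      (a := fun j => eLpNorm (conv f (φ.block j)) p volume)
      (b := fun j => eLpNorm (conv g (φ.block j)) p volume)
      (e := fun j => eLpNorm (conv (f + g) (φ.block j)) p volume)
      p.LpAddConst_lt_top.ne hf hg fun j => ?_
    rw [conv_add]
    exact eLpNorm_add_le' (continuous_conv _ _).aestronglyMeasurable
      (continuous_conv _ _).aestronglyMeasurable p
  zero_mem' := by
    have h0 : ∀ j, eLpNorm (conv (0 : 𝓢'(E d, ℂ)) (φ.block j)) p volume = 0 := fun j => by
      have : conv (0 : 𝓢'(E d, ℂ)) (φ.block j) = 0 := rfl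
      rw [this, eLpNorm_zero]
    change scaledBesovENorm S φ γ p q 0 < ∞
    unfold scaledBesovENorm besovENorm
    simp only [h0]
    split_ifs
    · simp
    · rcases eq_or_lt_of_le (ENNReal.toReal_nonneg (a := q)) with hr | hr
      · simp [← hr]
      · simp [hr, ENNReal.zero_rpow_of_pos]
  smul_mem' := by
    intro a f hf
    refine lqENorm_lt_top_of_le (c := S.c) (s := S.s) (γ := γ) (q := q) (K := ‖a‖ₑ)
      (a := fun j => eLpNorm (conv f (φ.block j)) p volume)
      (b := fun j => eLpNorm (conv f (φ.block j)) p volume)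
      (e := fun j => eLpNorm (conv (a • f) (φ.block j)) p volume)
      (by simp) hf hf fun j => ?_
    rw [conv_smul, eLpNorm_const_smul]
    gcongr
    exact le_self_add

/-! ### Quasi-Banach spaces, duals, equivalence of quasi-norms -/

/-- `{f | N f < ∞}` with `N` is a quasi-Banach space whose quasi-triangle inequality holds with
the constant `K`; with `K = 1` it is a Banach space. -/
structure IsQuasiBanachWith {V : Type*} [AddCommGroup V] [Module ℂ V] (K : ℝ≥0)
    (N : V → ℝ≥0∞) : Prop where
  eq_zero_iff : ∀ f, N f = 0 ↔ f = 0
  smul : ∀ (a : ℂ) (f : V), N (a • f) = ‖a‖ₑ * N f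
  add_le : ∀ f g, N (f + g) ≤ K * (N f + N g)
  complete : ∀ u : ℕ → V, (∀ k, N (u k) < ∞) →
    (∀ ε : ℝ≥0∞, 0 < ε → ∃ k₀, ∀ k ≥ k₀, ∀ l ≥ k₀, N (u k - u l) < ε) →
    ∃ f, N f < ∞ ∧ Tendsto (fun k => N (u k - f)) atTop (𝓝 0)

/-- Two extended quasi-norms are equivalent; in particular they are finite on the same set. -/
def EquivENorm {V : Type*} (N N' : V → ℝ≥0∞) : Prop :=
  ∃ C : ℝ≥0, 0 < C ∧ ∀ f, N f ≤ C * N' f ∧ N' f ≤ C * N f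

/-- The topological dual of the scaled Besov space: the linear functionals `l` on it with
`|l(f)| ≤ C ‖f‖`. -/
def scaledBesovDual (S : ScalingTriple) {d : ℕ} (φ : LittlewoodPaley d S.c) (γ : ℝ)
    (p q : ℝ≥0∞) : Submodule ℂ (scaledBesovSpace S φ γ p q →ₗ[ℂ] ℂ) where
  carrier := {l | ∃ C : ℝ≥0, ∀ f, ‖l f‖ₑ ≤ C * scaledBesovENorm S φ γ p q (f : 𝓢'(E d, ℂ))}
  add_mem' := by
    rintro l l' ⟨C, hC⟩ ⟨C', hC'⟩
    refine ⟨C + C', fun f => ?_⟩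
    rw [LinearMap.add_apply, ENNReal.coe_add, add_mul]
    exact (enorm_add_le _ _).trans (add_le_add (hC f) (hC' f))
  zero_mem' := ⟨0, fun f => by simp⟩
  smul_mem' := by
    rintro a l ⟨C, hC⟩
    refine ⟨‖a‖₊ * C, fun f => ?_⟩
    rw [LinearMap.smul_apply, enorm_smul, ENNReal.coe_mul, mul_assoc, ← enorm_eq_nnnorm]
    gcongr
    exact hC f

/-- The space `C̃^∞(ℝ^d)` of smooth functions all of whose derivatives lie in `L_p(ℝ^d)` for
every `p ∈ [1, ∞)`. -/
def IsCTilde {d : ℕ} (f : E d → ℂ) : Prop :=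
  ContDiff ℝ ((⊤ : ℕ∞) : WithTop ℕ∞) f ∧
    ∀ p : ℝ≥0∞, 1 ≤ p → p ≠ ∞ → ∀ k : ℕ, MemLp (iteratedFDeriv ℝ k f) p volume

/-! ### Complex interpolation -/

section Interpolation

variable {V : Type*} [AddCommGroup V] [Module ℂ V]

/-- The norm of `A₀ + A₁`, where `A_i = {a | N_i a < ∞}` is a Banach space in the
ambient space `V`. -/
def sumENorm (N₀ N₁ : V → ℝ≥0∞) (a : V) : ℝ≥0∞ := ⨅ b : V, N₀ b + N₁ (a - b)

/-- The closed strip `0 ≤ Re z ≤ 1`. -/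
def strip : Set ℂ := {z | 0 ≤ z.re ∧ z.re ≤ 1}

/-- The Calderón class of the couple `(A₀, A₁)`: functions with values in `A₀ + A₁` that are
bounded and continuous on the closed strip and analytic in the open strip, such that
`t ↦ f(it)` and `t ↦ f(1 + it)` are continuous into `A₀`, resp. `A₁`, and tend to zero there
as `|t| → ∞`. -/
structure IsCalderon (N₀ N₁ : V → ℝ≥0∞) (f : ℂ → V) : Prop where
  bounded : ∃ M : ℝ≥0, ∀ z ∈ strip, sumENorm N₀ N₁ (f z) ≤ M
  continuous : ∀ z ∈ strip, Tendsto (fun w => sumENorm N₀ N₁ (f w - f z)) (𝓝[strip] z) (𝓝 0)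
  analytic : ∀ z : ℂ, 0 < z.re → z.re < 1 → ∃ g : V, sumENorm N₀ N₁ g < ∞ ∧
    Tendsto (fun w => sumENorm N₀ N₁ ((w - z)⁻¹ • (f w - f z) - g)) (𝓝[≠] z) (𝓝 0)
  finite₀ : ∀ t : ℝ, N₀ (f (t * Complex.I)) < ∞
  finite₁ : ∀ t : ℝ, N₁ (f (1 + t * Complex.I)) < ∞
  continuous₀ : ∀ t : ℝ,
    Tendsto (fun u : ℝ => N₀ (f (u * Complex.I) - f (t * Complex.I))) (𝓝 t) (𝓝 0)
  continuous₁ : ∀ t : ℝ,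
    Tendsto (fun u : ℝ => N₁ (f (1 + u * Complex.I) - f (1 + t * Complex.I))) (𝓝 t) (𝓝 0)
  vanish₀ : Tendsto (fun u : ℝ => N₀ (f (u * Complex.I))) (cocompact ℝ) (𝓝 0)
  vanish₁ : Tendsto (fun u : ℝ => N₁ (f (1 + u * Complex.I))) (cocompact ℝ) (𝓝 0)

/-- The norm of the complex interpolation space `[A₀, A₁]_θ`: the infimum over all `f` in the
Calderón class with `f(θ) = a` of `max (sup_t ‖f(it)‖_{A₀}) (sup_t ‖f(1 + it)‖_{A₁})`. It is `∞`
exactly if there is no such `f`, that is, if `a ∉ [A₀, A₁]_θ`. -/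
def interpENorm (N₀ N₁ : V → ℝ≥0∞) (θ : ℝ) (a : V) : ℝ≥0∞ :=
  ⨅ (f : ℂ → V) (_ : IsCalderon N₀ N₁ f ∧ f θ = a),
    max (⨆ t : ℝ, N₀ (f (t * Complex.I))) (⨆ t : ℝ, N₁ (f (1 + t * Complex.I)))

end Interpolation

end ScaledBesov

end

open ScaledBesov

open scoped SchwartzMap FourierTransform ENNReal NNReal Topology
open MeasureTheory Filter

noncomputable section

namespace ScaledBesov

/-! Two facts carry the comparison statements. First, the blocks form a partition of unity on the
Fourier side with bounded overlap: the product of the symbols of `φ.block j` and `ψ.block k`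
vanishes unless the two dyadic scales are comparable, so `φ.block j` is, up to the constant `kap d`
of the convolution theorem, a finite sum of the convolutions `sconv (ψ.block k) (φ.block j)` with
`k` near `j` (`sum_sconv_block`). Second, `conv f (sconv g h)` is the convolution of the function
`conv f g` with `h` (`conv_sconv_eq_integral`), so Young's inequality applies to an arbitrary
tempered distribution; the blocks, being normalized dilates, are bounded in `L¹`. Hence changing the
Littlewood-Paley function, and even the base, acts on the block norms as an almost diagonal operator
on `ℓ_q` (`exists_besovENorm_le`). Neighbouring weights are comparable because the logarithm of `s`
decreases along `c_s^{-j}` by steps between `log s_L(c_s)` and `log s_U(c_s)`; these steps are also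
what `θ₀` and `θ₁` record, whence the classical bounds.

The weights grow at most geometrically, whereas the blocks of a smooth function decay faster than
any given geometric rate, since `ζ` is a power of the Laplacian of another Schwartz function
(`exists_lapS_pow_eq`). So smooth functions lie in every space, and by pairing, every space embeds
continuously into the tempered distributions (`exists_isControl_apply`). Completeness follows from
this embedding and Fatou's lemma. For density, truncate in frequency (dominated convergence in
`ℓ_q`, `q < ∞`), approximate the resulting `L_p` function (`p < ∞`) and cut off at infinity; density
makes a functional determined by its values on Schwartz functions.

For the weighted sequence spaces, the upper bound of the interpolation norm comes from an explicit
family `exp (z² - θ² + z L_j) c_j` with `L_j` chosen to equalize the two boundary norms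
(`interpENorm_le_wNorm`), and the lower bound from the three lines theorem applied to a finite
duality pairing (`sum_rpow_le_of_isCalderon`). The Besov spaces are retracts of the sequence spaces
over `L_p` (`exists_retract`), and complex interpolation respects bounded linear maps, so their
interpolation follows. -/

/-! ### Convolution of Schwartz functions -/

section SchwartzConvolution

variable {d : ℕ}

/-- The convolution of two Schwartz functions. -/
def sconv (g h : 𝓢(E d, ℂ)) : 𝓢(E d, ℂ) :=
  SchwartzMap.convolution (ContinuousLinearMap.mul ℂ ℂ) g h

/-- Convolution with a fixed Schwartz function as a continuous linear map. -/
def sconvCLM (g : 𝓢(E d, ℂ)) : 𝓢(E d, ℂ) →L[ℂ] 𝓢(E d, ℂ) :=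
  SchwartzMap.convolution (ContinuousLinearMap.mul ℂ ℂ) g

theorem sconv_apply (g h : 𝓢(E d, ℂ)) (x : E d) : sconv g h x = ∫ t, g t * h (x - t) := by
  rw [sconv, SchwartzMap.convolution_apply]
  rfl

theorem fourier_sconv (g h : 𝓢(E d, ℂ)) (ξ : E d) : 𝓕 (sconv g h) ξ = 𝓕 g ξ * 𝓕 h ξ := by
  rw [sconv, SchwartzMap.fourier_convolution, SchwartzMap.pairing_apply_apply]
  rfl

/-- Fourier inversion gives injectivity. The algebra of convolution thus reduces to that of
pointwise products. -/
theorem fourier_ext {g h : 𝓢(E d, ℂ)} (H : ∀ ξ, 𝓕 g ξ = 𝓕 h ξ) : g = h := by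
  have h1 : 𝓕 g = 𝓕 h := SchwartzMap.ext H
  rw [← FourierTransform.fourierInv_fourier_eq (F := 𝓢(E d, ℂ)) g, h1,
    FourierTransform.fourierInv_fourier_eq]

theorem sconv_comm (g h : 𝓢(E d, ℂ)) : sconv g h = sconv h g :=
  fourier_ext fun ξ => by rw [fourier_sconv, fourier_sconv, mul_comm]

theorem sconv_assoc (g h k : 𝓢(E d, ℂ)) : sconv (sconv g h) k = sconv g (sconv h k) :=
  fourier_ext fun ξ => by simp only [fourier_sconv, mul_assoc]

theorem sconv_smul (a : ℂ) (g h : 𝓢(E d, ℂ)) : sconv g (a • h) = a • sconv g h :=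
  map_smul (sconvCLM g) a h

theorem smul_sconv (a : ℂ) (g h : 𝓢(E d, ℂ)) : sconv (a • g) h = a • sconv g h := by
  rw [sconv_comm, sconv_smul, sconv_comm]

theorem sconv_sum {ι : Type*} (s : Finset ι) (g : 𝓢(E d, ℂ)) (h : ι → 𝓢(E d, ℂ)) :
    sconv g (∑ i ∈ s, h i) = ∑ i ∈ s, sconv g (h i) :=
  map_sum (sconvCLM g) h s

-- On the Fourier side a derivative is multiplication by a linear symbol, which can be attached to
-- one factor alone. This makes the derivatives of a convolution accessible to the integral formula.
open LineDeriv in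
theorem lineDerivOp_sconv (m : E d) (g h : 𝓢(E d, ℂ)) :
    ∂_{m} (sconv g h) = sconv (∂_{m} g) h := by
  have hm : (fun x : E d => inner ℝ x m).HasTemperateGrowth := by fun_prop
  refine fourier_ext fun ξ => ?_
  rw [fourier_sconv, SchwartzMap.fourier_lineDerivOp_eq, SchwartzMap.fourier_lineDerivOp_eq,
    smul_apply, smul_apply, SchwartzMap.smulLeftCLM_apply_apply hm,
    SchwartzMap.smulLeftCLM_apply_apply hm, fourier_sconv]
  simp only [smul_eq_mul, Complex.real_smul]
  ring

open LineDeriv in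
theorem iteratedLineDerivOp_sconv {n : ℕ} (m : Fin n → E d) (g h : 𝓢(E d, ℂ)) :
    ∂^{m} (sconv g h) = sconv (∂^{m} g) h := by
  induction n with
  | zero => simp
  | succ n ih =>
    rw [LineDeriv.iteratedLineDerivOp_succ_left, LineDeriv.iteratedLineDerivOp_succ_left, ih,
      lineDerivOp_sconv]

theorem sum_sconv {ι : Type*} (s : Finset ι) (g : ι → 𝓢(E d, ℂ)) (h : 𝓢(E d, ℂ)) :
    sconv (∑ i ∈ s, g i) h = ∑ i ∈ s, sconv (g i) h := by
  simp only [sconv_comm _ h, sconv_sum]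

/-- The reflection `x ↦ g(-x)`. -/
def refl (g : 𝓢(E d, ℂ)) : 𝓢(E d, ℂ) := dilate (-1) (by norm_num) g

theorem refl_apply (g : 𝓢(E d, ℂ)) (x : E d) : refl g x = g (-x) := by
  rw [refl, dilate_apply, neg_one_smul]

theorem refl_refl (g : 𝓢(E d, ℂ)) : refl (refl g) = g := by
  ext x; simp [refl_apply]

theorem refl_sconv (g h : 𝓢(E d, ℂ)) : refl (sconv g h) = sconv (refl g) (refl h) := by
  ext x
  rw [refl_apply, sconv_apply, sconv_apply, ← integral_neg_eq_self]
  simp only [refl_apply]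
  refine integral_congr_ae (ae_of_all _ fun t => ?_)
  simp only [neg_sub, sub_neg_eq_add]
  rw [show -x + t = t - x by abel]

/-- The kernel identity behind associativity `(f ∗ g) ∗ h = f ∗ (g ∗ h)` for a distribution `f`: the
reflection comes from defining `f ∗ g` by transposition. -/
theorem sconv_refl_reflectTranslate (g h : 𝓢(E d, ℂ)) (x : E d) :
    sconv (refl g) (reflectTranslate h x) = reflectTranslate (sconv g h) x := by
  ext y
  rw [sconv_apply, reflectTranslate_apply, sconv_apply, ← integral_neg_eq_self]
  simp only [refl_apply, reflectTranslate_apply]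
  refine integral_congr_ae (ae_of_all _ fun t => ?_)
  simp only [neg_neg, sub_neg_eq_add]
  rw [show x - (y + t) = x - y - t by abel]

/-- The convolution of a tempered distribution with a Schwartz function, as a tempered
distribution. -/
def dconv (f : 𝓢'(E d, ℂ)) (g : 𝓢(E d, ℂ)) : 𝓢'(E d, ℂ) :=
  PointwiseConvergenceCLM.precomp ℂ (sconvCLM (refl g)) f

theorem dconv_apply (f : 𝓢'(E d, ℂ)) (g h : 𝓢(E d, ℂ)) : dconv f g h = f (sconv (refl g) h) := rfl

theorem conv_dconv (f : 𝓢'(E d, ℂ)) (g h : 𝓢(E d, ℂ)) :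
    conv (dconv f g) h = conv f (sconv g h) := by
  funext x
  rw [conv, dconv_apply, sconv_refl_reflectTranslate, conv]

end SchwartzConvolution

/-! ### Exchanging a tempered distribution with an integral -/

section Pettis

variable {d : ℕ}

/-- Indices for the weighted derivatives `‖x‖^k D^n u(x)(w₁, …, w_n)`, `(k, n) ∈ s`. -/
def SeminormIndex (d : ℕ) (s : Finset (ℕ × ℕ)) : Type :=
  (m : s) × (E d × (Fin m.1.2 → E d))

instance (d : ℕ) (s : Finset (ℕ × ℕ)) : TopologicalSpace (SeminormIndex d s) := ⊥

/-- For the discrete topology every bounded function is continuous, so the target is an `ℓ^∞` space: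
a Banach space in which Bochner integrals can be formed. -/
instance (d : ℕ) (s : Finset (ℕ × ℕ)) : DiscreteTopology (SeminormIndex d s) := ⟨rfl⟩

/-- The target of the embedding of the Schwartz space given by finitely many seminorms. -/
abbrev SeminormTarget (d : ℕ) (s : Finset (ℕ × ℕ)) : Type :=
  BoundedContinuousFunction (SeminormIndex d s) ℂ

theorem weightedDeriv_bound (s : Finset (ℕ × ℕ)) (u : 𝓢(E d, ℂ)) (i : SeminormIndex d s) :
    ‖(‖i.2.1‖ ^ i.1.1.1 / ∏ k, ‖i.2.2 k‖) • iteratedFDeriv ℝ i.1.1.2 u i.2.1 i.2.2‖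
      ≤ SchwartzMap.seminorm ℂ i.1.1.1 i.1.1.2 u := by
  have h1 := SchwartzMap.le_seminorm ℂ i.1.1.1 i.1.1.2 u i.2.1
  have h2 := (iteratedFDeriv ℝ i.1.1.2 u i.2.1).le_opNorm i.2.2
  have h0 : 0 ≤ ∏ k, ‖i.2.2 k‖ := by positivity
  rw [norm_smul, Real.norm_of_nonneg (by positivity)]
  -- If some direction is zero, so is the product of the norms, and division by zero makes the
  -- normalized entry zero.
  rcases h0.eq_or_lt with h | h
  · rw [← h, div_zero, zero_mul]
    exact apply_nonneg _ _
  · rw [div_mul_eq_mul_div, div_le_iff₀ h]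
    calc ‖i.2.1‖ ^ i.1.1.1 * ‖iteratedFDeriv ℝ i.1.1.2 u i.2.1 i.2.2‖
        ≤ ‖i.2.1‖ ^ i.1.1.1 * (‖iteratedFDeriv ℝ i.1.1.2 u i.2.1‖ * ∏ k, ‖i.2.2 k‖) := by gcongr
      _ ≤ _ := by rw [← mul_assoc]; gcongr

/-- The normalized weighted derivatives of a Schwartz function. -/
def weightedDeriv (s : Finset (ℕ × ℕ)) : 𝓢(E d, ℂ) →ₗ[ℂ] SeminormTarget d s where
  toFun u := BoundedContinuousFunction.ofNormedAddCommGroupDiscrete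
    (fun i => (‖i.2.1‖ ^ i.1.1.1 / ∏ k, ‖i.2.2 k‖) • iteratedFDeriv ℝ i.1.1.2 u i.2.1 i.2.2)
    (∑ m ∈ s, SchwartzMap.seminorm ℂ m.1 m.2 u) (fun i => (weightedDeriv_bound s u i).trans
      (Finset.single_le_sum (f := fun m : ℕ × ℕ => SchwartzMap.seminorm ℂ m.1 m.2 u)
        (fun _ _ => apply_nonneg _ _) i.1.2))
  map_add' u v := by
    ext i
    simp only [BoundedContinuousFunction.coe_ofNormedAddCommGroupDiscrete,
      BoundedContinuousFunction.coe_add, Pi.add_apply,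
      ← SchwartzMap.iteratedLineDerivOp_eq_iteratedFDeriv,
      LineDeriv.iteratedLineDerivOp_add, add_apply, smul_add]
  map_smul' a u := by
    ext i
    simp only [BoundedContinuousFunction.coe_ofNormedAddCommGroupDiscrete,
      BoundedContinuousFunction.coe_smul, ← SchwartzMap.iteratedLineDerivOp_eq_iteratedFDeriv,
      LineDeriv.iteratedLineDerivOp_smul, smul_apply, RingHom.id_apply]
    rw [smul_comm]

theorem weightedDeriv_apply (s : Finset (ℕ × ℕ)) (u : 𝓢(E d, ℂ)) (i : SeminormIndex d s) :
    weightedDeriv s u i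
      = (‖i.2.1‖ ^ i.1.1.1 / ∏ k, ‖i.2.2 k‖) • LineDeriv.iteratedLineDerivOp i.2.2 u i.2.1 := by
  rw [SchwartzMap.iteratedLineDerivOp_eq_iteratedFDeriv]
  rfl

theorem norm_weightedDeriv_le (s : Finset (ℕ × ℕ)) (u : 𝓢(E d, ℂ)) :
    ‖weightedDeriv s u‖ ≤ ∑ m ∈ s, SchwartzMap.seminorm ℂ m.1 m.2 u := by
  refine (BoundedContinuousFunction.norm_le (Finset.sum_nonneg fun _ _ => apply_nonneg _ _)).2 ?_
  exact fun i => (weightedDeriv_bound s u i).trans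
      (Finset.single_le_sum (f := fun m : ℕ × ℕ => SchwartzMap.seminorm ℂ m.1 m.2 u)
        (fun _ _ => apply_nonneg _ _) i.1.2)

/-- The supremum over normalized directions recovers the operator norm of the multilinear
derivative; multilinearity disposes of directions that vanish. -/
theorem seminorm_le_norm_weightedDeriv (s : Finset (ℕ × ℕ)) (u : 𝓢(E d, ℂ)) :
    (s.sup (schwartzSeminormFamily ℂ (E d) ℂ)) u ≤ ‖weightedDeriv s u‖ := by
  refine Seminorm.finset_sup_apply_le (norm_nonneg _) fun m hm => ?_
  refine SchwartzMap.seminorm_le_bound ℂ m.1 m.2 u (norm_nonneg _) fun x => ?_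
  have h0 : (0 : ℝ) ≤ ‖x‖ ^ m.1 := by positivity
  have : ‖(‖x‖ ^ m.1) • iteratedFDeriv ℝ m.2 u x‖ ≤ ‖weightedDeriv s u‖ := by
    refine ContinuousMultilinearMap.opNorm_le_bound (norm_nonneg _) fun w => ?_
    have h1 : ‖(‖x‖ ^ m.1 / ∏ k, ‖w k‖) • iteratedFDeriv ℝ m.2 u x w‖ ≤ ‖weightedDeriv s u‖ :=
      BoundedContinuousFunction.norm_coe_le_norm (weightedDeriv s u) ⟨⟨m, hm⟩, x, w⟩
    rw [smul_apply, norm_smul, Real.norm_of_nonneg h0]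
    by_cases hw : ∃ k, w k = 0
    · obtain ⟨k, hk⟩ := hw
      rw [(iteratedFDeriv ℝ m.2 u x).map_coord_zero k hk]
      simp only [norm_zero, mul_zero]
      positivity
    · push Not at hw
      have hp : 0 < ∏ k, ‖w k‖ := Finset.prod_pos fun k _ => norm_pos_iff.2 (hw k)
      rw [norm_smul, Real.norm_of_nonneg (by positivity)] at h1
      rw [← div_le_iff₀ hp, ← div_mul_eq_mul_div]
      exact h1
  rwa [norm_smul, Real.norm_of_nonneg h0] at this

theorem continuous_weightedDeriv (s : Finset (ℕ × ℕ)) :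
    Continuous (weightedDeriv s : 𝓢(E d, ℂ) → SeminormTarget d s) := by
  refine continuous_of_continuousAt_zero (weightedDeriv (d := d) s) ?_
  rw [ContinuousAt, map_zero, tendsto_zero_iff_norm_tendsto_zero]
  refine squeeze_zero (fun _ => norm_nonneg _) (norm_weightedDeriv_le s) ?_
  have : Continuous fun u : 𝓢(E d, ℂ) => ∑ m ∈ s, SchwartzMap.seminorm ℂ m.1 m.2 u :=
    continuous_finsetSum _ fun m _ =>
      (schwartz_withSeminorms ℂ (E d) ℂ).continuous_seminorm m
  simpa using this.tendsto 0

/-- A tempered distribution factors through finitely many weighted derivatives. -/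
theorem exists_factor_weightedDeriv (f : 𝓢'(E d, ℂ)) : ∃ (s : Finset (ℕ × ℕ))
    (l : SeminormTarget d s →L[ℂ] ℂ), ∀ u, f u = l (weightedDeriv s u) := by
  let f' : 𝓢(E d, ℂ) →ₗ[ℂ] ℂ := { toFun := f, map_add' := map_add f, map_smul' := map_smul f }
  obtain ⟨s, C, -, hC⟩ := Seminorm.bound_of_continuous (schwartz_withSeminorms ℂ (E d) ℂ)
    ((normSeminorm ℂ ℂ).comp f') (continuous_norm.comp f.continuous)
  have hb : ∀ u, ‖f u‖ ≤ C * ‖weightedDeriv s u‖ := fun u =>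
    (hC u).trans (mul_le_mul_of_nonneg_left (seminorm_le_norm_weightedDeriv s u) C.2)
  -- The seminorm bound makes `f` vanish on the kernel, so it descends to a bounded functional on
  -- the range.
  have hker : LinearMap.ker (weightedDeriv (d := d) s) ≤ LinearMap.ker f' := by
    intro u hu
    have := hb u
    rw [LinearMap.mem_ker] at hu
    rw [hu, norm_zero, mul_zero] at this
    exact norm_le_zero_iff.1 this
  let l₀ : LinearMap.range (weightedDeriv (d := d) s) →ₗ[ℂ] ℂ :=
    ((LinearMap.ker (weightedDeriv s)).liftQ f' hker).comp
      (LinearMap.quotKerEquivRange (weightedDeriv s)).symm.toLinearMap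
  have hl₀ : ∀ u, l₀ ⟨weightedDeriv s u, LinearMap.mem_range_self _ u⟩ = f u := by
    intro u
    have : (LinearMap.quotKerEquivRange (weightedDeriv (d := d) s)).symm
        ⟨weightedDeriv s u, LinearMap.mem_range_self _ u⟩
        = (LinearMap.ker (weightedDeriv s)).mkQ u := by
      rw [LinearEquiv.symm_apply_eq]; rfl
    simp only [l₀, LinearMap.comp_apply, LinearEquiv.coe_coe, this, Submodule.mkQ_apply,
      Submodule.liftQ_apply]
    rfl
  -- Hahn-Banach: the integrals below live in the whole target space, so a functional on the range
  -- alone would not suffice.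
  obtain ⟨l, hl, -⟩ := exists_extension_norm_eq (LinearMap.range (weightedDeriv (d := d) s))
    (l₀.mkContinuous C (by
      rintro ⟨_, u, rfl⟩
      rw [hl₀]
      exact hb u))
  refine ⟨s, l, fun u => ?_⟩
  rw [← hl₀ u]
  exact (hl ⟨weightedDeriv s u, LinearMap.mem_range_self _ u⟩).symm

/-- Translation costs only a power of `1 + ‖x‖`, because `‖y‖ ≤ (1 + ‖x‖)(1 + ‖y - x‖)`. The decay
of a second Schwartz function will absorb it. -/
theorem seminorm_translate_le (k n : ℕ) (G : 𝓢(E d, ℂ)) (x : E d) :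
    SchwartzMap.seminorm ℂ k n (SchwartzMap.compSubConstCLM ℂ x G) ≤ 2 ^ k * ((Finset.Iic (k, n)).sup
      fun m => SchwartzMap.seminorm ℂ m.1 m.2) G * (1 + ‖x‖) ^ k := by
  refine SchwartzMap.seminorm_le_bound ℂ k n _ (by positivity) fun y => ?_
  have h3 := SchwartzMap.one_add_le_sup_seminorm_apply (𝕜 := ℂ) (m := (k, n))
        (k := k) (n := n) le_rfl le_rfl G (y - x)
  have hy : ‖y‖ ≤ (1 + ‖x‖) * (1 + ‖y - x‖) := by
    have := norm_add_le (y - x) x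
    rw [sub_add_cancel] at this
    nlinarith [norm_nonneg x, norm_nonneg (y - x)]
  have hD : iteratedFDeriv ℝ n (SchwartzMap.compSubConstCLM ℂ x G) y
      = iteratedFDeriv ℝ n G (y - x) := iteratedFDeriv_comp_sub n x y
  rw [hD]
  calc ‖y‖ ^ k * ‖iteratedFDeriv ℝ n G (y - x)‖
      ≤ ((1 + ‖x‖) * (1 + ‖y - x‖)) ^ k * ‖iteratedFDeriv ℝ n G (y - x)‖ := by gcongr
    _ = ((1 + ‖y - x‖) ^ k * ‖iteratedFDeriv ℝ n G (y - x)‖) * (1 + ‖x‖) ^ k := by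
      rw [mul_pow]; ring
    _ ≤ _ := by gcongr

theorem integrable_one_add_norm_pow_mul (k : ℕ) (h : 𝓢(E d, ℂ)) :
    Integrable fun x : E d => (1 + ‖x‖) ^ k * ‖h x‖ := by
  have h1 := (h.integrable.norm.add (h.integrable_pow_mul volume k)).const_mul (2 ^ k)
  refine h1.mono' (by fun_prop) (ae_of_all _ fun x => ?_)
  have h2 : (1 + ‖x‖) ^ k ≤ 2 ^ k * (1 + ‖x‖ ^ k) := by
    rcases le_total 1 ‖x‖ with hx | hx
    · calc (1 + ‖x‖) ^ k ≤ (2 * ‖x‖) ^ k := by gcongr; linarith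
        _ ≤ _ := by rw [mul_pow]; gcongr; linarith
    · calc (1 + ‖x‖) ^ k ≤ 2 ^ k := by gcongr; linarith
        _ ≤ _ := by
          have : (0 : ℝ) ≤ ‖x‖ ^ k := by positivity
          nlinarith [pow_pos (two_pos : (0 : ℝ) < 2) k]
  rw [Real.norm_of_nonneg (by positivity)]
  calc (1 + ‖x‖) ^ k * ‖h x‖ ≤ (2 ^ k * (1 + ‖x‖ ^ k)) * ‖h x‖ := by gcongr
    _ = _ := by simp only [Pi.add_apply]; ring

/-- A tempered distribution commutes with the integral defining a convolution. -/
theorem apply_sconv_eq_integral (f : 𝓢'(E d, ℂ)) (G h : 𝓢(E d, ℂ)) :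
    f (sconv G h) = ∫ x, h x * f (SchwartzMap.compSubConstCLM ℂ x G) := by
  obtain ⟨s, l, hl⟩ := exists_factor_weightedDeriv f
  have hcont : Continuous fun x : E d => h x • weightedDeriv s (SchwartzMap.compSubConstCLM ℂ x G) :=
    h.continuous.smul ((continuous_weightedDeriv s).comp (continuous_translate G))
  -- The Schwartz space has no norm, so the integral is formed after the embedding; polynomial
  -- growth of the translates meets rapid decay of `h`.
  have hInt : Integrable fun x : E d =>
      h x • weightedDeriv s (SchwartzMap.compSubConstCLM ℂ x G) := by
    have hmaj : Integrable fun x : E d => ∑ m ∈ s, (2 ^ m.1 * ((Finset.Iic (m.1, m.2)).sup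
        fun m => SchwartzMap.seminorm ℂ m.1 m.2) G) * ((1 + ‖x‖) ^ m.1 * ‖h x‖) :=
      integrable_finsetSum _ fun m _ => (integrable_one_add_norm_pow_mul m.1 h).const_mul _
    refine hmaj.mono' hcont.aestronglyMeasurable (ae_of_all _ fun x => ?_)
    rw [norm_smul, mul_comm]
    refine (mul_le_mul_of_nonneg_right (norm_weightedDeriv_le s _) (norm_nonneg _)).trans ?_
    rw [Finset.sum_mul]
    refine Finset.sum_le_sum fun m _ => ?_
    rw [← mul_assoc]
    exact mul_le_mul_of_nonneg_right (seminorm_translate_le m.1 m.2 G x) (norm_nonneg _)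
  -- Evaluation at an index commutes with the Bochner integral, and at each index the claim is the
  -- convolution formula for a derivative of `G`.
  have key : weightedDeriv s (sconv G h)
      = ∫ x, h x • weightedDeriv s (SchwartzMap.compSubConstCLM ℂ x G) := by
    ext i
    change _ = BoundedContinuousFunction.evalCLM ℂ i _
    rw [← (BoundedContinuousFunction.evalCLM ℂ i).integral_comp_comm hInt]
    have hev : ∀ x, BoundedContinuousFunction.evalCLM ℂ i
        (h x • weightedDeriv s (SchwartzMap.compSubConstCLM ℂ x G))
        = (‖i.2.1‖ ^ i.1.1.1 / ∏ k, ‖i.2.2 k‖) •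
          (h x * (LineDeriv.iteratedLineDerivOp i.2.2 G) (i.2.1 - x)) := by
      intro x
      rw [map_smul, BoundedContinuousFunction.evalCLM_apply, weightedDeriv_apply, smul_comm,
        SchwartzMap.iteratedLineDerivOp_eq_iteratedFDeriv,
        SchwartzMap.iteratedLineDerivOp_eq_iteratedFDeriv]
      rw [show iteratedFDeriv ℝ i.1.1.2 (SchwartzMap.compSubConstCLM ℂ x G) i.2.1
        = iteratedFDeriv ℝ i.1.1.2 G (i.2.1 - x) from iteratedFDeriv_comp_sub _ x _, smul_eq_mul]
    simp only [hev]
    rw [integral_smul, weightedDeriv_apply, iteratedLineDerivOp_sconv, sconv_comm, sconv_apply]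
  rw [hl, key, ← l.integral_comp_comm hInt]
  refine integral_congr_ae (ae_of_all _ fun x => ?_)
  simp only [map_smul, smul_eq_mul, hl]

/-- The two meanings of `f ∗ g`, as a distribution and as a function, agree. This is what lets
integral inequalities act on distributions. -/
theorem dconv_eq_integral (f : 𝓢'(E d, ℂ)) (g h : 𝓢(E d, ℂ)) :
    dconv f g h = ∫ x, h x * conv f g x :=
  apply_sconv_eq_integral f (refl g) h

theorem conv_sconv_eq_integral (f : 𝓢'(E d, ℂ)) (g h : 𝓢(E d, ℂ)) (x : E d) :
    conv f (sconv g h) x = ∫ y, h (x - y) * conv f g y := by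
  rw [← conv_dconv, conv, dconv_eq_integral]
  simp only [reflectTranslate_apply]

end Pettis

/-! ### Young's inequality -/

section Young

variable {d : ℕ}

/-- Hölder's inequality for the measure `k (x - y) dy`, obtained by writing `k = k^{1/P} k^{1/P'}`,
bounds the inner integral pointwise; Tonelli and translation invariance then give the result. -/
theorem lintegral_rpow_convolution_le {k u : E d → ℝ≥0∞} (hk : Measurable k)
    (hu : AEMeasurable u volume) {P : ℝ} (hP : 1 ≤ P) :
    ∫⁻ x, (∫⁻ y, k (x - y) * u y) ^ P ≤ (∫⁻ y, k y) ^ P * ∫⁻ y, u y ^ P := by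
  have hP0 : 0 < P := by linarith
  set A := ∫⁻ y, k y with hA
  have hkx : ∀ x, Measurable fun y => k (x - y) := fun x => hk.comp (by fun_prop)
  have hpt : ∀ x, (∫⁻ y, k (x - y) * u y) ^ P ≤ A ^ (P - 1) * ∫⁻ y, k (x - y) * u y ^ P := by
    intro x
    rcases hP.eq_or_lt with rfl | hP1
    · simp
    have hc := Real.HolderConjugate.conjExponent hP1
    set P' := P.conjExponent
    have hP' : 0 < P' := hc.symm.pos
    have h1 : ∀ y, k (x - y) * u y = ((fun y => k (x - y) ^ (1 / P)* u y) *
        (fun y => k (x - y) ^ (1 / P'))) y := by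
      intro y
      simp only [Pi.mul_apply]
      rw [mul_right_comm, ← ENNReal.rpow_add_of_nonneg _ _ (by positivity) (by positivity),
        one_div, one_div, hc.inv_add_inv_eq_one, ENNReal.rpow_one]
    have h2 := ENNReal.lintegral_mul_le_Lp_mul_Lq volume hc
      (((hkx x).pow_const (1 / P)).aemeasurable.mul hu)
      ((hkx x).pow_const (1 / P')).aemeasurable
    change ∫⁻ y, ((fun y => k (x - y) ^ (1 / P) * u y) * (fun y => k (x - y) ^ (1 / P'))) y ≤ _
      at h2
    rw [← lintegral_congr h1] at h2
    calc (∫⁻ y, k (x - y) * u y) ^ P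
        ≤ ((∫⁻ y, (k (x - y) ^ (1 / P) * u y) ^ P) ^ (1 / P) *
          (∫⁻ y, (k (x - y) ^ (1 / P')) ^ P') ^ (1 / P')) ^ P := by gcongr; exact h2
      _ = (∫⁻ y, k (x - y) * u y ^ P) * (∫⁻ y, k (x - y)) ^ (P - 1) := by
        rw [ENNReal.mul_rpow_of_nonneg _ _ hP0.le, ← ENNReal.rpow_mul, ← ENNReal.rpow_mul,
          one_div_mul_cancel hP0.ne', ENNReal.rpow_one]
        have e1 : 1 / P' * P = P - 1 := by
          have := hc.inv_add_inv_eq_one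
          have h3 : P'⁻¹ = 1 - P⁻¹ := by linarith
          rw [one_div, h3, sub_mul, inv_mul_cancel₀ hP0.ne', one_mul]
        rw [e1]
        simp only [ENNReal.mul_rpow_of_nonneg _ _ hP0.le, ← ENNReal.rpow_mul,
          one_div_mul_cancel hP0.ne', one_div_mul_cancel hP'.ne', ENNReal.rpow_one]
      _ = _ := by rw [mul_comm, lintegral_sub_left_eq_self k x]
  have hjoint : AEMeasurable (fun z : E d × E d => k (z.1 - z.2) * u z.2 ^ P)
      (volume.prod volume) :=
    (hk.comp (measurable_fst.sub measurable_snd)).aemeasurable.mul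
      ((hu.comp_quasiMeasurePreserving Measure.quasiMeasurePreserving_snd).pow_const P)
  calc ∫⁻ x, (∫⁻ y, k (x - y) * u y) ^ P
      ≤ ∫⁻ x, A ^ (P - 1) * ∫⁻ y, k (x - y) * u y ^ P := lintegral_mono hpt
    _ = A ^ (P - 1) * ∫⁻ x, ∫⁻ y, k (x - y) * u y ^ P :=
      lintegral_const_mul'' _ hjoint.lintegral_prod_right'
    _ = A ^ (P - 1) * ∫⁻ y, ∫⁻ x, k (x - y) * u y ^ P := by
      rw [lintegral_lintegral_swap hjoint]
    _ = A ^ (P - 1) * ∫⁻ y, A * u y ^ P := by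
      congr 1
      refine lintegral_congr fun y => ?_
      rw [lintegral_mul_const _ (by fun_prop), lintegral_sub_right_eq_self k y]
    _ = _ := by
      rw [lintegral_const_mul'' _ (hu.pow_const P), ← mul_assoc]
      congr 1
      nth_rw 2 [← ENNReal.rpow_one A]
      rw [← ENNReal.rpow_add_of_nonneg _ _ (by linarith) zero_le_one, sub_add_cancel]

/-- Young's inequality for the convolution with an integrable function. -/
theorem eLpNorm_integral_mul_le (h : 𝓢(E d, ℂ)) {F : E d → ℂ}
    (hF : AEStronglyMeasurable F volume) {p : ℝ≥0∞} (hp : 1 ≤ p) :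
    eLpNorm (fun x => ∫ y, h (x - y) * F y) p volume
      ≤ eLpNorm h 1 volume * eLpNorm F p volume := by
  have hk : Measurable fun y => ‖h y‖ₑ := h.continuous.enorm.measurable
  have hpt : ∀ x, ‖∫ y, h (x - y) * F y‖ₑ ≤ ∫⁻ y, ‖h (x - y)‖ₑ * ‖F y‖ₑ := fun x =>
    (enorm_integral_le_lintegral_enorm _).trans (by simp only [enorm_mul]; rfl)
  rw [eLpNorm_one_eq_lintegral_enorm]
  by_cases hpt' : p = ∞
  · subst hpt'
    rw [eLpNorm_exponent_top, eLpNorm_exponent_top]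
    refine essSup_le_of_ae_le _ (ae_of_all _ fun x => (hpt x).trans ?_)
    calc ∫⁻ y, ‖h (x - y)‖ₑ * ‖F y‖ₑ ≤ ∫⁻ y, ‖h (x - y)‖ₑ * eLpNormEssSup F volume := by
          refine lintegral_mono_ae ?_
          filter_upwards [enorm_ae_le_eLpNormEssSup F volume] with y hy
          gcongr
      _ = _ := by
        have hkx : Measurable fun y => ‖h (x - y)‖ₑ := hk.comp (measurable_const.sub measurable_id)
        rw [lintegral_mul_const _ hkx,
          lintegral_sub_left_eq_self (fun y => ‖h y‖ₑ) x]
  have hP : 1 ≤ p.toReal := by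
    rw [← ENNReal.toReal_one]
    exact ENNReal.toReal_mono hpt' hp
  have hP0 : 0 < p.toReal := by linarith
  have hp0 : p ≠ 0 := (zero_lt_one.trans_le hp).ne'
  rw [eLpNorm_eq_lintegral_rpow_enorm_toReal hp0 hpt', eLpNorm_eq_lintegral_rpow_enorm_toReal hp0 hpt']
  calc (∫⁻ x, ‖∫ y, h (x - y) * F y‖ₑ ^ p.toReal) ^ (1 / p.toReal)
      ≤ (∫⁻ x, (∫⁻ y, ‖h (x - y)‖ₑ * ‖F y‖ₑ) ^ p.toReal) ^ (1 / p.toReal) := by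
        gcongr with x; exact hpt x
    _ ≤ ((∫⁻ y, ‖h y‖ₑ) ^ p.toReal * ∫⁻ y, ‖F y‖ₑ ^ p.toReal) ^ (1 / p.toReal) := by
        gcongr
        exact lintegral_rpow_convolution_le hk hF.enorm hP
    _ = _ := by
        rw [ENNReal.mul_rpow_of_nonneg _ _ (by positivity), ← ENNReal.rpow_mul,
          mul_one_div_cancel hP0.ne', ENNReal.rpow_one]

/-- The basic block estimate: Young's inequality sees the distribution only through the continuous
function `conv f g`. -/
theorem eLpNorm_conv_sconv_le (f : 𝓢'(E d, ℂ)) (g h : 𝓢(E d, ℂ)) {p : ℝ≥0∞} (hp : 1 ≤ p) :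
    eLpNorm (conv f (sconv g h)) p volume
      ≤ eLpNorm h 1 volume * eLpNorm (conv f g) p volume := by
  have : conv f (sconv g h) = fun x => ∫ y, h (x - y) * conv f g y :=
    funext fun x => conv_sconv_eq_integral f g h x
  rw [this]
  exact eLpNorm_integral_mul_le h (continuous_conv f g).aestronglyMeasurable hp

/-- The exponent conjugate to `p ∈ [1, ∞]`. -/
def conjExp (p : ℝ≥0∞) : ℝ≥0∞ := (1 - p⁻¹)⁻¹

theorem one_le_conjExp (p : ℝ≥0∞) : 1 ≤ conjExp p := by
  simp [conjExp]

theorem enorm_integral_mul_le {F : E d → ℂ} (hF : AEStronglyMeasurable F volume)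
    (h : 𝓢(E d, ℂ)) {p : ℝ≥0∞} (hp : 1 ≤ p) :
    ‖∫ x, h x * F x‖ₑ ≤ eLpNorm h (conjExp p) volume * eLpNorm F p volume := by
  have : ENNReal.HolderConjugate p (conjExp p) := ENNReal.HolderConjugate.inv_one_sub_inv' hp
  have : ENNReal.HolderTriple (conjExp p) p 1 := ENNReal.HolderTriple.symm
  refine (enorm_integral_le_lintegral_enorm _).trans ?_
  rw [← eLpNorm_one_eq_lintegral_enorm]
  exact eLpNorm_smul_le_mul_eLpNorm (φ := h) (p := conjExp p) (q := p) (r := 1) hF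
    h.continuous.aestronglyMeasurable

theorem enorm_dconv_apply_le (f : 𝓢'(E d, ℂ)) (g h : 𝓢(E d, ℂ)) {p : ℝ≥0∞} (hp : 1 ≤ p) :
    ‖dconv f g h‖ₑ ≤ eLpNorm h (conjExp p) volume * eLpNorm (conv f g) p volume := by
  rw [dconv_eq_integral]
  exact enorm_integral_mul_le (continuous_conv f g).aestronglyMeasurable h hp

end Young

/-! ### The Fourier transform with the normalization `(2π)^{-d/2}` -/

section FourierS

variable {d : ℕ}

/-- The constant `(2π)^{d/2}`. -/
def kap (d : ℕ) : ℂ := (((2 * Real.pi) ^ ((d : ℝ) / 2) : ℝ) : ℂ)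

theorem two_pi_pos : (0 : ℝ) < 2 * Real.pi := by positivity

theorem kap_ne_zero (d : ℕ) : kap d ≠ 0 := by
  rw [kap, Complex.ofReal_ne_zero]
  exact (Real.rpow_pos_of_pos two_pi_pos _).ne'

theorem kap_inv (d : ℕ) : (((2 * Real.pi) ^ (-(d : ℝ) / 2) : ℝ) : ℂ) = (kap d)⁻¹ := by
  rw [kap, neg_div, Real.rpow_neg two_pi_pos.le, Complex.ofReal_inv]

theorem kap_sq (d : ℕ) : kap d * kap d = ((2 * Real.pi : ℝ) : ℂ) ^ d := by
  rw [kap, ← Complex.ofReal_mul, ← Real.rpow_add two_pi_pos, add_halves, Real.rpow_natCast,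
    Complex.ofReal_pow]

theorem fourierS_eq (f : 𝓢(E d, ℂ)) (ξ : E d) :
    fourierS f ξ = (kap d)⁻¹ * 𝓕 f ((2 * Real.pi)⁻¹ • ξ) := by
  rw [← kap_inv]
  rfl

theorem fourier_eq_fourierS (f : 𝓢(E d, ℂ)) (η : E d) :
    𝓕 f η = kap d * fourierS f ((2 * Real.pi) • η) := by
  rw [fourierS_eq, smul_smul, inv_mul_cancel₀ two_pi_pos.ne', one_smul, ← mul_assoc,
    mul_inv_cancel₀ (kap_ne_zero d), one_mul]

theorem fourierS_ext {g h : 𝓢(E d, ℂ)} (H : ∀ ξ, fourierS g ξ = fourierS h ξ) : g = h :=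
  fourier_ext fun η => by rw [fourier_eq_fourierS, fourier_eq_fourierS, H]

/-- With the symmetric normalization the convolution theorem carries the factor `(2π)^{d/2}`, so
every reproducing identity below involves `kap d`. -/
theorem fourierS_sconv (g h : 𝓢(E d, ℂ)) (ξ : E d) :
    fourierS (sconv g h) ξ = kap d * (fourierS g ξ * fourierS h ξ) := by
  have hk := kap_ne_zero d
  rw [fourierS_eq, fourierS_eq, fourierS_eq, fourier_sconv]
  field_simp

/-- The Fourier transform as a continuous linear map. -/
def fourierSCLM (d : ℕ) : 𝓢(E d, ℂ) →L[ℂ] 𝓢(E d, ℂ) :=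
  (((2 * Real.pi) ^ (-(d : ℝ) / 2) : ℝ) : ℂ) •
    (SchwartzMap.compCLMOfContinuousLinearEquiv ℂ (ContinuousLinearEquiv.smulLeft (R₁ := ℝ)
      (M₁ := E d) (Units.mk0 _ two_pi_inv_ne_zero))).comp
      (FourierTransform.fourierCLM ℂ 𝓢(E d, ℂ))

theorem fourierS_smul (a : ℂ) (f : 𝓢(E d, ℂ)) : fourierS (a • f) = a • fourierS f :=
  map_smul (fourierSCLM d) a f

theorem fourierS_sum {ι : Type*} (s : Finset ι) (f : ι → 𝓢(E d, ℂ)) :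
    fourierS (∑ i ∈ s, f i) = ∑ i ∈ s, fourierS (f i) :=
  map_sum (fourierSCLM d) f s

theorem fourier_dilate (a : ℝ) (ha : 0 < a) (f : 𝓢(E d, ℂ)) (η : E d) :
    𝓕 (dilate a ha.ne' f) η = ((a : ℂ) ^ d)⁻¹ * 𝓕 f (a⁻¹ • η) := by
  rw [SchwartzMap.fourier_coe, SchwartzMap.fourier_coe, Real.fourier_eq', Real.fourier_eq']
  have h1 := Measure.integral_comp_smul (volume : Measure (E d))
    (fun v : E d => Complex.exp ((-2 * Real.pi * inner ℝ v (a⁻¹ • η) : ℝ) * Complex.I) • f v) a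
  rw [finrank_euclideanSpace_fin, abs_of_pos (by positivity)] at h1
  have h2 : ((a : ℂ) ^ d)⁻¹ = (((a ^ d)⁻¹ : ℝ) : ℂ) := by push_cast; rfl
  rw [h2, ← Complex.real_smul, ← h1]
  refine integral_congr_ae (ae_of_all _ fun v => ?_)
  simp only [dilate_apply, real_inner_smul_left, real_inner_smul_right]
  rw [inv_mul_cancel_left₀ ha.ne']

/-- The `L¹`-normalized dilation `a^d g(a ·)`. -/
def ndilate (a : ℝ) (ha : 0 < a) (g : 𝓢(E d, ℂ)) : 𝓢(E d, ℂ) := ((a : ℂ) ^ d) • dilate a ha.ne' g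

theorem ndilate_apply (a : ℝ) (ha : 0 < a) (g : 𝓢(E d, ℂ)) (x : E d) :
    ndilate a ha g x = (a : ℂ) ^ d * g (a • x) := rfl

theorem fourierS_ndilate (a : ℝ) (ha : 0 < a) (g : 𝓢(E d, ℂ)) (ξ : E d) :
    fourierS (ndilate a ha g) ξ = fourierS g (a⁻¹ • ξ) := by
  have ha' : (a : ℂ) ^ d ≠ 0 := pow_ne_zero _ (Complex.ofReal_ne_zero.2 ha.ne')
  rw [ndilate, fourierS_smul, smul_apply, fourierS_eq, fourier_dilate _ ha, fourierS_eq, smul_comm,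
    smul_eq_mul]
  field_simp

/-- This invariance is the source of all bounds that are uniform in the block index. -/
theorem eLpNorm_one_ndilate (a : ℝ) (ha : 0 < a) (g : 𝓢(E d, ℂ)) :
    eLpNorm (ndilate a ha g) 1 volume = eLpNorm g 1 volume := by
  rw [eLpNorm_one_eq_lintegral_enorm, eLpNorm_one_eq_lintegral_enorm,
    ← ofReal_integral_norm_eq_lintegral_enorm (ndilate a ha g).integrable,
    ← ofReal_integral_norm_eq_lintegral_enorm g.integrable]
  congr 1
  have h1 := Measure.integral_comp_smul (volume : Measure (E d)) (fun v : E d => ‖g v‖) a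
  rw [finrank_euclideanSpace_fin, abs_of_pos (by positivity), smul_eq_mul] at h1
  simp only [ndilate_apply, norm_mul, norm_pow, Complex.norm_real, Real.norm_of_nonneg ha.le]
  rw [integral_const_mul, h1, ← mul_assoc, mul_inv_cancel₀ (by positivity), one_mul]

theorem fourierS_fourierInvS (f : 𝓢(E d, ℂ)) : fourierS (fourierInvS f) = f := by
  have hk := kap_ne_zero d
  ext ξ
  have h2 : ((((2 * Real.pi)⁻¹ : ℝ) : ℂ) ^ d)⁻¹ = kap d * kap d := by
    rw [kap_sq]
    push_cast
    rw [← inv_pow, inv_inv]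
  rw [fourierInvS, fourierS_smul, smul_apply, fourierS_eq,
    fourier_dilate _ (inv_pos.2 two_pi_pos), FourierTransform.fourier_fourierInv_eq, smul_smul,
    h2, kap_inv, inv_inv, mul_inv_cancel₀ two_pi_pos.ne', one_smul, smul_eq_mul]
  field_simp

end FourierS

/-! ### Littlewood-Paley blocks -/

namespace LittlewoodPaley

variable {d n : ℕ}

theorem cast_pos (φ : LittlewoodPaley d n) : (0 : ℝ) < n := by
  have := φ.two_le
  positivity

theorem one_lt_cast (φ : LittlewoodPaley d n) : (1 : ℝ) < n := by
  exact_mod_cast φ.two_le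

theorem block_zero_symbol (φ : LittlewoodPaley d n) (ξ : E d) :
    fourierS (φ.block 0) ξ = φ.lowSymbol ξ := by
  rw [block, fourierS_fourierInvS]
  rfl

theorem block_succ (φ : LittlewoodPaley d n) (j : ℕ) :
    φ.block (j + 1) = ndilate ((n : ℝ) ^ (j + 1)) (pow_pos φ.cast_pos _) φ.ζ := by
  rw [block, ndilate, Complex.ofReal_pow, Complex.ofReal_natCast, ← pow_mul]

theorem block_succ_symbol (φ : LittlewoodPaley d n) (j : ℕ) (ξ : E d) :
    fourierS (φ.block (j + 1)) ξ = fourierS φ.ζ ((n : ℝ) ^ (-((j : ℤ) + 1)) • ξ) := by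
  rw [block_succ, fourierS_ndilate, zpow_neg, ← zpow_natCast]
  norm_cast

theorem summable_symbol (φ : LittlewoodPaley d n) (ξ : E d) :
    Summable fun j : ℕ => fourierS φ.ζ ((n : ℝ) ^ (-((j : ℤ) + 1)) • ξ) := by
  by_cases hξ : ξ = 0
  · subst hξ
    have : ∀ j : ℕ, fourierS φ.ζ ((n : ℝ) ^ (-((j : ℤ) + 1)) • (0 : E d)) = 0 := fun j =>
      φ.fourierS_eq_zero (by
        left
        rw [smul_zero, norm_zero]
        exact inv_pos.2 φ.cast_pos)
    simp only [this]
    exact summable_zero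
  · have hinj : Function.Injective fun j : ℕ => (j : ℤ) + 1 := fun a b hab => by simpa using hab
    exact (φ.sum_eq_one ξ hξ).summable.comp_injective hinj

/-- The low symbol is by definition what the positive indices leave of 1, so the identity also holds
at `ξ = 0`, unlike the one over all integers. -/
theorem hasSum_symbol (φ : LittlewoodPaley d n) (ξ : E d) :
    HasSum (fun j : ℕ => fourierS (φ.block j) ξ) 1 := by
  rw [← hasSum_nat_add_iff' 1]
  simp only [block_succ_symbol, Finset.sum_range_one, block_zero_symbol, lowSymbol, sub_sub_cancel]
  exact (φ.summable_symbol ξ).hasSum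

theorem lowSymbol_eq_zero (φ : LittlewoodPaley d n) {ξ : E d} (hξ : (n : ℝ) < ‖ξ‖) :
    φ.lowSymbol ξ = 0 := by
  have hn1 := φ.one_lt_cast
  have hξ0 : ξ ≠ 0 := by
    rintro rfl
    rw [norm_zero] at hξ
    linarith
  have hinj : Function.Injective fun j : ℕ => (j : ℤ) + 1 := fun a b hab => by
    simpa using hab
  have hsum := (hinj.hasSum_iff (f := fun j : ℤ => fourierS φ.ζ ((n : ℝ) ^ (-j) • ξ))
    (a := (1 : ℂ)) ?_).2 (φ.sum_eq_one ξ hξ0)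
  · have : ∑' j : ℕ, fourierS φ.ζ ((n : ℝ) ^ (-((j : ℤ) + 1)) • ξ) = 1 := hsum.tsum_eq
    rw [lowSymbol, this, sub_self]
  · intro j hj
    have hj0 : j ≤ 0 := by
      by_contra h
      exact hj ⟨(j - 1).toNat, by simp only; omega⟩
    apply φ.fourierS_eq_zero
    right
    rw [norm_smul, Real.norm_of_nonneg (by positivity)]
    have : (1 : ℝ) ≤ (n : ℝ) ^ (-j) := one_le_zpow₀ hn1.le (by omega)
    nlinarith [norm_nonneg ξ]

/-- All positive dilates of the annulus stay outside the unit ball. Hence the low symbol can serve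
as a cutoff function. -/
theorem lowSymbol_eq_one (φ : LittlewoodPaley d n) {ξ : E d} (hξ : ‖ξ‖ < 1) :
    φ.lowSymbol ξ = 1 := by
  have hn1 := φ.one_lt_cast
  have h0 : ∀ j : ℕ, fourierS φ.ζ ((n : ℝ) ^ (-((j : ℤ) + 1)) • ξ) = 0 := by
    intro j
    apply φ.fourierS_eq_zero
    left
    rw [norm_smul, Real.norm_of_nonneg (by positivity)]
    have h1 : (n : ℝ) ^ (-((j : ℤ) + 1)) ≤ (n : ℝ)⁻¹ := by
      rw [← zpow_neg_one]
      exact zpow_le_zpow_right₀ hn1.le (by omega)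
    have h2 : (0 : ℝ) < (n : ℝ)⁻¹ := inv_pos.2 φ.cast_pos
    have h3 : (0 : ℝ) < (n : ℝ) ^ (-((j : ℤ) + 1)) := zpow_pos φ.cast_pos _
    nlinarith [norm_nonneg ξ]
  rw [lowSymbol]
  simp only [h0, tsum_zero, sub_zero]

theorem norm_le_of_symbol_ne_zero (φ : LittlewoodPaley d n) {j : ℕ} {ξ : E d}
    (h : fourierS (φ.block j) ξ ≠ 0) : ‖ξ‖ ≤ (n : ℝ) ^ (j + 1) := by
  have hn0 := φ.cast_pos
  rcases j with _ | j
  · rw [block_zero_symbol] at h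
    rw [zero_add, pow_one]
    exact not_lt.1 fun h' => h (φ.lowSymbol_eq_zero h')
  · rw [block_succ, fourierS_ndilate] at h
    have h1 : ‖((n : ℝ) ^ (j + 1))⁻¹ • ξ‖ ≤ n :=
      not_lt.1 fun h' => h (φ.fourierS_eq_zero (Or.inr h'))
    rw [norm_smul, Real.norm_of_nonneg (by positivity), inv_mul_le_iff₀ (by positivity)] at h1
    rwa [pow_succ]

theorem le_norm_of_symbol_ne_zero (φ : LittlewoodPaley d n) {j : ℕ} {ξ : E d}
    (h : fourierS (φ.block (j + 1)) ξ ≠ 0) : (n : ℝ) ^ j ≤ ‖ξ‖ := by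
  have hn0 := φ.cast_pos
  rw [block_succ, fourierS_ndilate] at h
  have h1 : (n : ℝ)⁻¹ ≤ ‖((n : ℝ) ^ (j + 1))⁻¹ • ξ‖ :=
    not_lt.1 fun h' => h (φ.fourierS_eq_zero (Or.inl h'))
  rw [norm_smul, Real.norm_of_nonneg (by positivity), le_inv_mul_iff₀ (by positivity)] at h1
  rwa [pow_succ, mul_assoc, mul_inv_cancel₀ hn0.ne', mul_one] at h1

/-- The partial sums of the blocks are the dilates of the block `0`. -/
theorem sum_block (φ : LittlewoodPaley d n) (J : ℕ) :
    ∑ j ∈ Finset.range (J + 1), φ.block j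
      = ndilate ((n : ℝ) ^ J) (pow_pos φ.cast_pos _) (φ.block 0) := by
  have hn0 := φ.cast_pos
  refine fourierS_ext fun ξ => ?_
  rw [fourierS_sum, sum_apply, fourierS_ndilate, block_zero_symbol, lowSymbol]
  -- The tail of the partition beyond `J` is the high-frequency series at the rescaled frequency
  -- `n^{-J} ξ`, so what remains is the rescaled low symbol.
  have h1 := (φ.hasSum_symbol ξ).summable.sum_add_tsum_nat_add (J + 1)
  rw [(φ.hasSum_symbol ξ).tsum_eq] at h1
  rw [eq_sub_iff_add_eq, ← h1]
  congr 2
  funext j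
  rw [show j + (J + 1) = (j + J) + 1 by ring, block_succ_symbol, smul_smul, ← zpow_natCast,
    ← zpow_neg, ← zpow_add₀ hn0.ne']
  congr 3
  push_cast
  ring

/-- The reproducing formula: the partition of unity multiplied by the symbol of `g`, in which only
the indices of `O` survive. -/
theorem sum_sconv_block (φ : LittlewoodPaley d n) (g : 𝓢(E d, ℂ)) (O : Finset ℕ)
    (hO : ∀ k ∉ O, sconv (φ.block k) g = 0) :
    ∑ k ∈ O, sconv (φ.block k) g = kap d • g := by
  refine fourierS_ext fun ξ => ?_
  rw [fourierS_sum, sum_apply, fourierS_smul, smul_apply, smul_eq_mul]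
  have h1 : HasSum (fun k => fourierS (sconv (φ.block k) g) ξ) (kap d * (1 * fourierS g ξ)) := by
    simp only [fourierS_sconv]
    exact ((φ.hasSum_symbol ξ).mul_right _).mul_left _
  rw [one_mul] at h1
  refine (hasSum_sum_of_ne_finset_zero fun k hk => ?_).unique h1
  rw [hO k hk]
  exact congrArg (fun h : 𝓢(E d, ℂ) => h ξ) (map_zero (fourierSCLM d))

theorem exists_eLpNorm_block_le (φ : LittlewoodPaley d n) :
    ∃ C : ℝ≥0, ∀ j, eLpNorm (φ.block j) 1 volume ≤ C := by
  refine ⟨(eLpNorm (φ.block 0) 1 volume + eLpNorm φ.ζ 1 volume).toNNReal, fun j => ?_⟩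
  rw [ENNReal.coe_toNNReal (ENNReal.add_ne_top.2
    ⟨((φ.block 0).eLpNorm_lt_top 1 volume).ne, (φ.ζ.eLpNorm_lt_top 1 volume).ne⟩)]
  rcases j with _ | j
  · exact le_self_add
  · rw [block_succ, eLpNorm_one_ndilate]
    exact le_add_self

end LittlewoodPaley

/-- The frequency scales `2^{aj}` and `2^{bk}` are comparable. -/
def Near (a b j k : ℕ) : Prop := a * j ≤ b * k + (a + b) ∧ b * k ≤ a * j + (a + b)

theorem Near.symm {a b j k : ℕ} (h : Near a b j k) : Near b a k j := by
  unfold Near at *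
  omega

/-- At a common frequency `ξ` one has `2^{a(j-1)} ≤ ‖ξ‖` for `j ≥ 1` and `‖ξ‖ ≤ 2^{b(k+1)}`, and
likewise with the roles exchanged; comparing exponents yields the tolerance `a + b`. -/
theorem near_of_sconv_block_ne_zero {d a b : ℕ} (φ : LittlewoodPaley d (2 ^ a))
    (ψ : LittlewoodPaley d (2 ^ b)) {j k : ℕ} (h : sconv (φ.block j) (ψ.block k) ≠ 0) :
    Near a b j k := by
  obtain ⟨ξ, hξ⟩ : ∃ ξ, fourierS (sconv (φ.block j) (ψ.block k)) ξ ≠ 0 := by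
    by_contra! H
    refine h (fourierS_ext fun ξ => ?_)
    rw [H ξ]
    exact (congrArg (fun h : 𝓢(E d, ℂ) => h ξ) (map_zero (fourierSCLM d))).symm
  rw [fourierS_sconv] at hξ
  have h1 := left_ne_zero_of_mul (right_ne_zero_of_mul hξ)
  have h2 := right_ne_zero_of_mul (right_ne_zero_of_mul hξ)
  have key : ∀ {a b : ℕ} (φ : LittlewoodPaley d (2 ^ a)) (ψ : LittlewoodPaley d (2 ^ b)) {j k : ℕ},
      fourierS (φ.block j) ξ ≠ 0 → fourierS (ψ.block k) ξ ≠ 0 → a * j ≤ b * k + (a + b) := by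
    intro a b φ ψ j k h1 h2
    rcases j with _ | j
    · simp
    have h3 := (φ.le_norm_of_symbol_ne_zero h1).trans (ψ.norm_le_of_symbol_ne_zero h2)
    push_cast at h3
    rw [← pow_mul, ← pow_mul, pow_le_pow_iff_right₀ one_lt_two] at h3
    nlinarith
  have h3 := key ψ φ h2 h1
  exact ⟨key φ ψ h1 h2, by omega⟩

/-! ### The quasi-norm of `ℓ_q` on sequences in `[0, ∞]` -/

section Elq

/-- The `ℓ_q` quasi-norm of a sequence in `[0, ∞]`. -/
def elq (q : ℝ≥0∞) (b : ℕ → ℝ≥0∞) : ℝ≥0∞ :=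
  if q = ∞ then ⨆ j, b j else (∑' j, b j ^ q.toReal) ^ (1 / q.toReal)

variable {q : ℝ≥0∞}

theorem elq_top (b : ℕ → ℝ≥0∞) : elq ∞ b = ⨆ j, b j := if_pos rfl

theorem elq_of_ne_top (hq : q ≠ ∞) (b : ℕ → ℝ≥0∞) :
    elq q b = (∑' j, b j ^ q.toReal) ^ (1 / q.toReal) := if_neg hq

theorem elq_mono {a b : ℕ → ℝ≥0∞} (h : ∀ j, a j ≤ b j) : elq q a ≤ elq q b := by
  unfold elq
  split_ifs
  · exact iSup_mono h
  · gcongr with j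
    exact h j

theorem elq_const_mul (hq : 0 < q) (K : ℝ≥0∞) (b : ℕ → ℝ≥0∞) :
    elq q (fun j => K * b j) = K * elq q b := by
  unfold elq
  split_ifs with hqt
  · rw [ENNReal.mul_iSup]
  · have hr : 0 < q.toReal := ENNReal.toReal_pos hq.ne' hqt
    simp only [ENNReal.mul_rpow_of_nonneg _ _ hr.le]
    rw [ENNReal.tsum_mul_left, ENNReal.mul_rpow_of_nonneg _ _ (by positivity), ← ENNReal.rpow_mul,
      mul_one_div_cancel hr.ne', ENNReal.rpow_one]

/-- The triangle inequalities for `ℓ_q` are inherited from `L_q` of the counting measure. -/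
theorem elq_eq_eLpNorm (hq : 0 < q) (b : ℕ → ℝ≥0∞) : elq q b = eLpNorm b q Measure.count := by
  unfold elq
  split_ifs with hqt
  · rw [hqt, eLpNorm_exponent_top, eLpNormEssSup, essSup_count]
    rfl
  · rw [eLpNorm_eq_lintegral_rpow_enorm_toReal hq.ne' hqt, lintegral_count]
    rfl

theorem elq_add_le' (hq : 0 < q) (a b : ℕ → ℝ≥0∞) :
    elq q (fun j => a j + b j) ≤ q.LpAddConst * (elq q a + elq q b) := by
  rw [elq_eq_eLpNorm hq, elq_eq_eLpNorm hq, elq_eq_eLpNorm hq]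
  exact eLpNorm_add_le' (.of_discrete) (.of_discrete) q

theorem elq_add_le (hq : 1 ≤ q) (a b : ℕ → ℝ≥0∞) :
    elq q (fun j => a j + b j) ≤ elq q a + elq q b := by
  have := elq_add_le' (zero_lt_one.trans_le hq) a b
  rwa [ENNReal.LpAddConst_of_one_le hq, one_mul] at this

theorem le_elq (hq : 0 < q) (b : ℕ → ℝ≥0∞) (j : ℕ) : b j ≤ elq q b := by
  unfold elq
  split_ifs with hqt
  · exact le_iSup b j
  · have hr : 0 < q.toReal := ENNReal.toReal_pos hq.ne' hqt
    rw [one_div, ENNReal.le_rpow_inv_iff hr]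
    exact ENNReal.le_tsum j

/-- Each entry is at most the `ℓ_{q₁}` quasi-norm `A`, so `b_j^{q₂} ≤ A^{q₂-q₁} b_j^{q₁}`, which
sums to `A^{q₂}`. -/
theorem elq_anti {q₁ q₂ : ℝ≥0∞} (h₁ : 0 < q₁) (h : q₁ ≤ q₂) (b : ℕ → ℝ≥0∞) :
    elq q₂ b ≤ elq q₁ b := by
  by_cases ht2 : q₂ = ∞
  · rw [ht2, elq_top]
    exact iSup_le fun j => le_elq h₁ b j
  have ht1 : q₁ ≠ ∞ := ne_top_of_le_ne_top ht2 h
  have hr1 : 0 < q₁.toReal := ENNReal.toReal_pos h₁.ne' ht1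
  have hr : q₁.toReal ≤ q₂.toReal := ENNReal.toReal_mono ht2 h
  have hr2 : 0 < q₂.toReal := hr1.trans_le hr
  by_cases hT : elq q₁ b = ∞
  · rw [hT]; exact le_top
  rw [elq_of_ne_top ht2, one_div, ENNReal.rpow_inv_le_iff hr2]
  calc ∑' j, b j ^ q₂.toReal
      ≤ ∑' j, elq q₁ b ^ (q₂.toReal - q₁.toReal) * b j ^ q₁.toReal := by
        refine ENNReal.tsum_le_tsum fun j => ?_
        calc b j ^ q₂.toReal = b j ^ (q₂.toReal - q₁.toReal) * b j ^ q₁.toReal := by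
              rw [← ENNReal.rpow_add_of_nonneg _ _ (by linarith) hr1.le, sub_add_cancel]
          _ ≤ _ := by
            gcongr
            exact le_elq h₁ b j
    _ = elq q₁ b ^ (q₂.toReal - q₁.toReal) * elq q₁ b ^ q₁.toReal := by
        rw [ENNReal.tsum_mul_left]
        congr 1
        rw [elq_of_ne_top ht1, ← ENNReal.rpow_mul, one_div_mul_cancel hr1.ne', ENNReal.rpow_one]
    _ = elq q₁ b ^ q₂.toReal := by
        rw [← ENNReal.rpow_add_of_nonneg _ _ (by linarith) hr1.le, sub_add_cancel]

/-- Fatou's lemma for `ℓ_q`. -/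
theorem elq_le_of_le_liminf (hq : 0 < q) {x : ℕ → ℝ≥0∞} {y : ℕ → ℕ → ℝ≥0∞} {ε : ℝ≥0∞}
    (hx : ∀ j, x j ≤ liminf (fun l => y l j) atTop) (hy : ∀ᶠ l in atTop, elq q (y l) ≤ ε) :
    elq q x ≤ ε := by
  by_cases hqt : q = ∞
  · subst hqt
    rw [elq_top]
    refine iSup_le fun j => (hx j).trans ?_
    refine liminf_le_of_frequently_le' (Eventually.frequently ?_)
    filter_upwards [hy] with l hl
    exact (le_elq hq _ j).trans hl
  have hr : 0 < q.toReal := ENNReal.toReal_pos hq.ne' hqt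
  rw [elq_of_ne_top hqt, one_div, ENNReal.rpow_inv_le_iff hr]
  have hx' : ∀ j, x j ^ q.toReal ≤ liminf (fun l => y l j ^ q.toReal) atTop := by
    intro j
    refine (ENNReal.rpow_le_rpow (hx j) hr.le).trans (le_of_eq ?_)
    -- A positive power is an order isomorphism of `[0, ∞]` and so commutes with the lower limit.
    exact (ENNReal.orderIsoRpow q.toReal hr).liminf_apply
  calc ∑' j, x j ^ q.toReal ≤ ∑' j, liminf (fun l => y l j ^ q.toReal) atTop :=
        ENNReal.tsum_le_tsum hx'
    _ = ∫⁻ j, liminf (fun l => y l j ^ q.toReal) atTop ∂Measure.count := (lintegral_count _).symm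
    _ ≤ liminf (fun l => ∫⁻ j, y l j ^ q.toReal ∂Measure.count) atTop :=
        lintegral_liminf_le fun l => .of_discrete
    _ ≤ ε ^ q.toReal := by
      refine liminf_le_of_frequently_le' (Eventually.frequently ?_)
      filter_upwards [hy] with l hl
      rw [elq_of_ne_top hqt, one_div, ENNReal.rpow_inv_le_iff hr] at hl
      rwa [lintegral_count]

/-- Dominated convergence for `ℓ_q`, `q < ∞`. -/
theorem tendsto_elq_zero {ι : Type*} {l : Filter ι} [l.IsCountablyGenerated] (hq : 0 < q)
    (hqt : q ≠ ∞) {b : ι → ℕ → ℝ≥0∞} {B : ℕ → ℝ≥0∞} (hB : elq q B ≠ ∞)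
    (hb : ∀ᶠ i in l, ∀ j, b i j ≤ B j) (h0 : ∀ j, Tendsto (fun i => b i j) l (𝓝 0)) :
    Tendsto (fun i => elq q (b i)) l (𝓝 0) := by
  have hr : 0 < q.toReal := ENNReal.toReal_pos hq.ne' hqt
  simp only [elq_of_ne_top hqt] at hB ⊢
  have h1 : Tendsto (fun i => ∫⁻ j, b i j ^ q.toReal ∂Measure.count) l
      (𝓝 (∫⁻ _, 0 ∂(Measure.count : Measure ℕ))) := by
    refine tendsto_lintegral_filter_of_dominated_convergence (fun j => B j ^ q.toReal)
      (.of_forall fun i => .of_discrete) ?_ ?_ ?_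
    · filter_upwards [hb] with i hi
      exact ae_of_all _ fun j => ENNReal.rpow_le_rpow (hi j) hr.le
    · rw [lintegral_count]
      intro h
      rw [h, ENNReal.top_rpow_of_pos (by positivity)] at hB
      exact hB rfl
    · refine ae_of_all _ fun j => ?_
      have := (h0 j).ennrpow_const q.toReal
      rwa [ENNReal.zero_rpow_of_pos hr] at this
  simp only [lintegral_count, tsum_zero] at h1
  have := h1.ennrpow_const (1 / q.toReal)
  rwa [ENNReal.zero_rpow_of_pos (by positivity)] at this

/-- The indices `k` with `2^{bk}` comparable to `2^{aj}`. -/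
def nearSet (a b j : ℕ) : Finset ℕ := by
  classical exact (Finset.range (a * j + (a + b) + 1)).filter fun k => Near a b j k

theorem mem_nearSet {a b j k : ℕ} (hb : 1 ≤ b) : k ∈ nearSet a b j ↔ Near a b j k := by
  classical
  unfold nearSet
  rw [Finset.mem_filter, Finset.mem_range]
  refine ⟨fun h => h.2, fun h => ⟨?_, h⟩⟩
  have := h.2
  nlinarith

/-- Bounded overlap, uniformly in `j`: shifting `b k` by `a + b - a j` embeds the set into an
interval of fixed length. The truncated subtraction is exact here because `a j ≤ b k + (a + b)`. -/
theorem card_nearSet_le (a b j : ℕ) (hb : 1 ≤ b) : (nearSet a b j).card ≤ 2 * (a + b) + 1 := by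
  have h : (nearSet a b j).card ≤ (Finset.range (2 * (a + b) + 1)).card := by
    refine Finset.card_le_card_of_injOn (fun k => b * k + (a + b) - a * j) ?_ ?_
    · intro k hk
      have := (mem_nearSet hb).1 hk
      unfold Near at this
      simp only [Finset.coe_range, Set.mem_Iio]
      omega
    · intro k hk k' hk' hkk
      have h1 := (mem_nearSet hb).1 hk
      have h2 := (mem_nearSet hb).1 hk'
      unfold Near at h1 h2
      simp only at hkk
      have : b * k = b * k' := by omega
      exact Nat.eq_of_mul_eq_mul_left hb this
  simpa using h

/-- The sum is at most the cardinality times its largest term; this crude bound treats `r < 1` and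
`r ≥ 1` alike. -/
theorem sum_rpow_le {ι : Type*} (s : Finset ι) (y : ι → ℝ≥0∞) {r : ℝ} (hr : 0 < r) :
    (∑ k ∈ s, y k) ^ r ≤ (s.card : ℝ≥0∞) ^ r * ∑ k ∈ s, y k ^ r := by
  rcases s.eq_empty_or_nonempty with rfl | hs
  · simp [hr]
  obtain ⟨k₀, hk₀, hmax⟩ := s.exists_max_image y hs
  calc (∑ k ∈ s, y k) ^ r ≤ (s.card * y k₀) ^ r := by
        refine ENNReal.rpow_le_rpow ?_ hr.le
        rw [← nsmul_eq_mul]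
        exact Finset.sum_le_card_nsmul s y _ hmax
    _ = (s.card : ℝ≥0∞) ^ r * y k₀ ^ r := ENNReal.mul_rpow_of_nonneg _ _ hr.le
    _ ≤ _ := by
        gcongr
        exact Finset.single_le_sum (f := fun k => y k ^ r) (fun _ _ => zero_le) hk₀

/-- Almost diagonal operators are bounded on `ℓ_q`. -/
theorem exists_elq_le_of_near {a b : ℕ} (ha : 1 ≤ a) (hb : 1 ≤ b) (hq : 0 < q) (C : ℝ≥0) :
    ∃ K : ℝ≥0, ∀ x y : ℕ → ℝ≥0∞, (∀ j, x j ≤ C * ∑ k ∈ nearSet a b j, y k) →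
      elq q x ≤ K * elq q y := by
  set M : ℝ≥0 := 2 * (a + b) + 1 with hM
  have hcard : ∀ j, ((nearSet a b j).card : ℝ≥0∞) ≤ M := fun j => by
    have := card_nearSet_le a b j hb
    rw [hM]
    exact_mod_cast this
  by_cases hqt : q = ∞
  · subst hqt
    refine ⟨C * M, fun x y h => ?_⟩
    rw [elq_top]
    refine iSup_le fun j => (h j).trans ?_
    rw [ENNReal.coe_mul, mul_assoc]
    gcongr
    calc ∑ k ∈ nearSet a b j, y k ≤ ∑ k ∈ nearSet a b j, elq ∞ y :=
          Finset.sum_le_sum fun k _ => le_elq hq y k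
      _ ≤ _ := by
        rw [Finset.sum_const, nsmul_eq_mul]
        gcongr
        exact hcard j
  have hr : 0 < q.toReal := ENNReal.toReal_pos hq.ne' hqt
  set r := q.toReal with hrdef
  have hfin : ((C : ℝ≥0∞) ^ r * (M : ℝ≥0∞) ^ r * M) ^ (1 / r) ≠ ∞ := by
    refine ENNReal.rpow_ne_top_of_nonneg (by positivity) ?_
    exact ENNReal.mul_ne_top (ENNReal.mul_ne_top (ENNReal.rpow_ne_top_of_nonneg hr.le (by simp))
      (ENNReal.rpow_ne_top_of_nonneg hr.le (by simp))) (by simp)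
  refine ⟨(((C : ℝ≥0∞) ^ r * (M : ℝ≥0∞) ^ r * M) ^ (1 / r)).toNNReal, fun x y h => ?_⟩
  rw [ENNReal.coe_toNNReal hfin, elq_of_ne_top hqt, elq_of_ne_top hqt,
    ← ENNReal.mul_rpow_of_nonneg _ _ (by positivity)]
  gcongr
  -- After exchanging the sums, each `k` is counted once for every `j` near it, hence at most `M`
  -- times, since nearness is symmetric.
  have hswap : ∑' j, ∑ k ∈ nearSet a b j, y k ^ r ≤ M * ∑' k, y k ^ r := by
    classical
    have h1 : ∀ j, ∑ k ∈ nearSet a b j, y k ^ r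
        = ∑' k, if k ∈ nearSet a b j then y k ^ r else 0 := by
      intro j
      rw [tsum_eq_sum (s := nearSet a b j) fun k hk => if_neg hk]
      exact Finset.sum_congr rfl fun k hk => (if_pos hk).symm
    simp only [h1]
    rw [ENNReal.tsum_comm, ← ENNReal.tsum_mul_left]
    refine ENNReal.tsum_le_tsum fun k => ?_
    have h2 : ∀ j, (if k ∈ nearSet a b j then y k ^ r else 0)
        = if j ∈ nearSet b a k then y k ^ r else 0 := by
      intro j
      have : k ∈ nearSet a b j ↔ j ∈ nearSet b a k := by
        rw [mem_nearSet hb, mem_nearSet ha]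
        exact ⟨Near.symm, Near.symm⟩
      simp only [this]
    simp only [h2]
    rw [tsum_eq_sum (s := nearSet b a k) fun j hj => if_neg hj,
      Finset.sum_congr rfl fun j hj => if_pos hj, Finset.sum_const, nsmul_eq_mul]
    gcongr
    have := card_nearSet_le b a k ha
    rw [hM, add_comm (a : ℝ≥0)]
    exact_mod_cast this
  calc ∑' j, x j ^ r ≤ ∑' j, (C : ℝ≥0∞) ^ r * (M : ℝ≥0∞) ^ r * ∑ k ∈ nearSet a b j, y k ^ r := by
        refine ENNReal.tsum_le_tsum fun j => ?_
        calc x j ^ r ≤ (C * ∑ k ∈ nearSet a b j, y k) ^ r := ENNReal.rpow_le_rpow (h j) hr.le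
          _ = (C : ℝ≥0∞) ^ r * (∑ k ∈ nearSet a b j, y k) ^ r :=
            ENNReal.mul_rpow_of_nonneg _ _ hr.le
          _ ≤ (C : ℝ≥0∞) ^ r * ((M : ℝ≥0∞) ^ r * ∑ k ∈ nearSet a b j, y k ^ r) := by
            gcongr
            refine (sum_rpow_le _ y hr).trans ?_
            gcongr
            exact hcard j
          _ = _ := by ring
    _ = (C : ℝ≥0∞) ^ r * (M : ℝ≥0∞) ^ r * ∑' j, ∑ k ∈ nearSet a b j, y k ^ r :=
        ENNReal.tsum_mul_left
    _ ≤ (C : ℝ≥0∞) ^ r * (M : ℝ≥0∞) ^ r * (M * ∑' k, y k ^ r) := by gcongr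
    _ = _ := by ring

theorem rpow_add_rpow_le {r : ℝ} (hr : 0 < r) (x T : ℝ≥0∞) :
    (x ^ r + T ^ r) ^ (1 / r) ≤ 2 ^ (1 / r) * (x + T) := by
  calc (x ^ r + T ^ r) ^ (1 / r)
      ≤ (2 * (x + T) ^ r) ^ (1 / r) := by
        refine ENNReal.rpow_le_rpow ?_ (by positivity)
        rw [two_mul]
        exact add_le_add (ENNReal.rpow_le_rpow le_self_add hr.le)
          (ENNReal.rpow_le_rpow le_add_self hr.le)
    _ = _ := by
      rw [ENNReal.mul_rpow_of_nonneg _ _ (by positivity), ← ENNReal.rpow_mul,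
        mul_one_div_cancel hr.ne', ENNReal.rpow_one]

theorem elq_rpow (hq : 0 < q) (hqt : q ≠ ∞) (b : ℕ → ℝ≥0∞) :
    elq q b ^ q.toReal = ∑' j, b j ^ q.toReal := by
  have hr : 0 < q.toReal := ENNReal.toReal_pos hq.ne' hqt
  rw [elq_of_ne_top hqt, ← ENNReal.rpow_mul, one_div_mul_cancel hr.ne', ENNReal.rpow_one]

/-- The `ℓ_q` quasi-norm in terms of the first entry and the tail. -/
theorem elq_le_zero_add_tail (hq : 0 < q) : ∃ K : ℝ≥0, ∀ b : ℕ → ℝ≥0∞,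
    elq q b ≤ K * (b 0 + elq q fun j => b (j + 1)) := by
  by_cases hqt : q = ∞
  · subst hqt
    refine ⟨1, fun b => ?_⟩
    rw [ENNReal.coe_one, one_mul, elq_top]
    refine iSup_le fun j => ?_
    rcases j with _ | j
    · exact le_self_add
    · exact (le_elq hq (fun j => b (j + 1)) j).trans le_add_self
  have hr : 0 < q.toReal := ENNReal.toReal_pos hq.ne' hqt
  refine ⟨2 ^ (1 / q.toReal), fun b => ?_⟩
  rw [ENNReal.coe_rpow_of_nonneg _ (by positivity)]
  have h1 : ∑' j, b j ^ q.toReal = b 0 ^ q.toReal + ∑' j, b (j + 1) ^ q.toReal :=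
    tsum_eq_zero_add' (f := fun j => b j ^ q.toReal) ENNReal.summable
  have h2 := rpow_add_rpow_le hr (b 0) (elq q fun j => b (j + 1))
  rw [elq_rpow hq hqt, ← h1, ← elq_of_ne_top hqt] at h2
  exact_mod_cast h2

theorem elq_tail_le (b : ℕ → ℝ≥0∞) : elq q (fun j => b (j + 1)) ≤ elq q b := by
  unfold elq
  split_ifs
  · exact iSup_le fun j => le_iSup b (j + 1)
  · refine ENNReal.rpow_le_rpow ?_ (by positivity)
    exact ENNReal.tsum_comp_le_tsum_of_injective (add_left_injective 1) (fun j => b j ^ q.toReal)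

end Elq

/-! ### Weights -/

section Weights

/-- The weights `s(c^{-j})^{-γ/2}`, `j ≥ 0`. -/
def gw (c : ℕ) (s : ℝ → ℝ) (γ : ℝ) (j : ℕ) : ℝ≥0∞ :=
  ENNReal.ofReal (s ((c : ℝ) ^ (-(j : ℤ))) ^ (-γ / 2))

variable {c : ℕ} {s : ℝ → ℝ} {γ : ℝ} {q : ℝ≥0∞}

theorem gw_ne_top (j : ℕ) : gw c s γ j ≠ ∞ := ENNReal.ofReal_ne_top

theorem zpow_neg_pos (hc : 0 < c) (j : ℤ) : (0 : ℝ) < (c : ℝ) ^ (-j) := by positivity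

theorem gw_ne_zero (hc : 0 < c) (hs : ∀ r, 0 < r → 0 < s r) (j : ℕ) : gw c s γ j ≠ 0 := by
  rw [gw, Ne, ENNReal.ofReal_eq_zero, not_le]
  exact Real.rpow_pos_of_pos (hs _ (zpow_neg_pos hc _)) _

theorem lqENorm_eq (hc : 0 < c) (hs : ∀ r, 0 < r → 0 < s r) (hq : 0 < q) (a : ℕ → ℝ≥0∞) :
    lqENorm c s γ q a = a 0 + elq q fun j => gw c s γ (j + 1) * a (j + 1) := by
  have hcast : ∀ j : ℕ, gw c s γ (j + 1)
      = ENNReal.ofReal (s ((c : ℝ) ^ (-((j : ℤ) + 1))) ^ (-γ / 2)) := fun j => by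
    rw [gw]; push_cast; rfl
  unfold lqENorm elq
  split_ifs with hqt
  · simp only [hcast]
  · have hr : 0 < q.toReal := ENNReal.toReal_pos hq.ne' hqt
    congr 3
    funext j
    beta_reduce
    rw [hcast, ENNReal.mul_rpow_of_nonneg _ _ hr.le]
    congr 1
    have hpos := hs _ (zpow_neg_pos hc ((j : ℤ) + 1))
    rw [ENNReal.ofReal_rpow_of_pos (Real.rpow_pos_of_pos hpos _), ← Real.rpow_mul hpos.le]
    congr 2
    ring

/-- The defining norm adds the unweighted entry 0 to the tail. Up to constants it is a single
weighted `ℓ_q` quasi-norm over all indices, for which almost diagonal estimates need no special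
case; the converse bound follows. -/
theorem exists_lqENorm_le (hc : 0 < c) (hs : ∀ r, 0 < r → 0 < s r) (hq : 0 < q) (γ : ℝ) :
    ∃ K : ℝ≥0, ∀ a : ℕ → ℝ≥0∞, lqENorm c s γ q a ≤ K * elq q fun j => gw c s γ j * a j := by
  have h0 := gw_ne_zero (γ := γ) hc hs 0
  refine ⟨(gw c s γ 0)⁻¹.toNNReal + 1, fun a => ?_⟩
  rw [lqENorm_eq hc hs hq, ENNReal.coe_add, ENNReal.coe_toNNReal (ENNReal.inv_ne_top.2 h0),
    ENNReal.coe_one, add_mul, one_mul]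
  refine add_le_add ?_ (elq_tail_le fun j => gw c s γ j * a j)
  calc a 0 = (gw c s γ 0)⁻¹ * (gw c s γ 0 * a 0) := by
        rw [← mul_assoc, ENNReal.inv_mul_cancel h0 (gw_ne_top 0), one_mul]
    _ ≤ _ := by
        gcongr
        exact le_elq hq (fun j => gw c s γ j * a j) 0

theorem exists_le_lqENorm (hc : 0 < c) (hs : ∀ r, 0 < r → 0 < s r) (hq : 0 < q) (γ : ℝ) :
    ∃ K : ℝ≥0, ∀ a : ℕ → ℝ≥0∞, elq q (fun j => gw c s γ j * a j) ≤ K * lqENorm c s γ q a := by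
  obtain ⟨K, hK⟩ := elq_le_zero_add_tail hq
  refine ⟨K * ((gw c s γ 0).toNNReal + 1), fun a => ?_⟩
  refine (hK _).trans ?_
  rw [lqENorm_eq hc hs hq, ENNReal.coe_mul, ENNReal.coe_add, ENNReal.coe_toNNReal (gw_ne_top 0),
    ENNReal.coe_one, mul_assoc]
  gcongr
  rw [add_mul, one_mul]
  refine add_le_add ?_ le_add_self
  gcongr
  exact le_self_add

/-- Comparison of two weighted sequence quasi-norms under an almost diagonal estimate. -/
theorem exists_lqENorm_le_of_near {a b : ℕ} (ha : 1 ≤ a) (hb : 1 ≤ b) {s s' : ℝ → ℝ}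
    (hs : ∀ r, 0 < r → 0 < s r) (hs' : ∀ r, 0 < r → 0 < s' r) {γ γ' : ℝ} (hq : 0 < q) {C C' : ℝ≥0}
    (hw : ∀ j k, Near a b j k → gw (2 ^ a) s γ j ≤ C * gw (2 ^ b) s' γ' k) :
    ∃ K : ℝ≥0, ∀ x y : ℕ → ℝ≥0∞, (∀ j, x j ≤ C' * ∑ k ∈ nearSet a b j, y k) →
      lqENorm (2 ^ a) s γ q x ≤ K * lqENorm (2 ^ b) s' γ' q y := by
  obtain ⟨K₁, h₁⟩ := exists_lqENorm_le (c := 2 ^ a) (by positivity) hs hq γ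
  obtain ⟨K₂, h₂⟩ := exists_elq_le_of_near ha hb hq (C' * C)
  obtain ⟨K₃, h₃⟩ := exists_le_lqENorm (c := 2 ^ b) (by positivity) hs' hq γ'
  refine ⟨K₁ * (K₂ * K₃), fun x y h => (h₁ x).trans ?_⟩
  rw [ENNReal.coe_mul, ENNReal.coe_mul, mul_assoc, mul_assoc]
  gcongr
  refine (h₂ _ (fun k => gw (2 ^ b) s' γ' k * y k) fun j => ?_).trans (by gcongr; exact h₃ y)
  calc gw (2 ^ a) s γ j * x j ≤ gw (2 ^ a) s γ j * (C' * ∑ k ∈ nearSet a b j, y k) := by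
        gcongr; exact h j
    _ = C' * ∑ k ∈ nearSet a b j, gw (2 ^ a) s γ j * y k := by
        rw [Finset.mul_sum, Finset.mul_sum, Finset.mul_sum]
        exact Finset.sum_congr rfl fun k _ => by ring
    _ ≤ C' * ∑ k ∈ nearSet a b j, C * gw (2 ^ b) s' γ' k * y k := by
        gcongr with k hk
        exact hw j k ((mem_nearSet hb).1 hk)
    _ = _ := by
        rw [ENNReal.coe_mul, mul_assoc, Finset.mul_sum (a := (C : ℝ≥0∞))]
        congr 1
        exact Finset.sum_congr rfl fun k _ => by ring

end Weights

/-! ### Growth of the weights of a scaling triple -/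

namespace ScalingTriple

variable (S : ScalingTriple)

theorem m_spec : 1 ≤ S.m ∧ 1 < S.sL (2 ^ S.m) := by
  have hne : {m : ℕ | 1 ≤ m ∧ 1 < S.sL (2 ^ m)}.Nonempty := by
    have h1 : Tendsto (fun m : ℕ => S.sL (2 ^ m)) atTop atTop :=
      S.sL_top.comp (tendsto_pow_atTop_atTop_of_one_lt one_lt_two)
    obtain ⟨m, hm⟩ := ((h1.eventually_gt_atTop 1).and (eventually_ge_atTop 1)).exists
    exact ⟨m, hm.2, hm.1⟩
  exact Nat.sInf_mem hne

theorem c_eq : S.c = 2 ^ S.m := rfl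

theorem c_pos : 0 < S.c := by
  rw [c_eq]; positivity

theorem c_cast : (S.c : ℝ) = 2 ^ S.m := by
  rw [c_eq]; push_cast; rfl

theorem one_lt_c : (1 : ℝ) < S.c := by
  rw [c_cast]
  exact one_lt_pow₀ one_lt_two (by have := S.m_spec.1; omega)

theorem one_lt_sL : 1 < S.sL S.c := by
  rw [c_cast]; exact S.m_spec.2

/-- The values `s(c^{-j})`. -/
def sig (j : ℕ) : ℝ := S.s ((S.c : ℝ) ^ (-(j : ℤ)))

theorem sig_pos (j : ℕ) : 0 < S.sig j := S.s_pos _ (zpow_neg_pos S.c_pos _)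

theorem gw_eq (γ : ℝ) (j : ℕ) : gw S.c S.s γ j = ENNReal.ofReal (S.sig j ^ (-γ / 2)) := rfl

theorem sig_ratio (j : ℕ) : S.sL S.c ≤ S.sig j / S.sig (j + 1) ∧
    S.sig j / S.sig (j + 1) ≤ S.sU S.c := by
  have hc := zpow_neg_pos S.c_pos
  have hle : (S.c : ℝ) ^ (-((j + 1 : ℕ) : ℤ)) ≤ (S.c : ℝ) ^ (-(j : ℤ)) :=
    zpow_le_zpow_right₀ S.one_lt_c.le (by push_cast; omega)
  have hdiv : (S.c : ℝ) ^ (-(j : ℤ)) / (S.c : ℝ) ^ (-((j + 1 : ℕ) : ℤ)) = S.c := by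
    rw [← zpow_sub₀ (by have := S.one_lt_c; positivity)]
    push_cast
    rw [show -(j : ℤ) - -((j : ℤ) + 1) = 1 by ring, zpow_one]
  have h1 := S.le_ratio _ _ (hc ((j + 1 : ℕ) : ℤ)) hle
  have h2 := S.ratio_le _ _ (hc ((j + 1 : ℕ) : ℤ)) hle
  rw [hdiv] at h1 h2
  exact ⟨h1, h2⟩

theorem sL_le_sU : S.sL S.c ≤ S.sU S.c := (S.sig_ratio 0).1.trans (S.sig_ratio 0).2

theorem one_lt_sU : 1 < S.sU S.c := S.one_lt_sL.trans_le S.sL_le_sU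

theorem log_sig_succ (j : ℕ) :
    Real.log (S.sL S.c) ≤ Real.log (S.sig j) - Real.log (S.sig (j + 1)) ∧
    Real.log (S.sig j) - Real.log (S.sig (j + 1)) ≤ Real.log (S.sU S.c) := by
  rw [← Real.log_div (S.sig_pos j).ne' (S.sig_pos _).ne']
  have hpos : 0 < S.sL S.c := zero_lt_one.trans S.one_lt_sL
  exact ⟨Real.log_le_log hpos (S.sig_ratio j).1,
    Real.log_le_log (hpos.trans_le (S.sig_ratio j).1) (S.sig_ratio j).2⟩

/-- In logarithmic form the bounds for consecutive scales add up: `-log s(c_s^{-j})` has increments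
between two positive constants. -/
theorem log_sig_add (j i : ℕ) :
    i * Real.log (S.sL S.c) ≤ Real.log (S.sig j) - Real.log (S.sig (j + i)) ∧
    Real.log (S.sig j) - Real.log (S.sig (j + i)) ≤ i * Real.log (S.sU S.c) := by
  induction i with
  | zero => simp
  | succ i ih =>
    have := S.log_sig_succ (j + i)
    rw [← add_assoc]
    push_cast
    constructor <;> linarith [ih.1, ih.2, this.1, this.2]

theorem log_sL_pos : 0 < Real.log (S.sL S.c) := Real.log_pos S.one_lt_sL

theorem log_sU_pos : 0 < Real.log (S.sU S.c) := Real.log_pos S.one_lt_sU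

/-- This is where `s_L(c_s) > 1`, the reason for the choice of `c_s`, matters: `s` itself is not
assumed monotone. -/
theorem sig_anti : Antitone S.sig := by
  refine antitone_nat_of_succ_le fun j => ?_
  have h := (S.log_sig_succ j).1
  have h2 := S.log_sL_pos
  exact (Real.log_le_log_iff (S.sig_pos _) (S.sig_pos _)).1 (by linarith)

/-- With equal bases, nearness means `|j - k| ≤ 2`, and each step changes the logarithm by at most
`log s_U(c_s)`. -/
theorem log_sig_near {j k : ℕ} (h : Near S.m S.m j k) :
    |Real.log (S.sig j) - Real.log (S.sig k)| ≤ 2 * Real.log (S.sU S.c) := by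
  have hm := S.m_spec.1
  have key : ∀ {j k : ℕ}, j ≤ k → k ≤ j + 2 →
      |Real.log (S.sig j) - Real.log (S.sig k)| ≤ 2 * Real.log (S.sU S.c) := by
    intro j k h1 h2
    obtain ⟨i, rfl⟩ := Nat.exists_eq_add_of_le h1
    have h3 := S.log_sig_add j i
    have hi : (i : ℝ) ≤ 2 := by exact_mod_cast (by omega : i ≤ 2)
    have h4 := S.log_sL_pos
    have h5 := S.log_sU_pos
    rw [abs_le]
    constructor
    · have : (0 : ℝ) ≤ i * Real.log (S.sL S.c) := by positivity
      linarith [h3.1]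
    · nlinarith [h3.2]
  have h1 : j ≤ k + 2 := by
    have := h.1
    by_contra hlt
    have : S.m * (k + 3) ≤ S.m * j := Nat.mul_le_mul_left _ (by omega)
    nlinarith
  have h2 : k ≤ j + 2 := by
    have := h.2
    by_contra hlt
    have : S.m * (j + 3) ≤ S.m * k := Nat.mul_le_mul_left _ (by omega)
    nlinarith
  rcases le_total j k with hjk | hjk
  · exact key hjk h2
  · rw [abs_sub_comm]
    exact key hjk h1

theorem sig_rpow (x : ℝ) (j : ℕ) : S.sig j ^ x = Real.exp (x * Real.log (S.sig j)) := by
  rw [Real.rpow_def_of_pos (S.sig_pos j), mul_comm]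

theorem exists_gw_le_near (γ : ℝ) : ∃ C : ℝ≥0, ∀ j k, Near S.m S.m j k →
    gw (2 ^ S.m) S.s γ j ≤ C * gw (2 ^ S.m) S.s γ k := by
  refine ⟨Real.toNNReal (Real.exp (|γ| * Real.log (S.sU S.c))), fun j k h => ?_⟩
  rw [← c_eq, gw_eq, gw_eq, ← ENNReal.ofReal, ← ENNReal.ofReal_mul (Real.exp_nonneg _)]
  refine ENNReal.ofReal_le_ofReal ?_
  rw [sig_rpow, sig_rpow, ← Real.exp_add, Real.exp_le_exp]
  have h1 := S.log_sig_near h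
  have h2 : -γ / 2 * (Real.log (S.sig j) - Real.log (S.sig k))
      ≤ |-γ / 2| * |Real.log (S.sig j) - Real.log (S.sig k)| := by
    rw [← abs_mul]; exact le_abs_self _
  rw [abs_div, abs_neg, abs_two] at h2
  nlinarith [abs_nonneg γ]

/-- The weights grow at most geometrically. -/
theorem exists_gw_le_geom (γ : ℝ) : ∃ C A : ℝ≥0, ∀ j, gw S.c S.s γ j ≤ C * A ^ j := by
  refine ⟨Real.toNNReal (Real.exp (-γ / 2 * Real.log (S.sig 0))),
    Real.toNNReal (Real.exp (|γ| / 2 * Real.log (S.sU S.c))), fun j => ?_⟩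
  rw [gw_eq, ← ENNReal.ofReal, ← ENNReal.ofReal, ← ENNReal.ofReal_pow (Real.exp_nonneg _),
    ← ENNReal.ofReal_mul (Real.exp_nonneg _)]
  refine ENNReal.ofReal_le_ofReal ?_
  rw [sig_rpow, ← Real.exp_nat_mul, ← Real.exp_add, Real.exp_le_exp]
  have h1 := S.log_sig_add 0 j
  rw [zero_add] at h1
  have h4 : (0 : ℝ) ≤ j * Real.log (S.sL S.c) := by have := S.log_sL_pos; positivity
  have h3 : γ / 2 * (Real.log (S.sig 0) - Real.log (S.sig j))
      ≤ |γ| / 2 * (Real.log (S.sig 0) - Real.log (S.sig j)) :=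
    mul_le_mul_of_nonneg_right (by linarith [le_abs_self γ]) (by linarith)
  have h2 : |γ| / 2 * (Real.log (S.sig 0) - Real.log (S.sig j))
      ≤ |γ| / 2 * (j * Real.log (S.sU S.c)) :=
    mul_le_mul_of_nonneg_left h1.2 (by positivity)
  linarith

/-- Geometric lower bounds for the weights are thus the upper bounds for the opposite order. -/
theorem gw_neg (γ : ℝ) (j : ℕ) : gw S.c S.s (-γ) j = (gw S.c S.s γ j)⁻¹ := by
  rw [gw_eq, gw_eq, ← ENNReal.ofReal_inv_of_pos (Real.rpow_pos_of_pos (S.sig_pos j) _),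
    ← Real.rpow_neg (S.sig_pos j).le]
  congr 2
  ring

theorem log_c : Real.log S.c = S.m * Real.log 2 := by
  rw [c_cast, Real.log_pow]

theorem θ₀_mul_log : S.θ₀ * (S.m * Real.log 2) = Real.log (S.sL S.c) := by
  rw [θ₀, Real.logb, ← log_c, div_mul_cancel₀ _ (Real.log_pos S.one_lt_c).ne']

theorem θ₁_mul_log : S.θ₁ * (S.m * Real.log 2) = Real.log (S.sU S.c) := by
  rw [θ₁, Real.logb, ← log_c, div_mul_cancel₀ _ (Real.log_pos S.one_lt_c).ne']

theorem gw_two_id (σ : ℝ) (k : ℕ) : gw (2 ^ 1) (fun x => x) σ k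
    = ENNReal.ofReal (Real.exp (k * (σ / 2 * Real.log 2))) := by
  rw [gw]
  congr 1
  have h2 : (0 : ℝ) < ((2 ^ 1 : ℕ) : ℝ) ^ (-(k : ℤ)) := by positivity
  rw [Real.rpow_def_of_pos h2, Real.log_zpow]
  congr 1
  push_cast
  ring

theorem abs_near_mul_le {j k : ℕ} (h : Near S.m 1 j k) (σ : ℝ) :
    |(S.m * j - k : ℝ) * (σ / 2 * Real.log 2)| ≤ (S.m + 1) * |σ| := by
  have h1 : (S.m * j : ℝ) ≤ k + (S.m + 1) := by exact_mod_cast (by simpa using h.1)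
  have h2 : (k : ℝ) ≤ S.m * j + (S.m + 1) := by exact_mod_cast (by simpa using h.2)
  have h3 : |(S.m * j - k : ℝ)| ≤ S.m + 1 := by
    rw [abs_le]; constructor <;> linarith
  have h4 : |σ / 2 * Real.log 2| ≤ |σ| := by
    have h5 := Real.log_two_lt_d9
    have h6 : 0 < Real.log 2 := Real.log_pos one_lt_two
    rw [abs_mul, abs_div, abs_two, abs_of_pos h6]
    nlinarith [abs_nonneg σ]
  rw [abs_mul]
  exact mul_le_mul h3 h4 (abs_nonneg _) (by positivity)

/-- The bounds on `log s` have slopes `θ₀ log c_s` and `θ₁ log c_s`; multiplication by `γ` exchanges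
their roles when `γ < 0`, which accounts for the minimum and the maximum. -/
theorem γ_mul_log_sig_bounds (γ : ℝ) (j : ℕ) :
    j * (min (S.θ₀ * γ) (S.θ₁ * γ) * (S.m * Real.log 2))
      ≤ γ * (Real.log (S.sig 0) - Real.log (S.sig j)) ∧
    γ * (Real.log (S.sig 0) - Real.log (S.sig j))
      ≤ j * (max (S.θ₀ * γ) (S.θ₁ * γ) * (S.m * Real.log 2)) := by
  have h1 := S.log_sig_add 0 j
  rw [zero_add, ← θ₀_mul_log, ← θ₁_mul_log] at h1
  have hL : (0 : ℝ) ≤ j * (S.m * Real.log 2) := by positivity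
  rcases le_total 0 γ with hγ | hγ
  · have a1 := mul_le_mul_of_nonneg_left h1.1 hγ
    have a2 := mul_le_mul_of_nonneg_left h1.2 hγ
    have a3 := mul_le_mul_of_nonneg_right (min_le_left (S.θ₀ * γ) (S.θ₁ * γ)) hL
    have a4 := mul_le_mul_of_nonneg_right (le_max_right (S.θ₀ * γ) (S.θ₁ * γ)) hL
    constructor <;> linarith
  · have a1 := mul_le_mul_of_nonpos_left h1.1 hγ
    have a2 := mul_le_mul_of_nonpos_left h1.2 hγ
    have a3 := mul_le_mul_of_nonneg_right (min_le_right (S.θ₀ * γ) (S.θ₁ * γ)) hL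
    have a4 := mul_le_mul_of_nonneg_right (le_max_left (S.θ₀ * γ) (S.θ₁ * γ)) hL
    constructor <;> linarith

theorem exists_gw_le_classical (γ : ℝ) : ∃ C : ℝ≥0, ∀ j k, Near S.m 1 j k →
    gw (2 ^ S.m) S.s γ j
      ≤ C * gw (2 ^ 1) (fun x => x) (max (S.θ₀ * γ) (S.θ₁ * γ)) k := by
  set σ := max (S.θ₀ * γ) (S.θ₁ * γ) with hσ
  -- The first term normalizes the weight at `j = 0`; the second pays for the mismatch `|m j - k| ≤
  -- m + 1` between the two dyadic scales.
  refine ⟨Real.toNNReal (Real.exp (-γ / 2 * Real.log (S.sig 0) + (S.m + 1) * |σ|)),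
    fun j k h => ?_⟩
  rw [← c_eq, gw_eq, gw_two_id, ← ENNReal.ofReal, ← ENNReal.ofReal_mul (Real.exp_nonneg _)]
  refine ENNReal.ofReal_le_ofReal ?_
  rw [sig_rpow, ← Real.exp_add, Real.exp_le_exp]
  have h1 := (S.γ_mul_log_sig_bounds γ j).2
  have h2 := (abs_le.1 (S.abs_near_mul_le h σ)).2
  rw [← hσ] at h1
  linarith

theorem exists_classical_le_gw (γ : ℝ) : ∃ C : ℝ≥0, ∀ k j, Near 1 S.m k j →
    gw (2 ^ 1) (fun x => x) (min (S.θ₀ * γ) (S.θ₁ * γ)) k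
      ≤ C * gw (2 ^ S.m) S.s γ j := by
  set σ := min (S.θ₀ * γ) (S.θ₁ * γ) with hσ
  refine ⟨Real.toNNReal (Real.exp (γ / 2 * Real.log (S.sig 0) + (S.m + 1) * |σ|)),
    fun k j h => ?_⟩
  rw [← c_eq, gw_eq, gw_two_id, ← ENNReal.ofReal, ← ENNReal.ofReal_mul (Real.exp_nonneg _)]
  refine ENNReal.ofReal_le_ofReal ?_
  rw [sig_rpow, ← Real.exp_add, Real.exp_le_exp]
  have h1 := (S.γ_mul_log_sig_bounds γ j).1
  have h2 := (abs_le.1 (S.abs_near_mul_le h.symm σ)).1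
  rw [← hσ] at h1
  linarith

end ScalingTriple

/-! ### Comparison of Besov quasi-norms -/

section Comparison

variable {d : ℕ}

theorem besovENorm_eq_lqENorm {n : ℕ} (φ : LittlewoodPaley d n) (s : ℝ → ℝ) (γ : ℝ) (p q : ℝ≥0∞)
    (f : 𝓢'(E d, ℂ)) :
    besovENorm φ s γ p q f = lqENorm n s γ q fun j => eLpNorm (conv f (φ.block j)) p volume := rfl

theorem LittlewoodPaley.one_le_log {a : ℕ} (φ : LittlewoodPaley d (2 ^ a)) : 1 ≤ a := by
  have := φ.two_le
  by_contra h
  have : a = 0 := by omega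
  subst this
  omega

theorem conv_smul_right (f : 𝓢'(E d, ℂ)) (a : ℂ) (g : 𝓢(E d, ℂ)) :
    conv f (a • g) = a • conv f g := by
  funext x
  have : reflectTranslate (a • g) x = a • reflectTranslate g x := by
    ext y; simp [reflectTranslate_apply]
  rw [conv, this, map_smul]
  rfl

theorem conv_sum_right {ι : Type*} (f : 𝓢'(E d, ℂ)) (s : Finset ι) (g : ι → 𝓢(E d, ℂ)) :
    conv f (∑ i ∈ s, g i) = ∑ i ∈ s, conv f (g i) := by
  funext x
  have : reflectTranslate (∑ i ∈ s, g i) x = ∑ i ∈ s, reflectTranslate (g i) x := by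
    ext y; simp [reflectTranslate_apply, sum_apply]
  rw [conv, this, map_sum, Finset.sum_apply]
  rfl

/-- Insert the reproducing formula for `φ.block j` in terms of the `ψ.block k` and apply Young's
inequality, with the uniform `L¹` bound falling on `φ.block j`. The two bases may differ, so this
serves both the classical comparison and the independence of `φ`. -/
theorem eLpNorm_conv_block_le {a b : ℕ} (φ : LittlewoodPaley d (2 ^ a))
    (ψ : LittlewoodPaley d (2 ^ b)) : ∃ C : ℝ≥0, ∀ p : ℝ≥0∞, 1 ≤ p → ∀ (f : 𝓢'(E d, ℂ)) (j : ℕ),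
      eLpNorm (conv f (φ.block j)) p volume
        ≤ C * ∑ k ∈ nearSet a b j, eLpNorm (conv f (ψ.block k)) p volume := by
  obtain ⟨C, hC⟩ := φ.exists_eLpNorm_block_le
  refine ⟨‖(kap d)⁻¹‖₊ * C, fun p hp f j => ?_⟩
  have h0 : ∀ k ∉ nearSet a b j, sconv (ψ.block k) (φ.block j) = 0 := by
    intro k hk
    by_contra h
    rw [sconv_comm] at h
    exact hk ((mem_nearSet ψ.one_le_log).2 (near_of_sconv_block_ne_zero φ ψ h))
  have h1 : φ.block j = (kap d)⁻¹ • ∑ k ∈ nearSet a b j, sconv (ψ.block k) (φ.block j) := by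
    rw [ψ.sum_sconv_block _ _ h0, smul_smul, inv_mul_cancel₀ (kap_ne_zero d), one_smul]
  calc eLpNorm (conv f (φ.block j)) p volume
      = ‖(kap d)⁻¹‖ₑ * eLpNorm (∑ k ∈ nearSet a b j, conv f (sconv (ψ.block k) (φ.block j)))
          p volume := by
        conv_lhs => rw [h1]
        rw [conv_smul_right, eLpNorm_const_smul, conv_sum_right]
    _ ≤ ‖(kap d)⁻¹‖ₑ * ∑ k ∈ nearSet a b j, C * eLpNorm (conv f (ψ.block k)) p volume := by
        gcongr
        refine (eLpNorm_sum_le (fun k _ => (continuous_conv _ _).aestronglyMeasurable) hp).trans ?_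
        refine Finset.sum_le_sum fun k _ => (eLpNorm_conv_sconv_le f _ _ hp).trans ?_
        gcongr
        exact hC j
    _ = _ := by
        rw [← Finset.mul_sum, ENNReal.coe_mul, mul_assoc]
        rfl

theorem exists_besovENorm_le {a b : ℕ} (φ : LittlewoodPaley d (2 ^ a))
    (ψ : LittlewoodPaley d (2 ^ b)) {s s' : ℝ → ℝ}
    (hs : ∀ r, 0 < r → 0 < s r) (hs' : ∀ r, 0 < r → 0 < s' r) {γ γ' : ℝ} {p q : ℝ≥0∞} (hp : 1 ≤ p)
    (hq : 0 < q) {C : ℝ≥0} (hw : ∀ j k, Near a b j k → gw (2 ^ a) s γ j ≤ C * gw (2 ^ b) s' γ' k) :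
    ∃ K : ℝ≥0, ∀ f, besovENorm φ s γ p q f ≤ K * besovENorm ψ s' γ' p q f := by
  obtain ⟨C', hC'⟩ := eLpNorm_conv_block_le φ ψ
  obtain ⟨K, hK⟩ := exists_lqENorm_le_of_near φ.one_le_log ψ.one_le_log hs hs' hq (C' := C') hw
  exact ⟨K, fun f => hK _ _ fun j => hC' p hp f j⟩

theorem exists_scaledBesovENorm_le (S : ScalingTriple) (φ ϑ : LittlewoodPaley d S.c) (γ : ℝ)
    {p q : ℝ≥0∞} (hp : 1 ≤ p) (hq : 0 < q) :
    ∃ K : ℝ≥0, ∀ f, scaledBesovENorm S φ γ p q f ≤ K * scaledBesovENorm S ϑ γ p q f := by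
  obtain ⟨C, hC⟩ := S.exists_gw_le_near γ
  exact exists_besovENorm_le (a := S.m) (b := S.m) φ ϑ S.s_pos S.s_pos hp hq hC

theorem le_mul_add_one {N N' : ℝ≥0∞} {K K' : ℝ≥0} (h : N ≤ K * N') :
    N ≤ ((K + K' + 1 : ℝ≥0) : ℝ≥0∞) * N' := by
  refine h.trans ?_
  gcongr
  rw [add_assoc]
  exact le_self_add

theorem equivENorm_of_le {V : Type*} {N N' : V → ℝ≥0∞} (h₁ : ∃ K : ℝ≥0, ∀ f, N f ≤ K * N' f)
    (h₂ : ∃ K : ℝ≥0, ∀ f, N' f ≤ K * N f) : EquivENorm N N' := by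
  obtain ⟨K, hK⟩ := h₁
  obtain ⟨K', hK'⟩ := h₂
  refine ⟨K + K' + 1, by positivity, fun f => ⟨le_mul_add_one (hK f), ?_⟩⟩
  rw [add_comm K]
  exact le_mul_add_one (hK' f)

/-- Equivalence of the quasi-norms for different Littlewood-Paley functions. -/
theorem scaledBesovENorm_equiv (S : ScalingTriple) (φ ϑ : LittlewoodPaley d S.c) (γ : ℝ)
    {p q : ℝ≥0∞} (hp : 1 ≤ p) (hq : 0 < q) :
    EquivENorm (scaledBesovENorm S φ γ p q) (scaledBesovENorm S ϑ γ p q) :=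
  equivENorm_of_le (exists_scaledBesovENorm_le S φ ϑ γ hp hq)
    (exists_scaledBesovENorm_le S ϑ φ γ hp hq)

/-- Comparison with the classical Besov quasi-norms. -/
theorem scaledBesovENorm_classical (S : ScalingTriple) (φ : LittlewoodPaley d S.c)
    (ζ : LittlewoodPaley d 2) (γ : ℝ) {p q : ℝ≥0∞} (hp : 1 ≤ p) (hq : 0 < q) :
    ∃ N : ℝ≥0, 0 < N ∧ ∀ f : 𝓢'(E d, ℂ),
      (N : ℝ≥0∞)⁻¹ * classicalBesovENorm ζ (min (S.θ₀ * γ) (S.θ₁ * γ)) p q f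
          ≤ scaledBesovENorm S φ γ p q f ∧
      scaledBesovENorm S φ γ p q f
          ≤ N * classicalBesovENorm ζ (max (S.θ₀ * γ) (S.θ₁ * γ)) p q f := by
  obtain ⟨C, hC⟩ := S.exists_gw_le_classical γ
  obtain ⟨C', hC'⟩ := S.exists_classical_le_gw γ
  obtain ⟨K, hK⟩ := exists_besovENorm_le (a := S.m) (b := 1) φ ζ S.s_pos (s' := fun x => x)
    (fun _ h => h) hp hq hC
  obtain ⟨K', hK'⟩ := exists_besovENorm_le (a := 1) (b := S.m) ζ φ (s := fun x => x)
    (fun _ h => h) S.s_pos hp hq hC'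
  refine ⟨K + K' + 1, by positivity, fun f => ⟨?_, le_mul_add_one (hK f)⟩⟩
  rw [← ENNReal.div_eq_inv_mul]
  refine ENNReal.div_le_of_le_mul' ?_
  rw [add_comm K]
  exact le_mul_add_one (hK' f)

end Comparison

/-! ### Cutting off Schwartz functions -/

section Cutoff

variable {d : ℕ}

/-- The pointwise product of Schwartz functions. -/
def smulS (u g : 𝓢(E d, ℂ)) : 𝓢(E d, ℂ) := SchwartzMap.pairing (ContinuousLinearMap.mul ℂ ℂ) u g

theorem smulS_apply (u g : 𝓢(E d, ℂ)) (x : E d) : smulS u g x = u x * g x :=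
  SchwartzMap.pairing_apply_apply _ u g x

/-- The difference lives where `‖x‖ ≥ t⁻¹`. There `1 ≤ t ‖x‖`, so the factor `t` is bought with one
more power of `‖x‖`, which `g` can afford. -/
theorem seminorm_smulS_dilate_sub_le (χ : 𝓢(E d, ℂ)) (hχ : ∀ x, ‖x‖ < 1 → χ x = 1)
    (g : 𝓢(E d, ℂ)) (k n : ℕ) : ∃ C : ℝ, ∀ (t : ℝ) (ht : 0 < t), t ≤ 1 →
      SchwartzMap.seminorm ℂ k n (smulS (dilate t ht.ne' χ) g - g) ≤ C * t := by
  -- `B i` bounds the `i`-th derivative of `χ (t ·) - 1` for all `t ≤ 1`; the `+ 1` is for the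
  -- subtracted constant when `i = 0`.
  set B : ℕ → ℝ := fun i => SchwartzMap.seminorm ℂ 0 i χ + 1 with hB
  have hB0 : ∀ i, 0 ≤ B i := fun i => by positivity
  refine ⟨∑ i ∈ Finset.range (n + 1), (n.choose i : ℝ) * B i *
    SchwartzMap.seminorm ℂ (k + 1) (n - i) g, fun t ht ht1 => ?_⟩
  have hC0 : 0 ≤ ∑ i ∈ Finset.range (n + 1), (n.choose i : ℝ) * B i *
    SchwartzMap.seminorm ℂ (k + 1) (n - i) g :=
    Finset.sum_nonneg fun i _ => mul_nonneg (mul_nonneg (by positivity) (hB0 i)) (apply_nonneg _ _)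
  refine SchwartzMap.seminorm_le_bound ℂ k n _ (by positivity) fun x => ?_
  have hfun : ⇑(smulS (dilate t ht.ne' χ) g - g) = fun y => (χ (t • y) - 1) * g y := by
    funext y
    rw [sub_apply, smulS_apply, dilate_apply]
    ring
  rw [hfun]
  by_cases hx : ‖x‖ < t⁻¹
  · have : (fun y => (χ (t • y) - 1) * g y) =ᶠ[𝓝 x] fun _ => (0 : ℂ) := by
      have : ∀ᶠ y in 𝓝 x, ‖y‖ < t⁻¹ := (isOpen_lt continuous_norm continuous_const).mem_nhds hx
      filter_upwards [this] with y hy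
      rw [hχ, sub_self, zero_mul]
      rw [norm_smul, Real.norm_of_nonneg ht.le]
      calc t * ‖y‖ < t * t⁻¹ := by gcongr
        _ = 1 := mul_inv_cancel₀ ht.ne'
    rw [(this.iteratedFDeriv ℝ n).eq_of_nhds, iteratedFDeriv_fun_zero]
    simp only [Pi.zero_apply, norm_zero, mul_zero]
    positivity
  · rw [not_lt] at hx
    have htx : 1 ≤ t * ‖x‖ := by
      calc 1 = t * t⁻¹ := (mul_inv_cancel₀ ht.ne').symm
        _ ≤ _ := by gcongr
    have hsm : ContDiff ℝ (⊤ : ℕ∞) fun y => χ (t • y) - 1 :=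
      ((χ.smooth ⊤).comp (contDiff_const_smul t)).sub contDiff_const
    have hbound : ∀ i, ‖iteratedFDeriv ℝ i (fun y => χ (t • y) - 1) x‖ ≤ B i := by
      intro i
      rcases i with _ | i
      · rw [norm_iteratedFDeriv_zero]
        refine (norm_sub_le _ _).trans ?_
        rw [norm_one]
        have := SchwartzMap.norm_le_seminorm ℂ χ (t • x)
        simp only [hB]
        linarith
      · have h1 : iteratedFDeriv ℝ (i + 1) (fun y => χ (t • y) - 1) x
            = iteratedFDeriv ℝ (i + 1) (fun y => χ (t • y)) x := by
          have := iteratedFDeriv_sub_apply (𝕜 := ℝ) (i := i + 1) (f := fun y => χ (t • y))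
            (g := fun _ : E d => (1 : ℂ)) (x := x)
            ((χ.smooth _).comp (contDiff_const_smul t)).contDiffAt contDiff_const.contDiffAt
          rw [iteratedFDeriv_succ_const, Pi.zero_apply, sub_zero] at this
          exact this
        rw [h1, iteratedFDeriv_comp_const_smul t (χ.smooth _), norm_smul, norm_pow,
          Real.norm_of_nonneg ht.le]
        have h2 := SchwartzMap.norm_iteratedFDeriv_le_seminorm ℂ χ (i + 1) (t • x)
        have h3 : t ^ (i + 1) ≤ 1 := pow_le_one₀ ht.le ht1
        simp only [hB]
        nlinarith [norm_nonneg (iteratedFDeriv ℝ (i + 1) χ (t • x)), pow_pos ht (i + 1)]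
    have hL := norm_iteratedFDeriv_mul_le hsm (g.smooth ⊤) x (n := n)
      (by exact_mod_cast le_top)
    calc ‖x‖ ^ k * ‖iteratedFDeriv ℝ n (fun y => (χ (t • y) - 1) * g y) x‖
        ≤ ‖x‖ ^ k * (∑ i ∈ Finset.range (n + 1), (n.choose i : ℝ) *
          ‖iteratedFDeriv ℝ i (fun y => χ (t • y) - 1) x‖ * ‖iteratedFDeriv ℝ (n - i) g x‖) := by
          gcongr
      _ ≤ (t * ‖x‖) * (‖x‖ ^ k * (∑ i ∈ Finset.range (n + 1), (n.choose i : ℝ) *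
          ‖iteratedFDeriv ℝ i (fun y => χ (t • y) - 1) x‖ * ‖iteratedFDeriv ℝ (n - i) g x‖)) :=
          le_mul_of_one_le_left (by positivity) htx
      _ = ∑ i ∈ Finset.range (n + 1), ((n.choose i : ℝ) *
          ‖iteratedFDeriv ℝ i (fun y => χ (t • y) - 1) x‖ *
            (‖x‖ ^ (k + 1) * ‖iteratedFDeriv ℝ (n - i) g x‖)) * t := by
          rw [Finset.mul_sum, Finset.mul_sum]
          exact Finset.sum_congr rfl fun i _ => by ring
      _ ≤ _ := by
          rw [← Finset.sum_mul]
          gcongr with i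
          · exact hbound i
          · exact SchwartzMap.le_seminorm ℂ (k + 1) (n - i) g x

/-- Cutting off a Schwartz function at infinity. -/
theorem tendsto_smulS_dilate {ι : Type*} {l : Filter ι} (χ : 𝓢(E d, ℂ))
    (hχ : ∀ x, ‖x‖ < 1 → χ x = 1) (g : 𝓢(E d, ℂ)) {t : ι → ℝ} (ht : ∀ i, 0 < t i)
    (ht0 : Tendsto t l (𝓝 0)) :
    Tendsto (fun i => smulS (dilate (t i) (ht i).ne' χ) g) l (𝓝 g) := by
  rw [(schwartz_withSeminorms ℂ (E d) ℂ).tendsto_nhds]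
  rintro ⟨k, n⟩ ε hε
  obtain ⟨C, hC⟩ := seminorm_smulS_dilate_sub_le χ hχ g k n
  have h1 : Tendsto (fun i => C * t i) l (𝓝 0) := by simpa using ht0.const_mul C
  filter_upwards [h1.eventually_lt_const hε, ht0.eventually_le_const one_pos] with i hi hi1
  exact (hC (t i) (ht i) hi1).trans_lt hi

/-- Compactly supported smooth functions are dense in the Schwartz space. -/
theorem exists_seq_hasCompactSupport (g : 𝓢(E d, ℂ)) :
    ∃ u : ℕ → 𝓢(E d, ℂ), (∀ i, HasCompactSupport (u i)) ∧ Tendsto u atTop (𝓝 g) := by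
  let b : ContDiffBump (0 : E d) := ⟨1, 2, one_pos, one_lt_two⟩
  have hc : HasCompactSupport fun x => ((b x : ℝ) : ℂ) :=
    b.hasCompactSupport.comp_left (g := fun r : ℝ => (r : ℂ)) Complex.ofReal_zero
  have hsm : ContDiff ℝ (⊤ : ℕ∞) fun x => ((b x : ℝ) : ℂ) := Complex.ofRealCLM.contDiff.comp b.contDiff
  let χ : 𝓢(E d, ℂ) := hc.toSchwartzMap hsm
  have hχ : ∀ x, ‖x‖ < 1 → χ x = 1 := by
    intro x hx
    change ((b x : ℝ) : ℂ) = 1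
    rw [b.one_of_mem_closedBall (by simpa using hx.le), Complex.ofReal_one]
  have ht : ∀ i : ℕ, (0 : ℝ) < 1 / ((i : ℝ) + 1) := fun i => by positivity
  refine ⟨fun i => smulS (dilate (1 / ((i : ℝ) + 1)) (ht i).ne' χ) g, fun i => ?_,
    tendsto_smulS_dilate χ hχ g ht tendsto_one_div_add_atTop_nhds_zero_nat⟩
  have h1 : HasCompactSupport fun x => χ ((1 / ((i : ℝ) + 1)) • x) := by
    have hcχ : HasCompactSupport χ := hc
    exact hcχ.comp_smul (ht i).ne'
  have h2 : ⇑(smulS (dilate (1 / ((i : ℝ) + 1)) (ht i).ne' χ) g)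
      = fun x => χ ((1 / ((i : ℝ) + 1)) • x) * g x := by
    funext x
    rw [smulS_apply, dilate_apply]
  rw [h2]
  exact h1.mul_right

/-- The inverse Fourier transform as a continuous linear map. -/
def fourierInvSCLM (d : ℕ) : 𝓢(E d, ℂ) →L[ℂ] 𝓢(E d, ℂ) :=
  (((2 * Real.pi) ^ (-(d : ℝ) / 2) : ℝ) : ℂ) •
    (SchwartzMap.compCLMOfContinuousLinearEquiv ℂ (ContinuousLinearEquiv.smulLeft (R₁ := ℝ)
      (M₁ := E d) (Units.mk0 _ two_pi_inv_ne_zero))).comp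
      (FourierTransform.fourierInvCLM ℂ 𝓢(E d, ℂ))

theorem fourierInvSCLM_apply (f : 𝓢(E d, ℂ)) : fourierInvSCLM d f = fourierInvS f := rfl

theorem fourierInvS_fourierS (f : 𝓢(E d, ℂ)) : fourierInvS (fourierS f) = f :=
  fourierS_ext fun ξ => by rw [fourierS_fourierInvS]

/-- The reflection as a continuous linear map. -/
def reflCLM (d : ℕ) : 𝓢(E d, ℂ) →L[ℂ] 𝓢(E d, ℂ) :=
  SchwartzMap.compCLMOfContinuousLinearEquiv ℂ
    (ContinuousLinearEquiv.smulLeft (R₁ := ℝ) (M₁ := E d) (Units.mk0 (-1 : ℝ) (by norm_num)))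

theorem reflCLM_apply (f : 𝓢(E d, ℂ)) : reflCLM d f = refl f := rfl

/-- The partial sums have the symbols `lowSymbol (n^{-J} ·)`, so on the Fourier side this is the
cutoff of a Schwartz function at growing radii. -/
theorem tendsto_sum_sconv_block {n : ℕ} (φ : LittlewoodPaley d n) (g : 𝓢(E d, ℂ)) :
    Tendsto (fun J => sconv (∑ j ∈ Finset.range (J + 1), φ.block j) g) atTop
      (𝓝 (kap d • g)) := by
  have hn0 := φ.cast_pos
  have ht : ∀ J : ℕ, (0 : ℝ) < ((n : ℝ) ^ J)⁻¹ := fun J => by positivity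
  have ht0 : Tendsto (fun J : ℕ => ((n : ℝ) ^ J)⁻¹) atTop (𝓝 0) :=
    (tendsto_pow_atTop_atTop_of_one_lt φ.one_lt_cast).inv_tendsto_atTop
  have h1 := tendsto_smulS_dilate (fourierS (φ.block 0))
    (fun x hx => by rw [φ.block_zero_symbol, φ.lowSymbol_eq_one hx]) (fourierS g) ht ht0
  have h2 := (((fourierInvSCLM d).continuous.tendsto _).comp h1).const_smul (kap d)
  rw [fourierInvSCLM_apply, fourierInvS_fourierS] at h2
  refine h2.congr fun J => ?_
  simp only [Function.comp_apply, fourierInvSCLM_apply]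
  refine fourierS_ext fun ξ => ?_
  rw [fourierS_smul, fourierS_fourierInvS, smul_apply, smulS_apply, dilate_apply, φ.sum_block,
    fourierS_sconv, fourierS_ndilate, smul_eq_mul]

/-- The Littlewood-Paley decomposition of a tempered distribution. -/
theorem tendsto_sum_dconv_block {n : ℕ} (φ : LittlewoodPaley d n) (f : 𝓢'(E d, ℂ))
    (g : 𝓢(E d, ℂ)) :
    Tendsto (fun J => ∑ j ∈ Finset.range (J + 1), dconv f (φ.block j) g) atTop
      (𝓝 (kap d * f g)) := by
  -- By transposition the kernels act on `g` through their reflections; hence the convergence is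
  -- used for `refl g` and reflected back.
  have h1 : Tendsto (fun J => f (reflCLM d (sconv (∑ j ∈ Finset.range (J + 1), φ.block j)
      (refl g)))) atTop (𝓝 (f (reflCLM d (kap d • refl g)))) :=
    (((f.continuous.comp (reflCLM d).continuous).tendsto _).comp
      (tendsto_sum_sconv_block φ (refl g)))
  have h2 : f (reflCLM d (kap d • refl g)) = kap d * f g := by
    rw [map_smul, reflCLM_apply, refl_refl, map_smul, smul_eq_mul]
  rw [h2] at h1
  refine h1.congr fun J => ?_
  rw [sum_sconv, map_sum, map_sum]
  refine Finset.sum_congr rfl fun j _ => ?_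
  rw [reflCLM_apply, refl_sconv, refl_refl, dconv_apply]

end Cutoff

/-! ### The Laplacian and decay of the blocks -/

section Decay

variable {d : ℕ}

open Laplacian LineDeriv

/-- The Laplacian on Schwartz functions. -/
def lapS (d : ℕ) : 𝓢(E d, ℂ) →L[ℂ] 𝓢(E d, ℂ) := LineDeriv.laplacianCLM ℂ (E d) 𝓢(E d, ℂ)

theorem lapS_apply (g : 𝓢(E d, ℂ)) : lapS d g = Δ g := SchwartzMap.laplacianCLM_eq ℂ g

theorem fourierS_lapS (g : 𝓢(E d, ℂ)) (ξ : E d) :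
    fourierS (lapS d g) ξ = -((‖ξ‖ ^ 2 : ℝ) : ℂ) * fourierS g ξ := by
  have hg : (fun x : E d => ‖x‖ ^ 2).HasTemperateGrowth := by fun_prop
  rw [lapS_apply, SchwartzMap.laplacian_eq_fourierMultiplierCLM, fourierS_eq, fourierS_eq,
    FourierTransform.fourier_smul, smul_apply, SchwartzMap.fourierMultiplierCLM_apply,
    FourierTransform.fourier_fourierInv_eq, SchwartzMap.smulLeftCLM_apply_apply hg, norm_smul,
    Real.norm_of_nonneg (inv_pos.2 two_pi_pos).le]
  simp only [Complex.real_smul]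
  have hpi : (Real.pi : ℂ) ≠ 0 := by exact_mod_cast Real.pi_ne_zero
  push_cast
  field_simp

theorem lapS_pow_succ (M : ℕ) (g : 𝓢(E d, ℂ)) :
    (lapS d ^ (M + 1)) g = lapS d ((lapS d ^ M) g) := by
  rw [pow_succ', mul_apply_eq_comp]

theorem fourierS_lapS_pow (M : ℕ) (g : 𝓢(E d, ℂ)) (ξ : E d) :
    fourierS ((lapS d ^ M) g) ξ = (-((‖ξ‖ ^ 2 : ℝ) : ℂ)) ^ M * fourierS g ξ := by
  induction M with
  | zero => simp
  | succ M ih => rw [lapS_pow_succ, fourierS_lapS, ih, pow_succ]; ring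

theorem lapS_pow_ndilate (M : ℕ) (a : ℝ) (ha : 0 < a) (g : 𝓢(E d, ℂ)) :
    (lapS d ^ M) (ndilate a ha g) = ((a : ℂ) ^ (2 * M)) • ndilate a ha ((lapS d ^ M) g) := by
  have ha' : (a : ℂ) ≠ 0 := Complex.ofReal_ne_zero.2 ha.ne'
  refine fourierS_ext fun ξ => ?_
  rw [fourierS_lapS_pow, fourierS_smul, smul_apply, fourierS_ndilate, fourierS_ndilate,
    fourierS_lapS_pow, smul_eq_mul, norm_smul, Real.norm_of_nonneg (inv_pos.2 ha).le, pow_mul,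
    ← mul_assoc, ← mul_pow]
  congr 2
  push_cast
  field_simp

/-- The symbol of `ζ` vanishes near the origin, so dividing it by `(-‖ξ‖²)^M` leaves a smooth
compactly supported function. This provides vanishing moments of any order. -/
theorem exists_lapS_pow_eq {n : ℕ} (φ : LittlewoodPaley d n) (M : ℕ) :
    ∃ ψ : 𝓢(E d, ℂ), (lapS d ^ M) ψ = φ.ζ := by
  have hn : (0 : ℝ) < (n : ℝ)⁻¹ := inv_pos.2 φ.cast_pos
  set u : E d → ℂ := fun ξ => fourierS φ.ζ ξ * ((-((‖ξ‖ ^ 2 : ℝ) : ℂ)) ^ M)⁻¹ with hu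
  have hu0 : ∀ ξ : E d, ‖ξ‖ < (n : ℝ)⁻¹ → u ξ = 0 := fun ξ h => by
    simp only [hu, φ.fourierS_eq_zero (Or.inl h), zero_mul]
  have hsm : ContDiff ℝ (⊤ : ℕ∞) u := by
    rw [contDiff_iff_contDiffAt]
    intro ξ
    by_cases hξ : ξ = 0
    · have : u =ᶠ[𝓝 ξ] fun _ => 0 := by
        have : ∀ᶠ y in 𝓝 ξ, ‖y‖ < (n : ℝ)⁻¹ :=
          (isOpen_lt continuous_norm continuous_const).mem_nhds (by simpa [hξ] using hn)
        filter_upwards [this] with y hy using hu0 y hy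
      exact contDiffAt_const.congr_of_eventuallyEq this
    · refine ((fourierS φ.ζ).smooth ⊤).contDiffAt.mul (ContDiffAt.inv ?_ ?_)
      · have h1 : ContDiff ℝ (⊤ : ℕ∞) fun ξ : E d => ((‖ξ‖ ^ 2 : ℝ) : ℂ) :=
          Complex.ofRealCLM.contDiff.comp (contDiff_norm_sq ℝ)
        exact (h1.neg.pow M).contDiffAt
      · refine pow_ne_zero _ (neg_ne_zero.2 (Complex.ofReal_ne_zero.2 ?_))
        have := norm_pos_iff.2 hξ
        positivity
  have hcs : HasCompactSupport u := by
    refine HasCompactSupport.intro (isCompact_closedBall (0 : E d) n) fun ξ hξ => ?_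
    rw [mem_closedBall_zero_iff, not_le] at hξ
    simp only [hu, φ.fourierS_eq_zero (Or.inr hξ), zero_mul]
  refine ⟨fourierInvS (hcs.toSchwartzMap hsm), fourierS_ext fun ξ => ?_⟩
  rw [fourierS_lapS_pow, fourierS_fourierInvS]
  change _ * u ξ = _
  by_cases hξ : ξ = 0
  · rw [hu0 ξ (by simpa [hξ] using hn), mul_zero,
      φ.fourierS_eq_zero (Or.inl (by simpa [hξ] using hn))]
  · have h1 : (-((‖ξ‖ ^ 2 : ℝ) : ℂ)) ^ M ≠ 0 := by
      refine pow_ne_zero _ (neg_ne_zero.2 (Complex.ofReal_ne_zero.2 ?_))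
      have := norm_pos_iff.2 hξ
      positivity
    simp only [hu]
    field_simp

theorem lineDerivOp_reflectTranslate (m : E d) (u : 𝓢(E d, ℂ)) (x : E d) :
    ∂_{m} (reflectTranslate u x) = -reflectTranslate (∂_{m} u) x := by
  ext y
  rw [neg_apply, reflectTranslate_apply, SchwartzMap.lineDerivOp_apply_eq_fderiv,
    SchwartzMap.lineDerivOp_apply_eq_fderiv]
  have h1 : ⇑(reflectTranslate u x) = fun y => u (x - y) :=
    funext fun y => reflectTranslate_apply u x y
  have h2 := (u.hasFDerivAt (x - y)).comp y ((hasFDerivAt_id y).const_sub x)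
  have h3 : HasFDerivAt (fun y => u (x - y)) _ y := h2
  rw [h1, h3.fderiv]
  simp

theorem reflectTranslate_sum {ι : Type*} (s : Finset ι) (g : ι → 𝓢(E d, ℂ)) (x : E d) :
    reflectTranslate (∑ i ∈ s, g i) x = ∑ i ∈ s, reflectTranslate (g i) x := by
  ext y; simp [reflectTranslate_apply, sum_apply]

/-- The signs produced by the reflection cancel because the operator has even order. -/
theorem lapS_reflectTranslate (u : 𝓢(E d, ℂ)) (x : E d) :
    lapS d (reflectTranslate u x) = reflectTranslate (lapS d u) x := by
  have b := stdOrthonormalBasis ℝ (E d)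
  rw [lapS_apply, lapS_apply, SchwartzMap.laplacian_eq_sum b, SchwartzMap.laplacian_eq_sum b,
    reflectTranslate_sum]
  refine Finset.sum_congr rfl fun i _ => ?_
  rw [lineDerivOp_reflectTranslate, LineDeriv.lineDerivOp_neg, lineDerivOp_reflectTranslate, neg_neg]

theorem lapS_pow_reflectTranslate (M : ℕ) (u : 𝓢(E d, ℂ)) (x : E d) :
    (lapS d ^ M) (reflectTranslate u x) = reflectTranslate ((lapS d ^ M) u) x := by
  induction M with
  | zero => simp
  | succ M ih => rw [lapS_pow_succ, ih, lapS_reflectTranslate, lapS_pow_succ]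

/-- A distribution with `Δ^M T = F` has small blocks. -/
theorem conv_block_succ_eq {n : ℕ} (φ : LittlewoodPaley d n) {M : ℕ} {ψ : 𝓢(E d, ℂ)}
    (hψ : (lapS d ^ M) ψ = φ.ζ) {T : 𝓢'(E d, ℂ)} {F : E d → ℂ}
    (hT : ∀ u : 𝓢(E d, ℂ), T ((lapS d ^ M) u) = ∫ y, u y * F y) (k : ℕ) :
    conv T (φ.block (k + 1)) = ((((n : ℂ) ^ (k + 1)) ^ (2 * M))⁻¹) • fun x =>
      ∫ y, ndilate ((n : ℝ) ^ (k + 1)) (pow_pos φ.cast_pos _) ψ (x - y) * F y := by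
  have hn : (n : ℂ) ≠ 0 := by exact_mod_cast φ.cast_ne_zero
  -- The Laplacian scales by the square of the dilation factor: this is the source of the gain
  -- `n^{-2M(k+1)}`. The operator itself is then moved onto `T`.
  have h1 : φ.block (k + 1) = ((((n : ℂ) ^ (k + 1)) ^ (2 * M))⁻¹) •
      (lapS d ^ M) (ndilate ((n : ℝ) ^ (k + 1)) (pow_pos φ.cast_pos _) ψ) := by
    rw [lapS_pow_ndilate, hψ, φ.block_succ, smul_smul]
    push_cast
    rw [inv_mul_cancel₀ (by positivity), one_smul]
  rw [h1, conv_smul_right]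
  congr 1
  funext x
  rw [conv, ← lapS_pow_reflectTranslate, hT]
  simp only [reflectTranslate_apply]

theorem enorm_inv_natCast_pow {n : ℕ} (hn : 0 < n) (k M : ℕ) :
    ‖(((n : ℂ) ^ (k + 1)) ^ (2 * M))⁻¹‖ₑ = ((n : ℝ≥0∞) ^ (2 * M))⁻¹ ^ (k + 1) := by
  rw [← enorm_norm, norm_inv, norm_pow, norm_pow, Complex.norm_natCast]
  rw [enorm_inv (by positivity), enorm_pow, enorm_pow, Real.enorm_natCast, ← ENNReal.inv_pow,
    ← pow_mul, ← pow_mul, mul_comm]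

theorem exists_eLpNorm_conv_block_succ_le {n : ℕ} (φ : LittlewoodPaley d n) (M : ℕ) :
    ∃ C : ℝ≥0, ∀ (T : 𝓢'(E d, ℂ)) (F : E d → ℂ), AEStronglyMeasurable F volume →
      (∀ u : 𝓢(E d, ℂ), T ((lapS d ^ M) u) = ∫ y, u y * F y) → ∀ p : ℝ≥0∞, 1 ≤ p → ∀ k : ℕ,
      eLpNorm (conv T (φ.block (k + 1))) p volume
        ≤ C * ((n : ℝ≥0∞) ^ (2 * M))⁻¹ ^ (k + 1) * eLpNorm F p volume := by
  obtain ⟨ψ, hψ⟩ := exists_lapS_pow_eq φ M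
  refine ⟨(eLpNorm ψ 1 volume).toNNReal, fun T F hF hT p hp k => ?_⟩
  rw [ENNReal.coe_toNNReal (ψ.eLpNorm_lt_top 1 volume).ne, conv_block_succ_eq φ hψ hT,
    eLpNorm_const_smul, enorm_inv_natCast_pow (zero_lt_two.trans_le φ.two_le), mul_comm (eLpNorm ψ 1 volume), mul_assoc]
  gcongr
  refine (eLpNorm_integral_mul_le _ hF hp).trans ?_
  rw [eLpNorm_one_ndilate]

/-- A variant that assumes only `F ∈ L¹` for a useful bound: the kernel is estimated in the supremum
norm, at the price of the dilation factor `n^{d(k+1)}`. It is meant for `p = ∞`, where functions in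
`C̃^∞` offer no assumed bound. -/
theorem exists_eLpNorm_top_conv_block_succ_le {n : ℕ} (φ : LittlewoodPaley d n) (M : ℕ) :
    ∃ C : ℝ≥0, ∀ (T : 𝓢'(E d, ℂ)) (F : E d → ℂ),
      (∀ u : 𝓢(E d, ℂ), T ((lapS d ^ M) u) = ∫ y, u y * F y) → ∀ k : ℕ,
      eLpNorm (conv T (φ.block (k + 1))) ∞ volume
        ≤ C * (((n : ℝ≥0∞) ^ (2 * M))⁻¹ * (n : ℝ≥0∞) ^ d) ^ (k + 1) * eLpNorm F 1 volume := by
  obtain ⟨ψ, hψ⟩ := exists_lapS_pow_eq φ M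
  obtain ⟨K, hK0, hK⟩ := ψ.decay 0 0
  refine ⟨K.toNNReal, fun T F hT k => ?_⟩
  have hn := φ.cast_pos
  rw [conv_block_succ_eq φ hψ hT, eLpNorm_const_smul, enorm_inv_natCast_pow (zero_lt_two.trans_le φ.two_le), mul_pow,
    mul_left_comm, mul_assoc, mul_assoc]
  gcongr
  rw [eLpNorm_exponent_top, eLpNorm_one_eq_lintegral_enorm]
  refine essSup_le_of_ae_le _ (ae_of_all _ fun x => ?_)
  refine (enorm_integral_le_lintegral_enorm _).trans ?_
  rw [← mul_assoc, ← lintegral_const_mul' _ _ (by simp [ENNReal.mul_eq_top])]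
  refine lintegral_mono fun y => ?_
  rw [enorm_mul]
  gcongr
  rw [ndilate_apply, enorm_mul, mul_comm]
  gcongr
  · rw [← ofReal_norm]
    refine ENNReal.ofReal_le_ofReal ?_
    simpa using hK _
  · rw [← enorm_norm, norm_pow, Complex.norm_of_nonneg (by positivity), enorm_pow, enorm_pow,
      Real.enorm_natCast, ← pow_mul, ← pow_mul, mul_comm]

end Decay

/-! ### Bounds by continuous seminorms -/

section Control

variable {d : ℕ}

/-- `Q` is bounded by a continuous seminorm on the Schwartz space. -/
def IsControl (Q : 𝓢(E d, ℂ) → ℝ≥0∞) : Prop :=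
  ∃ p : Seminorm ℂ 𝓢(E d, ℂ), Continuous p ∧ ∀ g, Q g ≤ ENNReal.ofReal (p g)

theorem IsControl.mono {Q R : 𝓢(E d, ℂ) → ℝ≥0∞} (hR : IsControl R) (h : ∀ g, Q g ≤ R g) :
    IsControl Q := by
  obtain ⟨p, hp, hpR⟩ := hR
  exact ⟨p, hp, fun g => (h g).trans (hpR g)⟩

theorem IsControl.add {Q R : 𝓢(E d, ℂ) → ℝ≥0∞} (hQ : IsControl Q) (hR : IsControl R) :
    IsControl fun g => Q g + R g := by
  obtain ⟨p, hp, hpQ⟩ := hQ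
  obtain ⟨r, hr, hrR⟩ := hR
  refine ⟨p + r, hp.add hr, fun g => ?_⟩
  rw [add_apply, ENNReal.ofReal_add (apply_nonneg _ _) (apply_nonneg _ _)]
  exact add_le_add (hpQ g) (hrR g)

theorem IsControl.const_mul {Q : 𝓢(E d, ℂ) → ℝ≥0∞} (hQ : IsControl Q) {C : ℝ≥0∞} (hC : C ≠ ∞) :
    IsControl fun g => C * Q g := by
  obtain ⟨p, hp, hpQ⟩ := hQ
  lift C to ℝ≥0 using hC
  refine ⟨C • p, (continuous_const.mul hp :), fun g => ?_⟩
  have : (C • p) g = C * p g := rfl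
  rw [this, ENNReal.ofReal_mul NNReal.zero_le_coe, ENNReal.ofReal_coe_nnreal]
  exact mul_le_mul_right (hpQ g) _

theorem IsControl.ne_top {Q : 𝓢(E d, ℂ) → ℝ≥0∞} (hQ : IsControl Q) (g : 𝓢(E d, ℂ)) : Q g ≠ ∞ := by
  obtain ⟨p, hp, hpQ⟩ := hQ
  exact ((hpQ g).trans_lt ENNReal.ofReal_lt_top).ne

theorem IsControl.tendsto {Q : 𝓢(E d, ℂ) → ℝ≥0∞} (hQ : IsControl Q) {ι : Type*} {l : Filter ι}
    {u : ι → 𝓢(E d, ℂ)} (hu : Tendsto u l (𝓝 0)) : Tendsto (fun i => Q (u i)) l (𝓝 0) := by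
  obtain ⟨p, hp, hpQ⟩ := hQ
  have h1 : Tendsto (fun i => ENNReal.ofReal (p (u i))) l (𝓝 0) := by
    have := ENNReal.tendsto_ofReal ((hp.tendsto 0).comp hu)
    simpa using this
  exact tendsto_of_tendsto_of_tendsto_of_le_of_le tendsto_const_nhds h1 (fun _ => bot_le)
    fun i => hpQ _

theorem isControl_eLpNorm (L : 𝓢(E d, ℂ) →L[ℂ] 𝓢(E d, ℂ)) {r : ℝ≥0∞} (hr : 1 ≤ r) :
    IsControl fun g => eLpNorm (L g) r volume := by
  have : Fact (1 ≤ r) := ⟨hr⟩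
  refine ⟨(normSeminorm ℂ (Lp ℂ r (volume : Measure (E d)))).comp
    ((SchwartzMap.toLpCLM ℂ ℂ r volume).comp L).toLinearMap, ?_, fun g => ?_⟩
  · exact continuous_norm.comp ((SchwartzMap.toLpCLM ℂ ℂ r volume).comp L).continuous
  · have h : ((normSeminorm ℂ (Lp ℂ r (volume : Measure (E d)))).comp
      ((SchwartzMap.toLpCLM ℂ ℂ r volume).comp L).toLinearMap) g = ‖(L g).toLp r volume‖ := rfl
    rw [h, SchwartzMap.norm_toLp, ENNReal.ofReal_toReal ((L g).eLpNorm_lt_top r volume).ne]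

/-- A linear functional dominated by a controlled function is a tempered distribution. -/
theorem exists_temperedDistribution {Q : 𝓢(E d, ℂ) → ℝ≥0∞} (hQ : IsControl Q)
    (l : 𝓢(E d, ℂ) →ₗ[ℂ] ℂ) (hl : ∀ g, ‖l g‖ₑ ≤ Q g) : ∃ T : 𝓢'(E d, ℂ), ∀ g, T g = l g := by
  obtain ⟨p, hp, hpQ⟩ := hQ
  have hle : (normSeminorm ℂ ℂ).comp l ≤ p := fun g => by
    have h1 := (hl g).trans (hpQ g)
    rw [← ofReal_norm] at h1
    exact (ENNReal.ofReal_le_ofReal_iff (apply_nonneg _ _)).1 h1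
  have hc : Continuous l := by
    refine continuous_of_continuousAt_zero l ?_
    rw [ContinuousAt, map_zero, tendsto_zero_iff_norm_tendsto_zero]
    have h2 := hp.tendsto 0
    rw [map_zero] at h2
    exact squeeze_zero (fun _ => norm_nonneg _) hle h2
  exact ⟨ContinuousLinearMap.toPointwiseConvergenceCLM ℂ (RingHom.id ℂ) 𝓢(E d, ℂ) ℂ ⟨l, hc⟩, fun g => rfl⟩

theorem conv_coe (g h : 𝓢(E d, ℂ)) : conv (g : 𝓢'(E d, ℂ)) h = sconv g h := by
  funext x
  rw [conv, SchwartzMap.coe_apply, sconv_apply]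
  refine integral_congr_ae (ae_of_all _ fun y => ?_)
  simp only [reflectTranslate_apply, smul_eq_mul, mul_comm]

theorem coe_lapS_pow_apply (g u : 𝓢(E d, ℂ)) (M : ℕ) :
    (g : 𝓢'(E d, ℂ)) ((lapS d ^ M) u) = ∫ y, u y * (lapS d ^ M) g y := by
  rw [SchwartzMap.coe_apply]
  simp only [smul_eq_mul]
  induction M generalizing u with
  | zero => simp
  | succ M ih =>
    have h1 : (lapS d ^ (M + 1)) u = (lapS d ^ M) (lapS d u) := by
      rw [pow_succ, mul_apply_eq_comp]
    rw [h1, ih, lapS_pow_succ, lapS_apply, lapS_apply]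
    exact (SchwartzMap.integral_mul_laplacian_right_eq_left u _).symm

/-- The number of Laplacians is chosen so that their gain beats the growth rate `A` of the weights
with a factor `1/2` to spare for summation. -/
theorem exists_mul_inv_pow_le (A : ℝ≥0) {n : ℕ} (hn : 2 ≤ n) :
    ∃ M : ℕ, (A : ℝ≥0∞) * ((n : ℝ≥0∞) ^ (2 * M))⁻¹ ≤ 2⁻¹ := by
  obtain ⟨M, hM⟩ := pow_unbounded_of_one_lt (2 * A : ℝ≥0) (one_lt_two (α := ℝ≥0))
  have hn2 : (2 : ℝ≥0∞) ≤ n := by exact_mod_cast hn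
  refine ⟨M, ?_⟩
  have h1 : (2 : ℝ≥0∞) * A ≤ (n : ℝ≥0∞) ^ (2 * M) := by
    calc (2 : ℝ≥0∞) * A ≤ 2 ^ M := by exact_mod_cast hM.le
      _ ≤ (n : ℝ≥0∞) ^ M := by gcongr
      _ ≤ (n : ℝ≥0∞) ^ (2 * M) :=
        pow_le_pow_right₀ (one_le_two.trans hn2) (by omega)
  rw [← div_eq_mul_inv]
  refine ENNReal.div_le_of_le_mul ?_
  calc (A : ℝ≥0∞) = 2⁻¹ * (2 * A) := by
        rw [← mul_assoc, ENNReal.inv_mul_cancel (by simp) (by simp), one_mul]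
    _ ≤ _ := by gcongr

/-- Rapid decay of the blocks of a Schwartz function. -/
theorem exists_isControl_block {n : ℕ} (φ : LittlewoodPaley d n) {r : ℝ≥0∞} (hr : 1 ≤ r)
    (A : ℝ≥0) : ∃ Q : 𝓢(E d, ℂ) → ℝ≥0∞, IsControl Q ∧
      ∀ (g : 𝓢(E d, ℂ)) j, (A : ℝ≥0∞) ^ j * eLpNorm (conv (g : 𝓢'(E d, ℂ)) (φ.block j)) r volume ≤ Q g * 2⁻¹ ^ j := by
  obtain ⟨M, hA⟩ := exists_mul_inv_pow_le A φ.two_le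
  obtain ⟨C, hC⟩ := exists_eLpNorm_conv_block_succ_le φ M
  refine ⟨fun g => eLpNorm (φ.block 0) 1 volume * eLpNorm g r volume
    + C * eLpNorm ((lapS d ^ M) g) r volume, ?_, fun g j => ?_⟩
  · refine IsControl.add (IsControl.const_mul ?_ ((φ.block 0).eLpNorm_lt_top 1 volume).ne)
      (IsControl.const_mul (isControl_eLpNorm _ hr) (by simp))
    exact isControl_eLpNorm (ContinuousLinearMap.id ℂ _) hr
  · rcases j with _ | k
    · rw [pow_zero, pow_zero, one_mul, mul_one]
      refine le_add_right ?_
      have h1 : conv (g : 𝓢'(E d, ℂ)) (φ.block 0) = fun x => ∫ y, φ.block 0 (x - y) * g y := by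
        funext x
        rw [conv, SchwartzMap.coe_apply]
        simp only [reflectTranslate_apply, smul_eq_mul]
      rw [h1]
      exact eLpNorm_integral_mul_le _ g.continuous.aestronglyMeasurable hr
    · have h1 := hC (g : 𝓢'(E d, ℂ)) ((lapS d ^ M) g)
        ((lapS d ^ M) g).continuous.aestronglyMeasurable (coe_lapS_pow_apply g · M) r hr k
      calc (A : ℝ≥0∞) ^ (k + 1) * eLpNorm (conv (g : 𝓢'(E d, ℂ)) (φ.block (k + 1))) r volume
          ≤ (A : ℝ≥0∞) ^ (k + 1) * (C * ((n : ℝ≥0∞) ^ (2 * M))⁻¹ ^ (k + 1) *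
            eLpNorm ((lapS d ^ M) g) r volume) := by gcongr
        _ = C * eLpNorm ((lapS d ^ M) g) r volume *
            (A * ((n : ℝ≥0∞) ^ (2 * M))⁻¹) ^ (k + 1) := by rw [mul_pow]; ring
        _ ≤ C * eLpNorm ((lapS d ^ M) g) r volume * 2⁻¹ ^ (k + 1) := by gcongr
        _ ≤ _ := by gcongr; exact le_add_self

theorem elq_geom_ne_top {q : ℝ≥0∞} (hq : 0 < q) : elq q (fun j => (2⁻¹ : ℝ≥0∞) ^ j) ≠ ∞ := by
  by_cases hqt : q = ∞
  · subst hqt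
    rw [elq_top]
    refine ne_top_of_le_ne_top ENNReal.one_ne_top (iSup_le fun j => pow_le_one₀ bot_le ?_)
    simp
  · have hr : 0 < q.toReal := ENNReal.toReal_pos hq.ne' hqt
    rw [elq_of_ne_top hqt]
    refine ENNReal.rpow_ne_top_of_nonneg (by positivity) ?_
    have h1 : ∀ j : ℕ, ((2⁻¹ : ℝ≥0∞) ^ j) ^ q.toReal = ((2⁻¹ : ℝ≥0∞) ^ q.toReal) ^ j := fun j => by
      rw [← ENNReal.rpow_natCast, ← ENNReal.rpow_natCast, ← ENNReal.rpow_mul, ← ENNReal.rpow_mul,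
        mul_comm]
    simp only [h1]
    rw [ENNReal.tsum_geometric]
    refine ENNReal.inv_ne_top.2 (tsub_pos_of_lt ?_).ne'
    exact ENNReal.rpow_lt_one (by simp) hr

/-- Geometric decay gives finite scaled norms. -/
theorem exists_lqENorm_le_of_geom (S : ScalingTriple) (γ : ℝ) {q : ℝ≥0∞} (hq : 0 < q) :
    ∃ A C : ℝ≥0, ∀ (a : ℕ → ℝ≥0∞) (Q : ℝ≥0∞), (∀ j, (A : ℝ≥0∞) ^ j * a j ≤ Q * 2⁻¹ ^ j) →
      lqENorm S.c S.s γ q a ≤ C * Q := by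
  obtain ⟨K, hK⟩ := exists_lqENorm_le S.c_pos S.s_pos hq γ
  obtain ⟨C, A, hA⟩ := S.exists_gw_le_geom γ
  refine ⟨A, K * (C * (elq q fun j => (2⁻¹ : ℝ≥0∞) ^ j).toNNReal), fun a Q h => ?_⟩
  rw [ENNReal.coe_mul, ENNReal.coe_mul, ENNReal.coe_toNNReal (elq_geom_ne_top hq), mul_assoc]
  refine (hK a).trans (mul_le_mul_right ?_ _)
  rw [mul_right_comm, ← elq_const_mul hq]
  refine elq_mono fun j => ?_
  calc gw S.c S.s γ j * a j ≤ C * A ^ j * a j := by gcongr; exact hA j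
    _ = C * (A ^ j * a j) := by ring
    _ ≤ C * (Q * 2⁻¹ ^ j) := mul_le_mul_right (h j) _
    _ = _ := by ring

/-- Schwartz functions lie in every scaled Besov space, continuously. -/
theorem isControl_scaledBesovENorm (S : ScalingTriple) (φ : LittlewoodPaley d S.c) (γ : ℝ)
    {p q : ℝ≥0∞} (hp : 1 ≤ p) (hq : 0 < q) :
    IsControl fun g : 𝓢(E d, ℂ) => scaledBesovENorm S φ γ p q (g : 𝓢'(E d, ℂ)) := by
  obtain ⟨A, C, h⟩ := exists_lqENorm_le_of_geom S γ hq
  obtain ⟨Q, hQ, hA⟩ := exists_isControl_block φ hp A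
  exact (hQ.const_mul (C := C) (by simp)).mono fun g => h _ _ (hA g)

theorem eLpNorm_refl (g : 𝓢(E d, ℂ)) (r : ℝ≥0∞) :
    eLpNorm (refl g) r volume = eLpNorm g r volume := by
  have h : ⇑(refl g) = g ∘ Neg.neg := funext fun x => refl_apply g x
  rw [h, eLpNorm_comp_measurePreserving g.continuous.aestronglyMeasurable
    (Measure.measurePreserving_neg volume)]

theorem dconv_sconv (f : 𝓢'(E d, ℂ)) (g h u : 𝓢(E d, ℂ)) :
    dconv f (sconv g h) u = dconv f g (sconv (refl h) u) := by
  rw [dconv_apply, dconv_apply, refl_sconv, sconv_assoc]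

theorem dconv_smul_right (f : 𝓢'(E d, ℂ)) (a : ℂ) (g u : 𝓢(E d, ℂ)) :
    dconv f (a • g) u = a * dconv f g u := by
  rw [dconv_apply, dconv_apply, ← reflCLM_apply, map_smul, reflCLM_apply, smul_sconv, map_smul,
    smul_eq_mul]

theorem dconv_sum_right {ι : Type*} (f : 𝓢'(E d, ℂ)) (s : Finset ι) (g : ι → 𝓢(E d, ℂ))
    (u : 𝓢(E d, ℂ)) : dconv f (∑ i ∈ s, g i) u = ∑ i ∈ s, dconv f (g i) u := by
  simp only [dconv_apply, ← reflCLM_apply, map_sum, sum_sconv]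

theorem sum_nearSet_sconv_block {m : ℕ} (φ : LittlewoodPaley d (2 ^ m)) (j : ℕ) :
    ∑ k ∈ nearSet m m j, sconv (φ.block j) (φ.block k) = kap d • φ.block j := by
  simp only [sconv_comm (φ.block j)]
  refine φ.sum_sconv_block _ _ fun k hk => ?_
  by_contra h
  exact hk ((mem_nearSet φ.one_le_log).2 (near_of_sconv_block_ne_zero φ φ h).symm)

/-- A second copy of the block is created by the reproducing formula and transferred to the test
function, whose blocks decay rapidly. -/
theorem kap_mul_dconv_block {m : ℕ} (φ : LittlewoodPaley d (2 ^ m)) (f : 𝓢'(E d, ℂ))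
    (g : 𝓢(E d, ℂ)) (j : ℕ) : kap d * dconv f (φ.block j) g
      = ∑ k ∈ nearSet m m j, dconv f (φ.block j) (sconv (refl (φ.block k)) g) := by
  rw [← dconv_smul_right, ← sum_nearSet_sconv_block, dconv_sum_right]
  simp only [dconv_sconv]

/-- The scaled Besov space is continuously embedded in the space of tempered distributions. -/
theorem exists_isControl_apply (S : ScalingTriple) (φ : LittlewoodPaley d S.c) (γ : ℝ)
    {p q : ℝ≥0∞} (hp : 1 ≤ p) (hq : 0 < q) : ∃ Q : 𝓢(E d, ℂ) → ℝ≥0∞, IsControl Q ∧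
      ∀ (f : 𝓢'(E d, ℂ)) g, ‖f g‖ₑ ≤ scaledBesovENorm S φ γ p q f * Q g := by
  -- The weights of order `-γ` are the inverses of those of order `γ`, so `A` bounds the possible
  -- growth of the blocks of `f`.
  obtain ⟨C, A, hA⟩ := S.exists_gw_le_geom (-γ)
  obtain ⟨D, hD⟩ := S.exists_gw_le_near (-γ)
  obtain ⟨K, hK⟩ := exists_le_lqENorm S.c_pos S.s_pos hq γ
  -- The blocks of the test function are measured in the conjugate exponent, with decay fast enough
  -- to compensate the rate `A`.
  obtain ⟨Q, hQ, hQA⟩ := exists_isControl_block φ (one_le_conjExp p) A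
  have hm := S.m_spec.1
  obtain ⟨K', hK'⟩ := exists_elq_le_of_near hm hm one_pos (1 : ℝ≥0)
  set G := elq 1 (fun j => (2⁻¹ : ℝ≥0∞) ^ j) with hG
  have hGt : G ≠ ∞ := elq_geom_ne_top one_pos
  have hk0 : ‖kap d‖ₑ ≠ 0 := by simpa using kap_ne_zero d
  have hQr : IsControl fun g => Q (refl g) := by
    obtain ⟨r, hr, hrQ⟩ := hQ
    exact ⟨r.comp (reflCLM d).toLinearMap, hr.comp (reflCLM d).continuous, fun g => hrQ (refl g)⟩
  refine ⟨fun g => ‖kap d‖ₑ⁻¹ * (‖kap d‖ₑ⁻¹ * (K * D * C * K' * G)) * Q (refl g),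
    hQr.const_mul ?_, fun f g => ?_⟩
  · refine ENNReal.mul_ne_top (ENNReal.inv_ne_top.2 hk0) (ENNReal.mul_ne_top
      (ENNReal.inv_ne_top.2 hk0) (ENNReal.mul_ne_top ?_ hGt))
    simp [ENNReal.mul_eq_top]
  set N := scaledBesovENorm S φ γ p q f with hN
  have hconv : ∀ j, gw S.c S.s γ j * eLpNorm (conv f (φ.block j)) p volume ≤ K * N := fun j =>
    (le_elq hq (fun j => gw S.c S.s γ j * eLpNorm (conv f (φ.block j)) p volume) j).trans (hK _)
  have hterm : ∀ j, ∀ k ∈ nearSet S.m S.m j,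
      ‖dconv f (φ.block j) (sconv (refl (φ.block k)) g)‖ₑ
        ≤ K * N * (D * C * Q (refl g)) * 2⁻¹ ^ k := by
    intro j k hk
    have hnear := (mem_nearSet hm).1 hk
    refine (enorm_dconv_apply_le _ _ _ hp).trans ?_
    have h1 : eLpNorm (sconv (refl (φ.block k)) g) (conjExp p) volume
        = eLpNorm (conv ((refl g : 𝓢(E d, ℂ)) : 𝓢'(E d, ℂ)) (φ.block k)) (conjExp p) volume := by
      rw [conv_coe, ← eLpNorm_refl, refl_sconv, refl_refl, sconv_comm]
    rw [h1]
    have h2 : eLpNorm (conv f (φ.block j)) p volume ≤ gw S.c S.s (-γ) j * (K * N) := by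
      rw [S.gw_neg]
      calc eLpNorm (conv f (φ.block j)) p volume = (gw S.c S.s γ j)⁻¹ *
            (gw S.c S.s γ j * eLpNorm (conv f (φ.block j)) p volume) := by
            rw [← mul_assoc, ENNReal.inv_mul_cancel (gw_ne_zero S.c_pos S.s_pos j) (gw_ne_top j),
              one_mul]
        _ ≤ _ := mul_le_mul_right (hconv j) _
    have h3 : gw S.c S.s (-γ) j ≤ D * (C * A ^ k) := (hD j k hnear).trans (by gcongr; exact hA k)
    set X := eLpNorm (conv ((refl g : 𝓢(E d, ℂ)) : 𝓢'(E d, ℂ)) (φ.block k)) (conjExp p) volume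
      with hX
    calc X * eLpNorm (conv f (φ.block j)) p volume ≤ X * (D * (C * A ^ k) * (K * N)) := by
          gcongr
          exact h2.trans (by gcongr)
      _ = K * N * (D * C) * (A ^ k * X) := by ring
      _ ≤ K * N * (D * C) * (Q (refl g) * 2⁻¹ ^ k) := mul_le_mul_right (hQA _ _) _
      _ = _ := by ring
  set Y := K * N * (D * C * Q (refl g)) with hY
  -- The almost diagonal estimate in `ℓ_1`, with the geometric sequence as the majorant of the
  -- neighbouring terms.
  have hsum : ∑' j, ‖dconv f (φ.block j) g‖ₑ ≤ ‖kap d‖ₑ⁻¹ * (K' * (Y * G)) := by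
    have h1 : ∀ j, ‖kap d‖ₑ * ‖dconv f (φ.block j) g‖ₑ
        ≤ (1 : ℝ≥0) * ∑ k ∈ nearSet S.m S.m j, Y * 2⁻¹ ^ k := by
      intro j
      have h0 : kap d * dconv f (φ.block j) g
        = ∑ k ∈ nearSet S.m S.m j, dconv f (φ.block j) (sconv (refl (φ.block k)) g) :=
        kap_mul_dconv_block (m := S.m) φ f g j
      rw [← enorm_mul, h0, ENNReal.coe_one, one_mul]
      exact (enorm_sum_le _ _).trans (Finset.sum_le_sum (hterm j))
    have h2 := hK' _ _ h1
    rw [elq_const_mul one_pos, elq_const_mul one_pos] at h2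
    have h3 : elq 1 (fun j => ‖dconv f (φ.block j) g‖ₑ) = ∑' j, ‖dconv f (φ.block j) g‖ₑ := by
      rw [elq_of_ne_top ENNReal.one_ne_top]
      simp
    rw [h3] at h2
    calc ∑' j, ‖dconv f (φ.block j) g‖ₑ
        = ‖kap d‖ₑ⁻¹ * (‖kap d‖ₑ * ∑' j, ‖dconv f (φ.block j) g‖ₑ) := by
          rw [← mul_assoc, ENNReal.inv_mul_cancel hk0 (by simp), one_mul]
      _ ≤ _ := by gcongr
  have hlim : ‖kap d * f g‖ₑ ≤ ‖kap d‖ₑ⁻¹ * (K' * (Y * G)) := by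
    refine le_of_tendsto (tendsto_sum_dconv_block φ f g).enorm (Eventually.of_forall fun J => ?_)
    exact (enorm_sum_le _ _).trans ((ENNReal.sum_le_tsum _).trans hsum)
  rw [enorm_mul] at hlim
  calc ‖f g‖ₑ = ‖kap d‖ₑ⁻¹ * (‖kap d‖ₑ * ‖f g‖ₑ) := by
        rw [← mul_assoc, ENNReal.inv_mul_cancel hk0 (by simp), one_mul]
    _ ≤ ‖kap d‖ₑ⁻¹ * (‖kap d‖ₑ⁻¹ * (K' * (Y * G))) := by gcongr
    _ = _ := by rw [hY]; ring

end Control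

/-! ### The scaled Besov spaces are quasi-Banach spaces -/

section QuasiBanach

variable {c : ℕ} {s : ℝ → ℝ} {γ : ℝ} {q : ℝ≥0∞}

theorem lqENorm_mono (hc : 0 < c) (hs : ∀ r, 0 < r → 0 < s r) (hq : 0 < q) {a b : ℕ → ℝ≥0∞}
    (h : ∀ j, a j ≤ b j) : lqENorm c s γ q a ≤ lqENorm c s γ q b := by
  rw [lqENorm_eq hc hs hq, lqENorm_eq hc hs hq]
  exact add_le_add (h 0) (elq_mono fun j => mul_le_mul_right (h _) _)

theorem lqENorm_const_mul (hc : 0 < c) (hs : ∀ r, 0 < r → 0 < s r) (hq : 0 < q) (K : ℝ≥0∞)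
    (a : ℕ → ℝ≥0∞) : lqENorm c s γ q (fun j => K * a j) = K * lqENorm c s γ q a := by
  rw [lqENorm_eq hc hs hq, lqENorm_eq hc hs hq, mul_add, ← elq_const_mul hq]
  simp only [mul_left_comm K]

theorem lqENorm_add_le (hc : 0 < c) (hs : ∀ r, 0 < r → 0 < s r) (hq : 1 ≤ q) (a b : ℕ → ℝ≥0∞) :
    lqENorm c s γ q (fun j => a j + b j) ≤ lqENorm c s γ q a + lqENorm c s γ q b := by
  have hq0 : 0 < q := zero_lt_one.trans_le hq
  rw [lqENorm_eq hc hs hq0, lqENorm_eq hc hs hq0, lqENorm_eq hc hs hq0, add_add_add_comm]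
  simp only [mul_add]
  gcongr
  exact elq_add_le hq _ _

theorem lqENorm_add_le' (hc : 0 < c) (hs : ∀ r, 0 < r → 0 < s r) (hq : 0 < q) (a b : ℕ → ℝ≥0∞) :
    lqENorm c s γ q (fun j => a j + b j)
      ≤ (q.LpAddConst + 1) * (lqENorm c s γ q a + lqENorm c s γ q b) := by
  rw [lqENorm_eq hc hs hq, lqENorm_eq hc hs hq, lqENorm_eq hc hs hq, add_add_add_comm, mul_add]
  refine add_le_add ?_ ?_
  · exact le_mul_of_one_le_left bot_le le_add_self
  · simp only [mul_add]
    refine (elq_add_le' hq _ _).trans ?_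
    rw [← mul_add]
    gcongr
    exact le_self_add

/-- Fatou's lemma for the scaled sequence norms. -/
theorem lqENorm_le_of_le_liminf (hc : 0 < c) (hs : ∀ r, 0 < r → 0 < s r) (hq : 0 < q)
    {x : ℕ → ℝ≥0∞} {y : ℕ → ℕ → ℝ≥0∞} {ε : ℝ≥0∞} (hx : ∀ j, x j ≤ liminf (fun l => y l j) atTop)
    (hy : ∀ᶠ l in atTop, lqENorm c s γ q (y l) ≤ ε) : lqENorm c s γ q x ≤ ε + ε := by
  simp only [lqENorm_eq hc hs hq] at hy ⊢
  -- One `ε` is spent on the entry 0 and one on the tail, each of which is bounded by the full norm.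
  refine add_le_add ?_ ?_
  · exact (hx 0).trans (liminf_le_of_frequently_le'
      (hy.mono fun l hl => le_self_add.trans hl).frequently)
  · refine elq_le_of_le_liminf hq (y := fun l j => gw c s γ (j + 1) * y l (j + 1)) (fun j => ?_)
      (hy.mono fun l hl => le_add_self.trans hl)
    rw [ENNReal.liminf_const_mul_of_ne_top (gw_ne_top _)]
    gcongr
    exact hx _

variable {d : ℕ} (S : ScalingTriple) (φ : LittlewoodPaley d S.c) {p : ℝ≥0∞}

theorem scaledBesovENorm_smul (γ : ℝ) (p : ℝ≥0∞) (hq : 0 < q) (a : ℂ) (f : 𝓢'(E d, ℂ)) :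
    scaledBesovENorm S φ γ p q (a • f) = ‖a‖ₑ * scaledBesovENorm S φ γ p q f := by
  unfold scaledBesovENorm
  rw [besovENorm_eq_lqENorm, besovENorm_eq_lqENorm, ← lqENorm_const_mul S.c_pos S.s_pos hq]
  simp only [conv_smul, eLpNorm_const_smul]

theorem scaledBesovENorm_add_le (γ : ℝ) (hp : 1 ≤ p) (hq : 1 ≤ q) (f g : 𝓢'(E d, ℂ)) :
    scaledBesovENorm S φ γ p q (f + g)
      ≤ scaledBesovENorm S φ γ p q f + scaledBesovENorm S φ γ p q g := by
  have hq0 : 0 < q := zero_lt_one.trans_le hq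
  unfold scaledBesovENorm
  simp only [besovENorm_eq_lqENorm]
  refine (lqENorm_mono S.c_pos S.s_pos hq0 fun j => ?_).trans (lqENorm_add_le S.c_pos S.s_pos hq _ _)
  rw [conv_add]
  exact eLpNorm_add_le (continuous_conv _ _).aestronglyMeasurable
      (continuous_conv _ _).aestronglyMeasurable hp

theorem scaledBesovENorm_add_le' (γ : ℝ) (hp : 1 ≤ p) (hq : 0 < q) (f g : 𝓢'(E d, ℂ)) :
    scaledBesovENorm S φ γ p q (f + g)
      ≤ (q.LpAddConst + 1) * (scaledBesovENorm S φ γ p q f + scaledBesovENorm S φ γ p q g) := by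
  unfold scaledBesovENorm
  simp only [besovENorm_eq_lqENorm]
  refine (lqENorm_mono S.c_pos S.s_pos hq fun j => ?_).trans (lqENorm_add_le' S.c_pos S.s_pos hq _ _)
  rw [conv_add]
  exact eLpNorm_add_le (continuous_conv _ _).aestronglyMeasurable
      (continuous_conv _ _).aestronglyMeasurable hp

theorem scaledBesovENorm_zero (γ : ℝ) (p : ℝ≥0∞) (hq : 0 < q) :
    scaledBesovENorm S φ γ p q 0 = 0 := by
  rw [← zero_smul ℂ (0 : 𝓢'(E d, ℂ)), scaledBesovENorm_smul S φ γ p hq, enorm_zero, zero_mul]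

theorem scaledBesovENorm_sub_comm (γ : ℝ) (p : ℝ≥0∞) (hq : 0 < q) (f g : 𝓢'(E d, ℂ)) :
    scaledBesovENorm S φ γ p q (f - g) = scaledBesovENorm S φ γ p q (g - f) := by
  have : f - g = (-1 : ℂ) • (g - f) := by
    ext h
    change f h - g h = (-1 : ℂ) * (g h - f h)
    ring
  rw [this, scaledBesovENorm_smul S φ γ p hq, enorm_neg, enorm_one, one_mul]

/-- Definiteness is the injectivity contained in the continuous embedding into the tempered
distributions. -/
theorem scaledBesovENorm_eq_zero_iff (γ : ℝ) (hp : 1 ≤ p) (hq : 0 < q) (f : 𝓢'(E d, ℂ)) :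
    scaledBesovENorm S φ γ p q f = 0 ↔ f = 0 := by
  refine ⟨fun h => ?_, fun h => by rw [h, scaledBesovENorm_zero S φ γ p hq]⟩
  obtain ⟨Q, -, hQ⟩ := exists_isControl_apply S φ γ hp hq
  ext g
  have := hQ f g
  rw [h, zero_mul, nonpos_iff_eq_zero, enorm_eq_zero] at this
  rw [this]
  rfl

/-- The embedding makes a Cauchy sequence converge against every test function. The limit functional
is tempered because the bound `M * Q` is uniform in the sequence, and lower semicontinuity of the
norm upgrades weak to norm convergence. -/
theorem scaledBesovENorm_complete (γ : ℝ) (hp : 1 ≤ p) (hq : 0 < q) (u : ℕ → 𝓢'(E d, ℂ))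
    (hu : ∀ k, scaledBesovENorm S φ γ p q (u k) < ∞)
    (hC : ∀ ε : ℝ≥0∞, 0 < ε → ∃ k₀, ∀ k ≥ k₀, ∀ l ≥ k₀,
      scaledBesovENorm S φ γ p q (u k - u l) < ε) :
    ∃ f, scaledBesovENorm S φ γ p q f < ∞ ∧
      Tendsto (fun k => scaledBesovENorm S φ γ p q (u k - f)) atTop (𝓝 0) := by
  obtain ⟨Q, hQc, hQ⟩ := exists_isControl_apply S φ γ hp hq
  have hKt : q.LpAddConst + 1 ≠ ∞ := by simp [q.LpAddConst_lt_top.ne]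
  have hcau : ∀ g : 𝓢(E d, ℂ), CauchySeq fun k => u k g := by
    intro g
    rw [EMetric.cauchySeq_iff]
    intro ε hε
    have hQg := hQc.ne_top g
    obtain ⟨k₀, hk₀⟩ := hC (ε / (Q g + 1)) (ENNReal.div_pos hε.ne' (by simp [hQg]))
    refine ⟨k₀, fun k hk l hl => ?_⟩
    rw [edist_eq_enorm_sub]
    have h1 : u k g - u l g = (u k - u l) g := rfl
    rw [h1]
    have hlt := hk₀ k hk l hl
    refine (hQ _ g).trans_lt ?_
    calc _ ≤ scaledBesovENorm S φ γ p q (u k - u l) * (Q g + 1) := by gcongr; exact le_self_add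
      _ < ε := by
        rw [ENNReal.lt_div_iff_mul_lt (by simp) (by simp [hQg])] at hlt
        exact hlt
  choose lim hlim using fun g => cauchySeq_tendsto_of_complete (hcau g)
  let l : 𝓢(E d, ℂ) →ₗ[ℂ] ℂ :=
    { toFun := lim
      map_add' := fun g h => tendsto_nhds_unique (hlim (g + h))
        (((hlim g).add (hlim h)).congr fun k => (map_add (u k) g h).symm)
      map_smul' := fun a g => tendsto_nhds_unique (hlim (a • g))
        (((hlim g).const_smul a).congr fun k => (map_smul (u k) a g).symm) }
  obtain ⟨k₁, hk₁⟩ := hC 1 one_pos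
  set M := (q.LpAddConst + 1) * (1 + scaledBesovENorm S φ γ p q (u k₁)) with hM
  have hMt : M ≠ ∞ := ENNReal.mul_ne_top hKt (by simp [(hu k₁).ne])
  have hbd : ∀ k ≥ k₁, scaledBesovENorm S φ γ p q (u k) ≤ M := fun k hk => by
    have h1 := scaledBesovENorm_add_le' S φ γ hp hq (u k - u k₁) (u k₁)
    rw [sub_add_cancel] at h1
    refine h1.trans ?_
    rw [hM]
    gcongr
    exact (hk₁ k hk k₁ le_rfl).le
  have hl : ∀ g, ‖l g‖ₑ ≤ M * Q g := fun g => by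
    refine le_of_tendsto (hlim g).enorm ?_
    filter_upwards [eventually_ge_atTop k₁] with k hk
    exact (hQ (u k) g).trans (by gcongr; exact hbd k hk)
  obtain ⟨T, hT⟩ := exists_temperedDistribution (hQc.const_mul hMt) l hl
  have hTlim : ∀ g, Tendsto (fun k => u k g) atTop (𝓝 (T g)) := fun g => by
    rw [hT]
    exact hlim g
  have hconv : Tendsto (fun k => scaledBesovENorm S φ γ p q (u k - T)) atTop (𝓝 0) := by
    rw [ENNReal.tendsto_atTop_zero]
    intro ε hε
    obtain ⟨k₀, hk₀⟩ := hC (ε / 2) (ENNReal.half_pos hε.ne')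
    refine ⟨k₀, fun k hk => ?_⟩
    rw [← ENNReal.add_halves ε]
    -- Testing against translated kernels gives pointwise convergence of each block, so Fatou
    -- applies in `L_p` and then in `ℓ_q`.
    refine lqENorm_le_of_le_liminf (x := fun j => eLpNorm (conv (u k - T) (φ.block j)) p volume)
      (γ := γ) S.c_pos S.s_pos hq (y := fun l j => eLpNorm (conv (u k - u l) (φ.block j)) p volume) (fun j => ?_) ?_
    · refine Lp.eLpNorm_lim_le_liminf_eLpNorm (fun l => (continuous_conv _ _).aestronglyMeasurable)
        _ (ae_of_all _ fun x => ?_)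
      exact (hTlim (reflectTranslate (φ.block j) x)).const_sub (u k (reflectTranslate (φ.block j) x))
    · filter_upwards [eventually_ge_atTop k₀] with l hl
      exact (hk₀ k hk l hl).le
  refine ⟨T, ?_, hconv⟩
  obtain ⟨k, hk⟩ := (hconv.eventually_lt_const one_pos).exists
  have h1 := scaledBesovENorm_add_le' S φ γ hp hq (T - u k) (u k)
  rw [sub_add_cancel, scaledBesovENorm_sub_comm S φ γ p hq] at h1
  refine h1.trans_lt (ENNReal.mul_lt_top hKt.lt_top (ENNReal.add_lt_top.2 ⟨?_, hu k⟩))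
  exact hk.trans ENNReal.one_lt_top

theorem isQuasiBanachWith_scaledBesovENorm (γ : ℝ) (hp : 1 ≤ p) (hq : 0 < q) :
    ∃ K : ℝ≥0, IsQuasiBanachWith K (scaledBesovENorm S φ γ p q) := by
  refine ⟨(q.LpAddConst + 1).toNNReal, scaledBesovENorm_eq_zero_iff S φ γ hp hq,
    scaledBesovENorm_smul S φ γ p hq, fun f g => ?_, scaledBesovENorm_complete S φ γ hp hq⟩
  rw [ENNReal.coe_toNNReal (by simp [q.LpAddConst_lt_top.ne])]
  exact scaledBesovENorm_add_le' S φ γ hp hq f g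

theorem isBanach_scaledBesovENorm (γ : ℝ) (hp : 1 ≤ p) (hq : 1 ≤ q) :
    IsQuasiBanachWith 1 (scaledBesovENorm S φ γ p q) := by
  have hq0 : 0 < q := zero_lt_one.trans_le hq
  refine ⟨scaledBesovENorm_eq_zero_iff S φ γ hp hq0, scaledBesovENorm_smul S φ γ p hq0,
    fun f g => ?_, scaledBesovENorm_complete S φ γ hp hq0⟩
  rw [ENNReal.coe_one, one_mul]
  exact scaledBesovENorm_add_le S φ γ hp hq f g

/-- Monotonicity in the smoothness. -/
theorem scaledBesovENorm_mono_smoothness (p : ℝ≥0∞) (hq : 0 < q) {γ₁ γ₂ : ℝ} (h : γ₁ ≤ γ₂)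
    (f : 𝓢'(E d, ℂ)) : scaledBesovENorm S φ γ₁ p q f
      ≤ ENNReal.ofReal (max 1 (S.s ((S.c : ℝ)⁻¹) ^ ((γ₂ - γ₁) / 2)))
        * scaledBesovENorm S φ γ₂ p q f := by
  unfold scaledBesovENorm
  rw [besovENorm_eq_lqENorm, besovENorm_eq_lqENorm, lqENorm_eq S.c_pos S.s_pos hq,
    lqENorm_eq S.c_pos S.s_pos hq, mul_add]
  have hsig : S.s ((S.c : ℝ)⁻¹) = S.sig 1 := by
    rw [ScalingTriple.sig]; norm_num
  rw [hsig]
  refine add_le_add (le_mul_of_one_le_left bot_le ?_) ?_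
  · rw [← ENNReal.ofReal_one]
    exact ENNReal.ofReal_le_ofReal (le_max_left _ _)
  · rw [← elq_const_mul hq]
    refine elq_mono fun j => ?_
    rw [← mul_assoc]
    gcongr
    rw [S.gw_eq, S.gw_eq, ← ENNReal.ofReal_mul (by positivity)]
    refine ENNReal.ofReal_le_ofReal ?_
    have hpos := S.sig_pos (j + 1)
    calc S.sig (j + 1) ^ (-γ₁ / 2)
        = S.sig (j + 1) ^ ((γ₂ - γ₁) / 2) * S.sig (j + 1) ^ (-γ₂ / 2) := by
          rw [← Real.rpow_add hpos]
          congr 1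
          ring
      _ ≤ _ := by
          gcongr
          refine le_trans ?_ (le_max_right _ _)
          -- Among the scales `c_s^{-j}` with `j ≥ 1`, the value of `s` is largest at `j = 1`; hence
          -- the constant.
          exact Real.rpow_le_rpow hpos.le (S.sig_anti (by omega)) (by linarith)

/-- Monotonicity in the summability exponent. -/
theorem scaledBesovENorm_anti_exponent (γ : ℝ) (p : ℝ≥0∞) {q₁ q₂ : ℝ≥0∞} (h₁ : 0 < q₁)
    (h : q₁ ≤ q₂) (f : 𝓢'(E d, ℂ)) :
    scaledBesovENorm S φ γ p q₂ f ≤ scaledBesovENorm S φ γ p q₁ f := by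
  unfold scaledBesovENorm
  rw [besovENorm_eq_lqENorm, besovENorm_eq_lqENorm, lqENorm_eq S.c_pos S.s_pos h₁,
    lqENorm_eq S.c_pos S.s_pos (h₁.trans_le h)]
  gcongr
  exact elq_anti h₁ h _

end QuasiBanach

/-! ### Smooth functions with integrable derivatives -/

section Smooth

variable {d : ℕ}

theorem IsCTilde.memLp {f : E d → ℂ} (hf : IsCTilde f) {p : ℝ≥0∞} (hp : 1 ≤ p) (hpt : p ≠ ∞) :
    MemLp f p volume := by
  have h := hf.2 p hp hpt 0
  refine (memLp_congr_norm hf.1.continuous.aestronglyMeasurable h.1 (ae_of_all _ fun x => ?_)).2 h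
  rw [norm_iteratedFDeriv_zero]

theorem IsCTilde.fderiv_apply {f : E d → ℂ} (hf : IsCTilde f) (v : E d) :
    IsCTilde fun x => fderiv ℝ f x v := by
  have hsm : ContDiff ℝ ((⊤ : ℕ∞) : WithTop ℕ∞) (fderiv ℝ f) := hf.1.fderiv_right (by simp)
  have hsm' : ContDiff ℝ ((⊤ : ℕ∞) : WithTop ℕ∞) fun x => fderiv ℝ f x v :=
    hsm.clm_apply contDiff_const
  refine ⟨hsm', fun p hp hpt k => ?_⟩
  refine MemLp.of_le_mul (c := ‖v‖) (hf.2 p hp hpt (k + 1))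
    (hsm'.continuous_iteratedFDeriv (by exact_mod_cast le_top)).aestronglyMeasurable
    (ae_of_all _ fun x => ?_)
  rw [← norm_iteratedFDeriv_fderiv]
  exact norm_iteratedFDeriv_clm_apply_const hsm.contDiffAt (by exact_mod_cast le_top)

theorem IsCTilde.sum {ι : Type*} (s : Finset ι) {f : ι → E d → ℂ} (hf : ∀ i, IsCTilde (f i)) :
    IsCTilde fun x => ∑ i ∈ s, f i x := by
  refine ⟨ContDiff.sum fun i _ => (hf i).1, fun p hp hpt k => ?_⟩
  rw [iteratedFDeriv_sum fun i _ => (hf i).1.of_le (by exact_mod_cast le_top)]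
  exact memLp_finsetSum' _ fun i _ => (hf i).2 p hp hpt k

theorem IsCTilde.integrable_mul {f : E d → ℂ} (hf : IsCTilde f) (u : 𝓢(E d, ℂ)) :
    Integrable fun x => u x * f x := by
  have h1 := memLp_one_iff_integrable.1 (hf.memLp le_rfl ENNReal.one_ne_top)
  refine h1.bdd_mul (c := SchwartzMap.seminorm ℂ 0 0 u) u.continuous.aestronglyMeasurable
    (ae_of_all _ fun x => SchwartzMap.norm_le_seminorm ℂ u x)

open LineDeriv in
theorem IsCTilde.integral_lineDerivOp_mul {f : E d → ℂ} (hf : IsCTilde f) (u : 𝓢(E d, ℂ))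
    (v : E d) : ∫ x, (∂_{v} u) x * f x = -∫ x, u x * fderiv ℝ f x v := by
  have hu : ∀ x, (∂_{v} u) x = fderiv ℝ u x v := fun x =>
    SchwartzMap.lineDerivOp_apply_eq_fderiv v u x
  rw [integral_mul_fderiv_eq_neg_fderiv_mul_of_integrable, neg_neg]
  · simp only [hu]
  · simpa only [hu] using hf.integrable_mul (∂_{v} u)
  · exact (hf.fderiv_apply v).integrable_mul u
  · exact hf.integrable_mul u
  · exact fun x _ => u.differentiableAt
  · exact fun x _ => hf.1.contDiffAt.differentiableAt (by simp)

/-- Two integrations by parts per direction, without boundary terms since all products involved are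
integrable. The class is preserved, so the step can be iterated. -/
theorem IsCTilde.exists_lapS {f : E d → ℂ} (hf : IsCTilde f) : ∃ F, IsCTilde F ∧
    ∀ u : 𝓢(E d, ℂ), ∫ x, lapS d u x * f x = ∫ x, u x * F x := by
  let b := stdOrthonormalBasis ℝ (E d)
  have hb : ∀ i, IsCTilde fun x => fderiv ℝ (fun y => fderiv ℝ f y (b i)) x (b i) := fun i =>
    (hf.fderiv_apply (b i)).fderiv_apply (b i)
  refine ⟨_, IsCTilde.sum Finset.univ hb, fun u => ?_⟩
  rw [lapS_apply, SchwartzMap.laplacian_eq_sum b]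
  simp only [sum_apply, Finset.sum_mul, Finset.mul_sum]
  rw [integral_finsetSum _ fun i _ => hf.integrable_mul _,
    integral_finsetSum _ fun i _ => (hb i).integrable_mul u]
  refine Finset.sum_congr rfl fun i _ => ?_
  rw [hf.integral_lineDerivOp_mul, (hf.fderiv_apply (b i)).integral_lineDerivOp_mul, neg_neg]

theorem IsCTilde.exists_lapS_pow {f : E d → ℂ} (hf : IsCTilde f) (M : ℕ) : ∃ F, IsCTilde F ∧
    ∀ u : 𝓢(E d, ℂ), ∫ x, (lapS d ^ M) u x * f x = ∫ x, u x * F x := by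
  induction M with
  | zero => exact ⟨f, hf, fun u => by simp⟩
  | succ M ih =>
    obtain ⟨F, hF, h⟩ := ih
    obtain ⟨F', hF', h'⟩ := hF.exists_lapS
    refine ⟨F', hF', fun u => ?_⟩
    rw [pow_succ, mul_apply_eq_comp, h, h']

theorem lqENorm_lt_top_of_geom (S : ScalingTriple) (γ : ℝ) {q : ℝ≥0∞} (hq : 0 < q) :
    ∃ A : ℝ≥0, ∀ (a : ℕ → ℝ≥0∞) (D ρ : ℝ≥0∞), a 0 ≠ ∞ → D ≠ ∞ → A * ρ ≤ 2⁻¹ →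
      (∀ k, a (k + 1) ≤ D * ρ ^ (k + 1)) → lqENorm S.c S.s γ q a < ∞ := by
  obtain ⟨A, C, h⟩ := exists_lqENorm_le_of_geom S γ hq
  refine ⟨A, fun a D ρ h0 hD hρ ha => ?_⟩
  refine (h a (a 0 + D) fun j => ?_).trans_lt
    (ENNReal.mul_lt_top (by simp) (ENNReal.add_lt_top.2 ⟨h0.lt_top, hD.lt_top⟩))
  rcases j with _ | k
  · simp
  · calc (A : ℝ≥0∞) ^ (k + 1) * a (k + 1) ≤ A ^ (k + 1) * (D * ρ ^ (k + 1)) := by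
          gcongr; exact ha k
      _ = D * (A * ρ) ^ (k + 1) := by rw [mul_pow]; ring
      _ ≤ (a 0 + D) * 2⁻¹ ^ (k + 1) := by gcongr; exact le_add_self

/-- Integration against `f ∈ L¹` defines the distribution, and the decay of its blocks comes from
powers of the Laplacian of `f`: taken in `L_p` if `p < ∞`, and in `L¹` if `p = ∞`. -/
theorem exists_mem_scaledBesovSpace_of_isCTilde (S : ScalingTriple) (φ : LittlewoodPaley d S.c)
    (γ : ℝ) {p q : ℝ≥0∞} (hp : 1 ≤ p) (hq : 0 < q) {f : E d → ℂ} (hf : IsCTilde f) :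
    ∃ T ∈ scaledBesovSpace S φ γ p q, ∀ g : 𝓢(E d, ℂ), T g = ∫ x, g x * f x := by
  have hf1 := hf.memLp le_rfl ENNReal.one_ne_top
  have : Fact ((1 : ℝ≥0∞) ≤ 1) := ⟨le_rfl⟩
  let T : 𝓢'(E d, ℂ) := Lp.toTemperedDistribution (hf1.toLp f)
  have hT : ∀ g : 𝓢(E d, ℂ), T g = ∫ x, g x * f x := fun g => by
    rw [Lp.toTemperedDistribution_apply]
    refine integral_congr_ae ?_
    filter_upwards [hf1.coeFn_toLp] with x hx
    rw [hx, smul_eq_mul]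
  refine ⟨T, ?_, hT⟩
  have h0 : conv T (φ.block 0) = fun x => ∫ y, φ.block 0 (x - y) * f y := by
    funext x
    rw [conv, hT]
    simp only [reflectTranslate_apply]
  obtain ⟨A, hA⟩ := lqENorm_lt_top_of_geom S γ hq
  change lqENorm S.c S.s γ q (fun j => eLpNorm (conv T (φ.block j)) p volume) < ∞
  by_cases hpt : p = ∞
  · subst hpt
    -- The rate to be beaten includes the loss `c_s^d` per scale in passing from `L¹` to `L_∞`.
    obtain ⟨M, hM⟩ := exists_mul_inv_pow_le (A * (S.c : ℝ≥0) ^ d) φ.two_le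
    obtain ⟨F, hF, hFT⟩ := hf.exists_lapS_pow M
    obtain ⟨C, hC⟩ := exists_eLpNorm_top_conv_block_succ_le φ M
    refine hA _ (C * eLpNorm F 1 volume) (((S.c : ℝ≥0∞) ^ (2 * M))⁻¹ * (S.c : ℝ≥0∞) ^ d) ?_ ?_ ?_
      fun k => ?_
    · rw [h0, eLpNorm_exponent_top]
      obtain ⟨K, hK0, hK⟩ := (φ.block 0).decay 0 0
      refine ne_top_of_le_ne_top (b := ENNReal.ofReal K * eLpNorm f 1 volume)
        (ENNReal.mul_ne_top ENNReal.ofReal_ne_top hf1.2.ne)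
        (essSup_le_of_ae_le _ (ae_of_all _ fun x => ?_))
      rw [eLpNorm_one_eq_lintegral_enorm]
      refine (enorm_integral_le_lintegral_enorm _).trans ?_
      rw [← lintegral_const_mul' _ _ ENNReal.ofReal_ne_top]
      refine lintegral_mono fun y => ?_
      rw [enorm_mul]
      gcongr
      rw [← ofReal_norm]
      refine ENNReal.ofReal_le_ofReal ?_
      simpa using hK (x - y)
    · exact ENNReal.mul_ne_top (by simp) (hF.memLp le_rfl ENNReal.one_ne_top).2.ne
    · refine le_trans (le_of_eq ?_) hM
      push_cast
      ring
    · refine (hC T F (fun u => by rw [hT, hFT]) k).trans (le_of_eq ?_)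
      ring
  · obtain ⟨M, hM⟩ := exists_mul_inv_pow_le A φ.two_le
    obtain ⟨F, hF, hFT⟩ := hf.exists_lapS_pow M
    obtain ⟨C, hC⟩ := exists_eLpNorm_conv_block_succ_le φ M
    refine hA _ (C * eLpNorm F p volume) ((S.c : ℝ≥0∞) ^ (2 * M))⁻¹ ?_ ?_ hM fun k => ?_
    · rw [h0]
      exact ((eLpNorm_integral_mul_le _ hf.1.continuous.aestronglyMeasurable hp).trans_lt
        (ENNReal.mul_lt_top ((φ.block 0).eLpNorm_lt_top 1 volume) (hf.memLp hp hpt).2)).ne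
    · exact ENNReal.mul_ne_top (by simp) (hF.memLp hp hpt).2.ne
    · refine (hC T F hF.1.continuous.aestronglyMeasurable (fun u => by rw [hT, hFT]) p hp k).trans
        (le_of_eq ?_)
      ring

end Smooth

/-! ### Density of test functions -/

section Density

variable {d : ℕ}

/-- The partial sums of a Littlewood-Paley decomposition of unity. -/
def LittlewoodPaley.lowPass {n : ℕ} (φ : LittlewoodPaley d n) (J : ℕ) : 𝓢(E d, ℂ) :=
  ∑ j ∈ Finset.range (J + 1), φ.block j

theorem LittlewoodPaley.eLpNorm_lowPass {n : ℕ} (φ : LittlewoodPaley d n) (J : ℕ) :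
    eLpNorm (φ.lowPass J) 1 volume = eLpNorm (φ.block 0) 1 volume := by
  rw [lowPass, φ.sum_block, eLpNorm_one_ndilate]

/-- Only blocks of index at most `j + 2` interact with block `j`, and all of them occur in the
partial sum. -/
theorem sconv_lowPass_block {m : ℕ} (φ : LittlewoodPaley d (2 ^ m)) {j J : ℕ} (h : j + 2 ≤ J) :
    sconv (φ.lowPass J) (φ.block j) = kap d • φ.block j := by
  rw [LittlewoodPaley.lowPass, sum_sconv]
  refine φ.sum_sconv_block _ _ fun k hk => ?_
  by_contra h0
  have h1 := (near_of_sconv_block_ne_zero φ φ h0).1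
  have hm := φ.one_le_log
  rw [Finset.mem_range] at hk
  have h2 : m * k ≤ m * (j + 2) := by linarith
  have h3 := Nat.le_of_mul_le_mul_left h2 hm
  omega

theorem sconv_lowPass_lowPass {m : ℕ} (φ : LittlewoodPaley d (2 ^ m)) (J : ℕ) :
    sconv (φ.lowPass J) (φ.lowPass (J + 2)) = kap d • φ.lowPass J := by
  rw [sconv_comm]
  conv_lhs => rw [LittlewoodPaley.lowPass.eq_def φ J, sconv_sum]
  rw [LittlewoodPaley.lowPass.eq_def φ J, Finset.smul_sum]
  refine Finset.sum_congr rfl fun j hj => sconv_lowPass_block φ ?_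
  rw [Finset.mem_range] at hj
  omega

theorem exists_pos_mul_add_lt {K ε : ℝ≥0∞} (hK : K ≠ ∞) (hε : 0 < ε) :
    ∃ δ : ℝ≥0∞, 0 < δ ∧ K * (δ + δ) < ε := by
  obtain ⟨n, hn, h⟩ := ENNReal.exists_nnreal_pos_mul_lt (a := K * 2)
    (ENNReal.mul_ne_top hK (by simp)) hε.ne'
  refine ⟨n, by simpa using hn, ?_⟩
  rw [← two_mul, ← mul_assoc, mul_comm]
  exact h

variable (S : ScalingTriple) (φ : LittlewoodPaley d S.c) {p q : ℝ≥0∞}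

theorem conv_sub (f g : 𝓢'(E d, ℂ)) (h : 𝓢(E d, ℂ)) : conv (f - g) h = conv f h - conv g h := rfl

/-- The truncations of the Littlewood-Paley decomposition converge. -/
theorem tendsto_scaledBesovENorm_sub_dconv (γ : ℝ) (hp : 1 ≤ p) (hq : 0 < q) (hqt : q ≠ ∞)
    {f : 𝓢'(E d, ℂ)} (hf : scaledBesovENorm S φ γ p q f < ∞) :
    Tendsto (fun J => scaledBesovENorm S φ γ p q (f - (kap d)⁻¹ • dconv f (φ.lowPass J)))
      atTop (𝓝 0) := by
  obtain ⟨K, hK⟩ := exists_lqENorm_le S.c_pos S.s_pos hq γ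
  obtain ⟨K', hK'⟩ := exists_le_lqENorm S.c_pos S.s_pos hq γ
  set D : ℝ≥0∞ := 1 + ‖(kap d)⁻¹‖ₑ * eLpNorm (φ.block 0) 1 volume with hD
  have hDt : D ≠ ∞ := by
    simp [hD, ENNReal.mul_eq_top, ((φ.block 0).eLpNorm_lt_top 1 volume).ne]
  have hconv : ∀ J j, conv (f - (kap d)⁻¹ • dconv f (φ.lowPass J)) (φ.block j)
      = conv f (φ.block j) - (kap d)⁻¹ • conv f (sconv (φ.block j) (φ.lowPass J)) := fun J j => by
    rw [conv_sub, conv_smul, conv_dconv, sconv_comm]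
  have h1 : Tendsto (fun J => elq q fun j => gw S.c S.s γ j *
      eLpNorm (conv (f - (kap d)⁻¹ • dconv f (φ.lowPass J)) (φ.block j)) p volume) atTop (𝓝 0) := by
    -- Dominated convergence: Young's inequality bounds every block of the difference by `D` times
    -- the block of `f`, uniformly in `J`, and a given block vanishes once `J ≥ j + 2`.
    refine tendsto_elq_zero hq hqt
      (B := fun j => D * (gw S.c S.s γ j * eLpNorm (conv f (φ.block j)) p volume)) ?_
      (Eventually.of_forall fun J j => ?_) fun j => ?_
    · rw [elq_const_mul hq]
      refine ENNReal.mul_ne_top hDt ((hK' fun j => eLpNorm (conv f (φ.block j)) p volume).trans_lt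
        (ENNReal.mul_lt_top (by simp) hf)).ne
    · rw [mul_left_comm]
      gcongr
      rw [hconv]
      refine (eLpNorm_sub_le (continuous_conv _ _).aestronglyMeasurable
        ((continuous_conv _ _).const_smul _).aestronglyMeasurable hp).trans ?_
      rw [hD, add_mul, one_mul, eLpNorm_const_smul, mul_assoc]
      gcongr
      refine (eLpNorm_conv_sconv_le _ _ _ hp).trans ?_
      rw [φ.eLpNorm_lowPass]
    · refine tendsto_const_nhds.congr' ?_
      filter_upwards [eventually_ge_atTop (j + 2)] with J hJ
      have h2 : sconv (φ.lowPass J) (φ.block j) = kap d • φ.block j :=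
        sconv_lowPass_block (m := S.m) φ hJ
      rw [hconv, sconv_comm, h2, conv_smul_right, smul_smul, inv_mul_cancel₀ (kap_ne_zero d),
        one_smul, sub_self, eLpNorm_zero, mul_zero]
  have h2 := ENNReal.Tendsto.const_mul (a := (K : ℝ≥0∞)) h1 (Or.inr (by simp))
  rw [mul_zero] at h2
  exact tendsto_of_tendsto_of_tendsto_of_le_of_le tendsto_const_nhds h2 (fun _ => bot_le)
    fun J => hK _

theorem conv_mem_of_scaledBesovENorm_lt_top {γ : ℝ} (hq : 0 < q) {f : 𝓢'(E d, ℂ)}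
    (hf : scaledBesovENorm S φ γ p q f < ∞) (j : ℕ) : MemLp (conv f (φ.block j)) p volume := by
  refine ⟨(continuous_conv _ _).aestronglyMeasurable, ?_⟩
  obtain ⟨K', hK'⟩ := exists_le_lqENorm S.c_pos S.s_pos hq γ
  have h1 := (le_elq hq (fun j => gw S.c S.s γ j * eLpNorm (conv f (φ.block j)) p volume) j).trans
    (hK' _)
  have h2 := h1.trans_lt (ENNReal.mul_lt_top (by simp) hf)
  exact ENNReal.lt_top_of_mul_ne_top_right h2.ne (gw_ne_zero S.c_pos S.s_pos j)

/-- Truncations can be approximated by Schwartz functions. -/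
theorem exists_schwartz_near_dconv (γ : ℝ) (hp : 1 ≤ p) (hpt : p ≠ ∞) (hq : 0 < q)
    {f : 𝓢'(E d, ℂ)} (hf : scaledBesovENorm S φ γ p q f < ∞) (J : ℕ) {ε : ℝ≥0∞} (hε : 0 < ε) :
    ∃ g : 𝓢(E d, ℂ), scaledBesovENorm S φ γ p q
      ((kap d)⁻¹ • dconv f (φ.lowPass J) - (g : 𝓢'(E d, ℂ))) < ε := by
  set w := conv f (φ.lowPass J) with hw
  have hwp : MemLp w p volume := by
    rw [hw, LittlewoodPaley.lowPass, conv_sum_right]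
    exact memLp_finsetSum' _ fun j _ => conv_mem_of_scaledBesovENorm_lt_top S φ hq hf j
  -- `Φ` reproduces the truncation, so the truncated distribution is a multiple of `w ∗ Φ` with `w ∈
  -- L_p`.
  set Φ := φ.lowPass (J + 2) with hΦ
  have hΦΦ : sconv (φ.lowPass J) Φ = kap d • φ.lowPass J := sconv_lowPass_lowPass (m := S.m) φ J
  set κ : ℂ := (kap d)⁻¹ * (kap d)⁻¹ with hκ
  set C : ℝ≥0∞ := ‖κ‖ₑ * scaledBesovENorm S φ γ 1 q (Φ : 𝓢'(E d, ℂ)) with hC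
  have hCt : C ≠ ∞ := ENNReal.mul_ne_top (by simp)
    ((isControl_scaledBesovENorm S φ γ le_rfl hq).ne_top Φ)
  obtain ⟨δ, hδ, hδε⟩ := ENNReal.exists_nnreal_pos_mul_lt hCt hε.ne'
  -- Replacing `w` by a nearby test function in `L_p` changes each block by a convolution of `w - k`
  -- with a block of `Φ`. Young's inequality thus needs only the Besov norm of `Φ` with `p = 1`.
  obtain ⟨k₀, hk1, hk2, hk3⟩ := hwp.exist_eLpNorm_sub_le hpt hp (ε := δ) (by exact_mod_cast hδ)
  set k : 𝓢(E d, ℂ) := hk1.toSchwartzMap hk2 with hk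
  have hkw : eLpNorm (w - ⇑k) p volume ≤ δ := by
    rw [ENNReal.ofReal_coe_nnreal] at hk3
    exact hk3
  refine ⟨κ • sconv Φ k, lt_of_le_of_lt ?_ hδε⟩
  have hconv : ∀ j, conv ((kap d)⁻¹ • dconv f (φ.lowPass J)
      - ((κ • sconv Φ k : 𝓢(E d, ℂ)) : 𝓢'(E d, ℂ))) (φ.block j)
      = κ • fun x => ∫ y, sconv Φ (φ.block j) (x - y) * (w - ⇑k) y := by
    intro j
    have h1 : conv ((kap d)⁻¹ • dconv f (φ.lowPass J)) (φ.block j)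
        = κ • conv f (sconv (φ.lowPass J) (sconv Φ (φ.block j))) := by
      rw [conv_smul, conv_dconv, ← sconv_assoc, hΦΦ, smul_sconv, conv_smul_right, smul_smul, hκ,
        mul_assoc, inv_mul_cancel₀ (kap_ne_zero d), mul_one]
    have h2 : conv ((κ • sconv Φ k : 𝓢(E d, ℂ)) : 𝓢'(E d, ℂ)) (φ.block j)
        = κ • conv (k : 𝓢'(E d, ℂ)) (sconv Φ (φ.block j)) := by
      rw [conv_coe, conv_coe, smul_sconv, ← sconv_assoc, sconv_comm k]
      rfl
    rw [conv_sub, h1, h2, ← smul_sub]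
    congr 1
    funext x
    have h3 : conv (k : 𝓢'(E d, ℂ)) (sconv Φ (φ.block j)) x
        = ∫ y, sconv Φ (φ.block j) (x - y) * k y := by
      rw [conv, SchwartzMap.coe_apply]
      simp only [reflectTranslate_apply, smul_eq_mul]
    have : ENNReal.HolderConjugate p (conjExp p) := ENNReal.HolderConjugate.inv_one_sub_inv' hp
    have : ENNReal.HolderTriple (conjExp p) p 1 := ENNReal.HolderTriple.symm
    have hInt : ∀ {G : E d → ℂ}, MemLp G p volume →
        Integrable fun y => sconv Φ (φ.block j) (x - y) * G y := fun {G} hG => by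
      have h4 := (reflectTranslate (sconv Φ (φ.block j)) x).memLp (conjExp p) volume
      have h5 := memLp_one_iff_integrable.1 (hG.mul (r := 1) h4)
      refine h5.congr (ae_of_all _ fun y => ?_)
      simp only [Pi.mul_apply, reflectTranslate_apply]
    rw [Pi.sub_apply, conv_sconv_eq_integral, h3, ← integral_sub (hInt hwp)
      (hInt (k.memLp p volume))]
    simp only [Pi.sub_apply, mul_sub, hw]
  have hle : scaledBesovENorm S φ γ p q ((kap d)⁻¹ • dconv f (φ.lowPass J)
      - ((κ • sconv Φ k : 𝓢(E d, ℂ)) : 𝓢'(E d, ℂ))) ≤ lqENorm S.c S.s γ q fun j =>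
      (δ * ‖κ‖ₑ) * eLpNorm (conv (Φ : 𝓢'(E d, ℂ)) (φ.block j)) 1 volume := by
    rw [scaledBesovENorm, besovENorm_eq_lqENorm]
    refine lqENorm_mono S.c_pos S.s_pos hq fun j => ?_
    rw [hconv, eLpNorm_const_smul, conv_coe]
    refine (mul_le_mul_right (eLpNorm_integral_mul_le _ (hwp.1.sub
      k.continuous.aestronglyMeasurable) hp) _).trans ?_
    rw [mul_comm (δ : ℝ≥0∞), mul_assoc, mul_comm (δ : ℝ≥0∞)]
    gcongr
  refine hle.trans (le_of_eq ?_)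
  rw [lqENorm_const_mul S.c_pos S.s_pos hq, hC, mul_assoc]
  rfl

/-- Test functions are dense in the scaled Besov spaces. -/
theorem exists_hasCompactSupport_near (γ : ℝ) (hp : 1 ≤ p) (hpt : p ≠ ∞) (hq : 0 < q)
    (hqt : q ≠ ∞) {f : 𝓢'(E d, ℂ)} (hf : f ∈ scaledBesovSpace S φ γ p q) {ε : ℝ≥0∞} (hε : 0 < ε) :
    ∃ g : 𝓢(E d, ℂ), HasCompactSupport g ∧
      scaledBesovENorm S φ γ p q (f - (g : 𝓢'(E d, ℂ))) < ε := by
  have hKt : q.LpAddConst + 1 ≠ ∞ := by simp [q.LpAddConst_lt_top.ne]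
  obtain ⟨δ, hδ, hδε⟩ := exists_pos_mul_add_lt hKt hε
  obtain ⟨δ', hδ', hδ'ε⟩ := exists_pos_mul_add_lt hKt hδ
  obtain ⟨J, hJ⟩ := ((tendsto_scaledBesovENorm_sub_dconv S φ γ hp hq hqt hf).eventually_lt_const
    hδ).exists
  obtain ⟨g, hg⟩ := exists_schwartz_near_dconv S φ γ hp hpt hq hf J hδ'
  obtain ⟨u, hu, hul⟩ := exists_seq_hasCompactSupport g
  have hul' : Tendsto (fun i => g - u i) atTop (𝓝 0) := by simpa using hul.const_sub g
  obtain ⟨i, hi⟩ := (((isControl_scaledBesovENorm S φ γ hp hq).tendsto hul').eventually_lt_const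
    hδ').exists
  refine ⟨u i, hu i, ?_⟩
  set h := (kap d)⁻¹ • dconv f (φ.lowPass J) with hh
  have e1 : ((g - u i : 𝓢(E d, ℂ)) : 𝓢'(E d, ℂ)) = (g : 𝓢'(E d, ℂ)) - (u i : 𝓢'(E d, ℂ)) :=
    map_sub _ _ _
  rw [e1] at hi
  have t1 : scaledBesovENorm S φ γ p q (h - (u i : 𝓢'(E d, ℂ))) < δ := by
    rw [← sub_add_sub_cancel h (g : 𝓢'(E d, ℂ)) (u i : 𝓢'(E d, ℂ))]
    refine (scaledBesovENorm_add_le' S φ γ hp hq _ _).trans_lt (lt_of_le_of_lt ?_ hδ'ε)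
    gcongr
  rw [← sub_add_sub_cancel f h (u i : 𝓢'(E d, ℂ))]
  refine (scaledBesovENorm_add_le' S φ γ hp hq _ _).trans_lt (lt_of_le_of_lt ?_ hδε)
  gcongr

/-- The dual of a scaled Besov space is a space of tempered distributions. -/
theorem exists_injective_dual (γ : ℝ) (hp : 1 ≤ p) (hpt : p ≠ ∞) (hq : 0 < q) (hqt : q ≠ ∞) :
    ∃ J : scaledBesovDual S φ γ p q →ₗ[ℂ] 𝓢'(E d, ℂ), Function.Injective J ∧
      ∀ (l : scaledBesovDual S φ γ p q) (g : 𝓢(E d, ℂ)),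
        ∃ hg : (g : 𝓢'(E d, ℂ)) ∈ scaledBesovSpace S φ γ p q,
          J l g = (l : scaledBesovSpace S φ γ p q →ₗ[ℂ] ℂ) ⟨(g : 𝓢'(E d, ℂ)), hg⟩ := by
  have hctrl := isControl_scaledBesovENorm (d := d) S φ γ hp hq
  have hmem : ∀ g : 𝓢(E d, ℂ), (g : 𝓢'(E d, ℂ)) ∈ scaledBesovSpace S φ γ p q := fun g =>
    (hctrl.ne_top g).lt_top
  let ι : 𝓢(E d, ℂ) →ₗ[ℂ] scaledBesovSpace S φ γ p q :=
    LinearMap.codRestrict _ (SchwartzMap.toTemperedDistributionCLM (E d) ℂ volume).toLinearMap hmem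
  have hex : ∀ l : scaledBesovDual S φ γ p q, ∃ T : 𝓢'(E d, ℂ), ∀ g,
      T g = (l : scaledBesovSpace S φ γ p q →ₗ[ℂ] ℂ) (ι g) := by
    rintro ⟨l, C, hC⟩
    exact exists_temperedDistribution (hctrl.const_mul (C := C) (by simp)) (l ∘ₗ ι)
      fun g => hC (ι g)
  choose T hT using hex
  refine ⟨{ toFun := T, map_add' := fun l l' => ?_, map_smul' := fun a l => ?_ }, ?_,
    fun l g => ⟨hmem g, hT l g⟩⟩
  · ext g
    change T (l + l') g = T l g + T l' g
    rw [hT, hT, hT]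
    rfl
  · ext g
    change T (a • l) g = a * T l g
    rw [hT, hT]
    rfl
  · rw [injective_iff_map_eq_zero]
    rintro ⟨l, C, hC⟩ h0
    have h1 : ∀ g, l (ι g) = 0 := fun g => by
      rw [← hT ⟨l, C, hC⟩ g]
      exact congrArg (fun T : 𝓢'(E d, ℂ) => T g) h0
    -- A bounded functional that vanishes on Schwartz functions is arbitrarily small at every `f`,
    -- by density.
    have h2 : l = 0 := by
      refine LinearMap.ext fun f => ?_
      by_contra hne
      have hpos : 0 < ‖l f‖ₑ := by simpa [pos_iff_ne_zero] using hne
      obtain ⟨δ, hδ, hδε⟩ := ENNReal.exists_nnreal_pos_mul_lt (a := (C : ℝ≥0∞)) (by simp) hpos.ne'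
      obtain ⟨g, -, hg⟩ := exists_hasCompactSupport_near S φ γ hp hpt hq hqt f.2 (ε := δ)
        (by exact_mod_cast hδ)
      have h3 : l f = l (f - ι g) := by rw [map_sub, h1, sub_zero]
      have h4 := hC (f - ι g)
      rw [← h3] at h4
      refine lt_irrefl _ (h4.trans_lt (lt_of_le_of_lt ?_ hδε))
      rw [mul_comm]
      gcongr
      exact hg.le
    exact Subtype.ext h2

end Density

/-! ### Weighted sequence spaces: the upper bound for the interpolation norm -/

section Upper

variable {B : Type*} [NormedAddCommGroup B]

/-- The norm of the weighted space `ℓ_q(B)` with the weights `exp (α j)`. -/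
def wNorm (q : ℝ≥0∞) (α : ℕ → ℝ) (x : ℕ → B) : ℝ≥0∞ :=
  elq q fun j => ENNReal.ofReal (Real.exp (α j)) * ‖x j‖ₑ

variable {q q₀ q₁ : ℝ≥0∞} {α β : ℕ → ℝ}

theorem wNorm_le_of_le (hq : 0 < q) {x C : ℕ → B} {R : ℝ≥0∞} (h : ∀ j, ‖x j‖ₑ ≤ R * ‖C j‖ₑ) :
    wNorm q α x ≤ R * wNorm q α C := by
  rw [wNorm, wNorm, ← elq_const_mul hq]
  refine elq_mono fun j => ?_
  rw [mul_left_comm]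
  exact mul_le_mul_right (h j) _

theorem tendsto_wNorm_zero {ι : Type*} {l : Filter ι} [l.IsCountablyGenerated] (hq : 0 < q)
    (hqt : q ≠ ∞) {x : ι → ℕ → B} {C : ℕ → B} (hC : wNorm q α C ≠ ∞) {ρ : ι → ℕ → ℝ≥0∞}
    {R : ℝ≥0∞} (hR : R ≠ ∞) (hρ : ∀ᶠ i in l, ∀ j, ρ i j ≤ R)
    (hρ0 : ∀ j, Tendsto (fun i => ρ i j) l (𝓝 0)) (hx : ∀ i j, ‖x i j‖ₑ ≤ ρ i j * ‖C j‖ₑ) :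
    Tendsto (fun i => wNorm q α (x i)) l (𝓝 0) := by
  refine tendsto_elq_zero hq hqt
    (B := fun j => R * (ENNReal.ofReal (Real.exp (α j)) * ‖C j‖ₑ)) ?_ ?_ fun j => ?_
  · rw [elq_const_mul hq]
    exact ENNReal.mul_ne_top hR hC
  · filter_upwards [hρ] with i hi j
    rw [mul_left_comm]
    gcongr
    exact (hx i j).trans (by gcongr; exact hi j)
  · have h1 : Tendsto (fun i => ENNReal.ofReal (Real.exp (α j)) * (ρ i j * ‖C j‖ₑ)) l (𝓝 0) := by
      have h2 := ENNReal.Tendsto.mul_const (b := ‖C j‖ₑ) (hρ0 j) (Or.inr (by simp))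
      have h3 := ENNReal.Tendsto.const_mul (a := ENNReal.ofReal (Real.exp (α j))) h2
        (Or.inr (by simp))
      simpa using h3
    exact tendsto_of_tendsto_of_tendsto_of_le_of_le tendsto_const_nhds h1 (fun _ => bot_le)
      fun i => mul_le_mul_right (hx i j) _

theorem enorm_indicator_le_of_le {P : Set ℕ} {x C : ℕ → B} {ρ : ℕ → ℝ≥0∞}
    (h : ∀ j, ‖x j‖ₑ ≤ ρ j * ‖C j‖ₑ) (j : ℕ) :
    ‖P.indicator x j‖ₑ ≤ ρ j * ‖P.indicator C j‖ₑ := by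
  by_cases hj : j ∈ P
  · simpa [hj] using h j
  · simp [hj]

/-- A sequence is split by coordinates: those in `P` are measured in the second space, the others in
the first. -/
theorem sumENorm_wNorm_le (P : Set ℕ) (x : ℕ → B) :
    sumENorm (wNorm q₀ α) (wNorm q₁ β) x
      ≤ wNorm q₀ α (Pᶜ.indicator x) + wNorm q₁ β (P.indicator x) := by
  refine (iInf_le _ (Pᶜ.indicator x)).trans (le_of_eq ?_)
  congr 2
  rw [Set.indicator_compl, sub_sub_cancel]

theorem sumENorm_wNorm_le_of_le (hq₀ : 0 < q₀) (hq₁ : 0 < q₁) (P : Set ℕ) {x C : ℕ → B} {R : ℝ≥0∞}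
    (h : ∀ j, ‖x j‖ₑ ≤ R * ‖C j‖ₑ) : sumENorm (wNorm q₀ α) (wNorm q₁ β) x
      ≤ R * (wNorm q₀ α (Pᶜ.indicator C) + wNorm q₁ β (P.indicator C)) := by
  refine (sumENorm_wNorm_le P x).trans ?_
  rw [mul_add]
  exact add_le_add (wNorm_le_of_le hq₀ (enorm_indicator_le_of_le h))
    (wNorm_le_of_le hq₁ (enorm_indicator_le_of_le h))

theorem tendsto_sumENorm_wNorm_zero {ι : Type*} {l : Filter ι} [l.IsCountablyGenerated]
    (hq₀ : 0 < q₀) (hqt₀ : q₀ ≠ ∞) (hq₁ : 0 < q₁) (hqt₁ : q₁ ≠ ∞) (P : Set ℕ) {x : ι → ℕ → B}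
    {C : ℕ → B} (hC₀ : wNorm q₀ α (Pᶜ.indicator C) ≠ ∞) (hC₁ : wNorm q₁ β (P.indicator C) ≠ ∞)
    {ρ : ι → ℕ → ℝ≥0∞} {R : ℝ≥0∞} (hR : R ≠ ∞) (hρ : ∀ᶠ i in l, ∀ j, ρ i j ≤ R)
    (hρ0 : ∀ j, Tendsto (fun i => ρ i j) l (𝓝 0)) (hx : ∀ i j, ‖x i j‖ₑ ≤ ρ i j * ‖C j‖ₑ) :
    Tendsto (fun i => sumENorm (wNorm q₀ α) (wNorm q₁ β) (x i)) l (𝓝 0) := by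
  have h := (tendsto_wNorm_zero hq₀ hqt₀ hC₀ hR hρ hρ0
    fun i => enorm_indicator_le_of_le (hx i)).add
    (tendsto_wNorm_zero hq₁ hqt₁ hC₁ hR hρ hρ0 fun i => enorm_indicator_le_of_le (hx i))
  rw [add_zero] at h
  exact tendsto_of_tendsto_of_tendsto_of_le_of_le tendsto_const_nhds h (fun _ => bot_le)
    fun i => sumENorm_wNorm_le P (x i)

/-- The exponent of the interpolating function. -/
def interpExp (θ L : ℝ) (z : ℂ) : ℂ := z ^ 2 - (θ : ℂ) ^ 2 + z * L

theorem interpExp_re (θ L : ℝ) (z : ℂ) :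
    (interpExp θ L z).re = z.re ^ 2 - z.im ^ 2 - θ ^ 2 + z.re * L := by
  simp [interpExp, pow_two]

theorem differentiable_interpExp (θ L : ℝ) : Differentiable ℂ (interpExp θ L) := by
  unfold interpExp
  fun_prop

/-- The interpolating function, normalized to be bounded on the strip. -/
def interpFun (θ L : ℝ) (z : ℂ) : ℂ := Complex.exp (interpExp θ L z - (max L 0 : ℝ))

theorem differentiable_interpFun (θ L : ℝ) : Differentiable ℂ (interpFun θ L) :=
  ((differentiable_interpExp θ L).sub_const _).cexp

/-- On the strip `Re z² ≤ 1`, and `L Re z` is largest at one of the two edges. The bound does not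
depend on `L`, as needed to treat all coordinates at once. -/
theorem norm_interpFun_le (θ L : ℝ) {z : ℂ} (hz : z ∈ strip) :
    ‖interpFun θ L z‖ ≤ Real.exp 1 := by
  obtain ⟨h0, h1⟩ := hz
  rw [interpFun, Complex.norm_exp, Complex.sub_re, interpExp_re, Complex.ofReal_re, Real.exp_le_exp]
  have h2 : z.re * L ≤ max L 0 := by
    rcases le_total L 0 with h | h
    · exact (mul_nonpos_of_nonneg_of_nonpos h0 h).trans (le_max_right _ _)
    · exact (mul_le_of_le_one_left h h1).trans (le_max_left _ _)
  nlinarith [sq_nonneg z.im, sq_nonneg θ]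

variable [NormedSpace ℂ B]

theorem interpFun_smul (θ L : ℝ) (z : ℂ) (c : B) :
    interpFun θ L z • (((Real.exp (max L 0) : ℝ) : ℂ) • c) = Complex.exp (interpExp θ L z) • c := by
  rw [smul_smul, interpFun, Complex.ofReal_exp, ← Complex.exp_add, sub_add_cancel]

/-- A Schwarz-lemma bound for difference quotients, again independent of `L`; it dominates the
quotients in the proof of analyticity. -/
theorem norm_dslope_interpFun_le (θ L : ℝ) {z w : ℂ} {δ : ℝ} (hδ : 0 < δ)
    (hball : Metric.ball z δ ⊆ strip) (hw : w ∈ Metric.ball z δ) :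
    ‖dslope (interpFun θ L) z w‖ ≤ 2 * Real.exp 1 / δ := by
  refine Complex.norm_dslope_le_div_of_mapsTo_ball
    (differentiable_interpFun θ L).differentiableOn (fun u hu => ?_) hw
  rw [mem_closedBall_iff_norm]
  refine (norm_sub_le _ _).trans ?_
  have h1 := norm_interpFun_le θ L (hball hu)
  have h2 := norm_interpFun_le θ L (hball (Metric.mem_ball_self hδ))
  linarith

theorem tendsto_exp_neg_sq_cocompact (A : ℝ) :
    Tendsto (fun u : ℝ => ENNReal.ofReal (Real.exp (A - u ^ 2))) (cocompact ℝ) (𝓝 0) := by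
  rw [← ENNReal.ofReal_zero]
  refine ENNReal.tendsto_ofReal (Real.tendsto_exp_atBot.comp ?_)
  have h1 : Tendsto (fun u : ℝ => u ^ 2) (cocompact ℝ) atTop := by
    have h2 := (tendsto_pow_atTop (α := ℝ) two_ne_zero).comp (tendsto_norm_cocompact_atTop (E := ℝ))
    refine h2.congr fun u => ?_
    simp
  simpa [sub_eq_add_neg] using tendsto_atBot_add_const_left (cocompact ℝ) A
    (tendsto_neg_atTop_atBot.comp h1)

theorem exists_ball_subset_strip {z : ℂ} (h0 : 0 < z.re) (h1 : z.re < 1) :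
    ∃ δ > 0, Metric.ball z δ ⊆ strip := by
  have hopen : IsOpen {w : ℂ | 0 < w.re ∧ w.re < 1} :=
    (isOpen_lt continuous_const Complex.continuous_re).inter
      (isOpen_lt Complex.continuous_re continuous_const)
  obtain ⟨δ, hδ, h⟩ := Metric.isOpen_iff.1 hopen z ⟨h0, h1⟩
  exact ⟨δ, hδ, fun w hw => ⟨(h hw).1.le, (h hw).2.le⟩⟩

section Calderon

variable (θ : ℝ) (L : ℕ → ℝ) {c : ℕ → B} {M : ℝ≥0∞}

/-- The interpolating family of sequences. -/
def interpFamily (θ : ℝ) (L : ℕ → ℝ) (c : ℕ → B) (z : ℂ) (j : ℕ) : B :=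
  Complex.exp (interpExp θ (L j) z) • c j

theorem wNorm_interpFamily_zero_le (hq₀ : 0 < q₀) (t : ℝ) (hc : wNorm q₀ α c ≤ M) :
    wNorm q₀ α (interpFamily θ L c (t * Complex.I)) ≤ ENNReal.ofReal (Real.exp (1 - t ^ 2)) * M := by
  refine (wNorm_le_of_le hq₀ (C := c) (R := ENNReal.ofReal (Real.exp (1 - t ^ 2)))
    fun j => ?_).trans (by gcongr)
  rw [interpFamily, enorm_smul]
  gcongr
  rw [← ofReal_norm, Complex.norm_exp, interpExp_re]
  refine ENNReal.ofReal_le_ofReal (Real.exp_le_exp.2 ?_)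
  simp
  nlinarith [sq_nonneg θ]

theorem wNorm_interpFamily_one_le (hq₁ : 0 < q₁) (t : ℝ)
    (hc : wNorm q₁ β (fun j => ((Real.exp (L j) : ℝ) : ℂ) • c j) ≤ M) :
    wNorm q₁ β (interpFamily θ L c (1 + t * Complex.I))
      ≤ ENNReal.ofReal (Real.exp (1 - t ^ 2)) * M := by
  refine (wNorm_le_of_le hq₁ (C := fun j => ((Real.exp (L j) : ℝ) : ℂ) • c j)
    (R := ENNReal.ofReal (Real.exp (1 - t ^ 2))) fun j => ?_).trans (by gcongr)
  rw [interpFamily, enorm_smul, enorm_smul, ← mul_assoc]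
  gcongr
  rw [← ofReal_norm, ← ofReal_norm, Complex.norm_exp, interpExp_re,
    Complex.norm_of_nonneg (Real.exp_nonneg _), ← ENNReal.ofReal_mul (Real.exp_nonneg _),
    ← Real.exp_add]
  refine ENNReal.ofReal_le_ofReal (Real.exp_le_exp.2 ?_)
  simp
  nlinarith [sq_nonneg θ]

/-- Each coordinate is an explicit entire function, so continuity and analyticity are clear there;
dominated convergence in `ℓ_q`, with majorants independent of the coordinate, carries them to the
sequence spaces. The factor `exp (z²)` forces decay along the edges. -/
theorem isCalderon_interpFamily (hq₀ : 0 < q₀) (hqt₀ : q₀ ≠ ∞) (hq₁ : 0 < q₁)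
    (hqt₁ : q₁ ≠ ∞) (hM : M ≠ ∞) (hc₀ : wNorm q₀ α c ≤ M)
    (hc₁ : wNorm q₁ β (fun j => ((Real.exp (L j) : ℝ) : ℂ) • c j) ≤ M) :
    IsCalderon (wNorm q₀ α) (wNorm q₁ β) (interpFamily θ L c) := by
  -- Coordinates with `L j > 0` are largest on the right edge and go to the second space.
  -- Accordingly `C` carries the edge where each coordinate peaks, and its two parts are controlled
  -- by the two hypotheses.
  set P : Set ℕ := {j | 0 < L j} with hP
  set C : ℕ → B := fun j => ((Real.exp (max (L j) 0) : ℝ) : ℂ) • c j with hC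
  have hC₀ : wNorm q₀ α (Pᶜ.indicator C) ≤ M := by
    refine le_trans ?_ hc₀
    refine (wNorm_le_of_le hq₀ (C := c) (R := 1) fun j => ?_).trans (by rw [one_mul])
    by_cases hj : j ∈ P
    · simp [hj]
    · have hj' : L j ≤ 0 := not_lt.1 hj
      simp [hj, hC, max_eq_right hj']
  have hC₁ : wNorm q₁ β (P.indicator C) ≤ M := by
    refine le_trans ?_ hc₁
    refine (wNorm_le_of_le hq₁ (C := fun j => ((Real.exp (L j) : ℝ) : ℂ) • c j) (R := 1)
      fun j => ?_).trans (by rw [one_mul])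
    by_cases hj : j ∈ P
    · have hj' : 0 < L j := hj
      simp [hj, hC, max_eq_left hj'.le]
    · simp [hj]
  have hC₀' := (hC₀.trans_lt hM.lt_top).ne
  have hC₁' := (hC₁.trans_lt hM.lt_top).ne
  have hf : ∀ z j, interpFamily θ L c z j = interpFun θ (L j) z • C j := fun z j =>
    (interpFun_smul θ (L j) z (c j)).symm
  have hbd : ∀ z ∈ strip, ∀ j, ‖interpFun θ (L j) z‖ₑ ≤ ENNReal.ofReal (Real.exp 1) :=
    fun z hz j => by
      rw [← ofReal_norm]
      exact ENNReal.ofReal_le_ofReal (norm_interpFun_le θ (L j) hz)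
  have hsub : ∀ {z w : ℂ}, z ∈ strip → w ∈ strip → ∀ j,
      ‖interpFun θ (L j) w - interpFun θ (L j) z‖ₑ
        ≤ ENNReal.ofReal (Real.exp 1) + ENNReal.ofReal (Real.exp 1) := fun hz hw j =>
    (enorm_sub_le).trans (add_le_add (hbd _ hw j) (hbd _ hz j))
  have hcont : ∀ (z : ℂ) j, Tendsto (fun w => ‖interpFun θ (L j) w - interpFun θ (L j) z‖ₑ)
      (𝓝 z) (𝓝 0) := fun z j => by
    have h := (((differentiable_interpFun θ (L j)).continuous.tendsto z).sub_const
      (interpFun θ (L j) z)).enorm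
    simpa using h
  refine ⟨?_, ?_, ?_, ?_, ?_, ?_, ?_, ?_, ?_⟩
  · refine ⟨(ENNReal.ofReal (Real.exp 1) * (M + M)).toNNReal, fun z hz => ?_⟩
    rw [ENNReal.coe_toNNReal (ENNReal.mul_ne_top ENNReal.ofReal_ne_top (by simp [hM]))]
    refine (sumENorm_wNorm_le_of_le hq₀ hq₁ P (C := C) (R := ENNReal.ofReal (Real.exp 1))
      fun j => ?_).trans (by gcongr)
    rw [hf, enorm_smul]
    gcongr
    exact hbd z hz j
  · intro z hz
    refine tendsto_sumENorm_wNorm_zero hq₀ hqt₀ hq₁ hqt₁ P hC₀' hC₁'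
      (ρ := fun w j => ‖interpFun θ (L j) w - interpFun θ (L j) z‖ₑ)
      (R := ENNReal.ofReal (Real.exp 1) + ENNReal.ofReal (Real.exp 1)) (by simp) ?_
      (fun j => (hcont z j).mono_left nhdsWithin_le_nhds) fun w j => ?_
    · filter_upwards [self_mem_nhdsWithin] with w hw j using hsub hz hw j
    · rw [Pi.sub_apply, hf, hf, ← sub_smul, enorm_smul]
  · intro z hz0 hz1
    obtain ⟨δ, hδ, hball⟩ := exists_ball_subset_strip hz0 hz1
    have hbd' : ∀ w ∈ Metric.ball z δ, ∀ j, ‖dslope (interpFun θ (L j)) z w‖ₑ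
        ≤ ENNReal.ofReal (2 * Real.exp 1 / δ) := fun w hw j => by
      rw [← ofReal_norm]
      exact ENNReal.ofReal_le_ofReal (norm_dslope_interpFun_le θ (L j) hδ hball hw)
    refine ⟨fun j => dslope (interpFun θ (L j)) z z • C j, ?_, ?_⟩
    · refine (sumENorm_wNorm_le_of_le hq₀ hq₁ P (C := C) (R := ENNReal.ofReal (2 * Real.exp 1 / δ))
        fun j => ?_).trans_lt (ENNReal.mul_lt_top ENNReal.ofReal_lt_top
          (ENNReal.add_lt_top.2 ⟨hC₀'.lt_top, hC₁'.lt_top⟩))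
      rw [enorm_smul]
      gcongr
      exact hbd' z (Metric.mem_ball_self hδ) j
    · have hcd : ∀ j, ContinuousAt (dslope (interpFun θ (L j)) z) z := fun j =>
        continuousAt_dslope_same.2 (differentiable_interpFun θ (L j) z)
      have key := tendsto_sumENorm_wNorm_zero (α := α) (β := β) (l := 𝓝[≠] z) hq₀ hqt₀ hq₁ hqt₁ P
        hC₀' hC₁'
        (ρ := fun w j => ‖dslope (interpFun θ (L j)) z w - dslope (interpFun θ (L j)) z z‖ₑ)
        (x := fun w j => (dslope (interpFun θ (L j)) z w - dslope (interpFun θ (L j)) z z) • C j)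
        (R := ENNReal.ofReal (2 * Real.exp 1 / δ) + ENNReal.ofReal (2 * Real.exp 1 / δ)) (by simp)
        ?_ (fun j => ?_) fun w j => by rw [enorm_smul]
      · refine key.congr' ?_
        filter_upwards [self_mem_nhdsWithin] with w hw
        congr 1
        funext j
        rw [Pi.sub_apply, Pi.smul_apply, Pi.sub_apply, hf, hf, ← sub_smul,
          smul_smul _ _ (C j), ← sub_smul, dslope_of_ne _ hw, slope_def_module, smul_eq_mul]
      · filter_upwards [mem_nhdsWithin_of_mem_nhds (Metric.ball_mem_nhds z hδ)] with w hw j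
        exact enorm_sub_le.trans (add_le_add (hbd' w hw j) (hbd' z (Metric.mem_ball_self hδ) j))
      · have h := ((hcd j).tendsto.sub_const (dslope (interpFun θ (L j)) z z)).enorm
        rw [sub_self, enorm_zero] at h
        exact h.mono_left nhdsWithin_le_nhds
  · intro t
    exact (wNorm_interpFamily_zero_le θ L hq₀ t hc₀).trans_lt
      (ENNReal.mul_lt_top ENNReal.ofReal_lt_top hM.lt_top)
  · intro t
    exact (wNorm_interpFamily_one_le θ L hq₁ t hc₁).trans_lt
      (ENNReal.mul_lt_top ENNReal.ofReal_lt_top hM.lt_top)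
  · intro t
    have hexp : ∀ (u : ℝ) j, ‖Complex.exp (interpExp θ (L j) (u * Complex.I))‖ ≤ 1 := fun u j => by
      rw [Complex.norm_exp, interpExp_re, Real.exp_le_one_iff]
      simp
      nlinarith [sq_nonneg θ, sq_nonneg u]
    refine tendsto_wNorm_zero hq₀ hqt₀ (C := c) (hc₀.trans_lt hM.lt_top).ne (ρ := fun u j =>
      ‖Complex.exp (interpExp θ (L j) (u * Complex.I)) -
        Complex.exp (interpExp θ (L j) (t * Complex.I))‖ₑ) (R := 1 + 1) (by simp)
      (Eventually.of_forall fun u j => ?_) (fun j => ?_) fun u j => ?_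
    · refine enorm_sub_le.trans (add_le_add ?_ ?_) <;>
      · rw [← ofReal_norm, ← ENNReal.ofReal_one]
        exact ENNReal.ofReal_le_ofReal (hexp _ j)
    · have hc : Continuous fun u : ℝ => Complex.exp (interpExp θ (L j) (u * Complex.I)) :=
        ((differentiable_interpExp θ (L j)).continuous.comp (by fun_prop)).cexp
      have h := ((hc.tendsto t).sub_const
        (Complex.exp (interpExp θ (L j) (t * Complex.I)))).enorm
      simpa using h
    · rw [Pi.sub_apply, interpFamily, interpFamily, ← sub_smul, enorm_smul]
  · intro t
    -- On the right edge the factor `exp (L j)` is moved into the majorant sequence, leaving a bound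
    -- free of `L j`.
    have hexp : ∀ (u : ℝ) j,
        ‖Complex.exp (interpExp θ (L j) (1 + u * Complex.I) - L j)‖ ≤ Real.exp 1 := fun u j => by
      rw [Complex.norm_exp, Complex.sub_re, interpExp_re, Real.exp_le_exp]
      simp
      nlinarith [sq_nonneg θ, sq_nonneg u]
    refine tendsto_wNorm_zero hq₁ hqt₁ (C := fun j => ((Real.exp (L j) : ℝ) : ℂ) • c j)
      (hc₁.trans_lt hM.lt_top).ne (ρ := fun u j =>
      ‖Complex.exp (interpExp θ (L j) (1 + u * Complex.I) - L j) -
        Complex.exp (interpExp θ (L j) (1 + t * Complex.I) - L j)‖ₑ)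
      (R := ENNReal.ofReal (Real.exp 1) + ENNReal.ofReal (Real.exp 1)) (by simp)
      (Eventually.of_forall fun u j => ?_) (fun j => ?_) fun u j => ?_
    · refine enorm_sub_le.trans (add_le_add ?_ ?_) <;>
      · rw [← ofReal_norm]
        exact ENNReal.ofReal_le_ofReal (hexp _ j)
    · have hc : Continuous fun u : ℝ =>
          Complex.exp (interpExp θ (L j) (1 + u * Complex.I) - L j) :=
        (((differentiable_interpExp θ (L j)).continuous.comp (by fun_prop)).sub
          continuous_const).cexp
      have h := ((hc.tendsto t).sub_const
        (Complex.exp (interpExp θ (L j) (1 + t * Complex.I) - L j))).enorm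
      simpa using h
    · rw [← enorm_smul, smul_smul, sub_mul, Complex.ofReal_exp, ← Complex.exp_add,
        ← Complex.exp_add, sub_add_cancel, sub_add_cancel, Pi.sub_apply, interpFamily,
        interpFamily, ← sub_smul]
  · have h := ENNReal.Tendsto.mul_const (b := M) (tendsto_exp_neg_sq_cocompact 1) (Or.inr hM)
    rw [zero_mul] at h
    exact tendsto_of_tendsto_of_tendsto_of_le_of_le tendsto_const_nhds h (fun _ => bot_le)
      fun t => wNorm_interpFamily_zero_le θ L hq₀ t hc₀
  · have h := ENNReal.Tendsto.mul_const (b := M) (tendsto_exp_neg_sq_cocompact 1) (Or.inr hM)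
    rw [zero_mul] at h
    exact tendsto_of_tendsto_of_tendsto_of_le_of_le tendsto_const_nhds h (fun _ => bot_le)
      fun t => wNorm_interpFamily_one_le θ L hq₁ t hc₁

/-- The coefficients `c j = exp (-θ L_j) a j` make the family pass through `a` at `θ`; the
hypotheses are the sizes of its moduli on the two edges. The sequence `L` remains free to be
optimized. -/
theorem interpENorm_le_of_wNorm_le (hq₀ : 0 < q₀) (hqt₀ : q₀ ≠ ∞) (hq₁ : 0 < q₁)
    (hqt₁ : q₁ ≠ ∞) {a : ℕ → B} (hM : M ≠ ∞)
    (h₀ : wNorm q₀ α (fun j => ((Real.exp (-(θ * L j)) : ℝ) : ℂ) • a j) ≤ M)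
    (h₁ : wNorm q₁ β (fun j => ((Real.exp ((1 - θ) * L j) : ℝ) : ℂ) • a j) ≤ M) :
    interpENorm (wNorm q₀ α) (wNorm q₁ β) θ a ≤ ENNReal.ofReal (Real.exp 1) * M := by
  set c : ℕ → B := fun j => ((Real.exp (-(θ * L j)) : ℝ) : ℂ) • a j with hc
  have h₁' : wNorm q₁ β (fun j => ((Real.exp (L j) : ℝ) : ℂ) • c j) ≤ M := by
    refine le_trans (le_of_eq ?_) h₁
    congr 1
    funext j
    rw [hc, smul_smul, ← Complex.ofReal_mul, ← Real.exp_add]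
    congr 3
    ring
  have hval : interpFamily θ L c θ = a := by
    funext j
    rw [interpFamily, hc, smul_smul, Complex.ofReal_exp, ← Complex.exp_add]
    have : interpExp θ (L j) θ + ((-(θ * L j) : ℝ) : ℂ) = 0 := by
      rw [interpExp]; push_cast; ring
    rw [this, Complex.exp_zero, one_smul]
  refine (iInf₂_le (interpFamily θ L c)
    ⟨isCalderon_interpFamily θ L hq₀ hqt₀ hq₁ hqt₁ hM h₀ h₁', hval⟩).trans ?_
  have hle : ∀ t : ℝ, ENNReal.ofReal (Real.exp (1 - t ^ 2)) * M ≤ ENNReal.ofReal (Real.exp 1) * M :=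
    fun t => by
      gcongr
      nlinarith [sq_nonneg t]
  exact max_le (iSup_le fun t => (wNorm_interpFamily_zero_le θ L hq₀ t h₀).trans (hle t))
    (iSup_le fun t => (wNorm_interpFamily_one_le θ L hq₁ t h₁').trans (hle t))

end Calderon

/-- The interpolation norm of a couple of weighted `ℓ_q` spaces: upper bound. -/
theorem interpENorm_le_wNorm {θ : ℝ} (hq₀ : 0 < q₀) (hqt₀ : q₀ ≠ ∞) (hq₁ : 0 < q₁) (hqt₁ : q₁ ≠ ∞)
    (hq : 0 < q) (hqt : q ≠ ∞)
    (hqq : 1 / q.toReal = (1 - θ) / q₀.toReal + θ / q₁.toReal) (a : ℕ → B) :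
    interpENorm (wNorm q₀ α) (wNorm q₁ β) θ a
      ≤ ENNReal.ofReal (Real.exp 1) * wNorm q (fun j => (1 - θ) * α j + θ * β j) a := by
  set M := wNorm q (fun j => (1 - θ) * α j + θ * β j) a with hM
  have hr : 0 < q.toReal := ENNReal.toReal_pos hq.ne' hqt
  have hr₀ : 0 < q₀.toReal := ENNReal.toReal_pos hq₀.ne' hqt₀
  have hr₁ : 0 < q₁.toReal := ENNReal.toReal_pos hq₁.ne' hqt₁
  set r := q.toReal
  set r₀ := q₀.toReal
  set r₁ := q₁.toReal
  by_cases hMt : M = ∞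
  · rw [hMt, ENNReal.mul_top (by simp [Real.exp_pos])]
    exact le_top
  -- The normalization below divides by `M`.
  by_cases hM0 : M = 0
  · have ha : a = 0 := by
      funext j
      have h1 := le_elq hq (fun j => ENNReal.ofReal (Real.exp ((1 - θ) * α j + θ * β j)) * ‖a j‖ₑ) j
      have h2 : ENNReal.ofReal (Real.exp ((1 - θ) * α j + θ * β j)) * ‖a j‖ₑ = 0 :=
        nonpos_iff_eq_zero.1 (h1.trans_eq hM0)
      simpa [(Real.exp_pos _).not_ge] using h2
    refine interpENorm_le_of_wNorm_le θ (fun _ => 0) hq₀ hqt₀ hq₁ hqt₁ hMt ?_ ?_ <;>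
    · rw [hM0, ha, nonpos_iff_eq_zero]
      refine nonpos_iff_eq_zero.1 ((wNorm_le_of_le (by assumption) (C := (0 : ℕ → B)) (R := 0)
        fun j => ?_).trans (by rw [zero_mul]))
      simp
  set m := M.toReal with hm
  have hmpos : 0 < m := ENNReal.toReal_pos hM0 hMt
  have hMm : M = ENNReal.ofReal m := (ENNReal.ofReal_toReal hMt).symm
  set b : ℕ → ℝ := fun j => Real.exp ((1 - θ) * α j + θ * β j) * ‖a j‖ / m with hb
  -- With this `L` the weighted entries on the two edges become `M b_j^{r/r₀}` and `M b_j^{r/r₁}`.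
  -- As `∑ b_j^r = 1`, both edge norms are at most `M`.
  set L : ℕ → ℝ := fun j => (r / r₁ - r / r₀) * Real.log (b j) + α j - β j with hL
  have hsum : ∑' j, ENNReal.ofReal (b j) ^ r = 1 := by
    have h1 : ∀ j, ENNReal.ofReal (b j)
        = M⁻¹ * (ENNReal.ofReal (Real.exp ((1 - θ) * α j + θ * β j)) * ‖a j‖ₑ) := fun j => by
      rw [hb, hMm, ENNReal.ofReal_div_of_pos hmpos, ENNReal.ofReal_mul (Real.exp_nonneg _),
        ofReal_norm, ENNReal.div_eq_inv_mul]
    rw [← elq_rpow hq hqt]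
    simp only [h1]
    rw [elq_const_mul hq]
    change (M⁻¹ * M) ^ r = 1
    rw [ENNReal.inv_mul_cancel hM0 hMt, ENNReal.one_rpow]
  have hid : r * ((1 - θ) / r₀ + θ / r₁) = 1 := by
    rw [← hqq]; field_simp
  have hgen : ∀ {s : ℝ≥0∞} {δ : ℕ → ℝ} {k : ℝ}, 0 < s → s ≠ ∞ → (∀ j, a j ≠ 0 →
      δ j + k * L j = (1 - θ) * α j + θ * β j + (r / s.toReal - 1) * Real.log (b j)) →
      wNorm s δ (fun j => ((Real.exp (k * L j) : ℝ) : ℂ) • a j) ≤ M := by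
    intro s δ k hs hst h
    have hrs : 0 < s.toReal := ENNReal.toReal_pos hs.ne' hst
    have h1 : ∀ j, ENNReal.ofReal (Real.exp (δ j)) * ‖((Real.exp (k * L j) : ℝ) : ℂ) • a j‖ₑ
        = M * ENNReal.ofReal (b j) ^ (r / s.toReal) := by
      intro j
      by_cases haj : a j = 0
      · have : b j = 0 := by simp [hb, haj]
        rw [haj, this, ENNReal.ofReal_zero, ENNReal.zero_rpow_of_pos (by positivity)]
        simp
      have hbj : 0 < b j := by
        have := norm_pos_iff.2 haj
        positivity
      rw [enorm_smul, ← ofReal_norm, ← ofReal_norm, Complex.norm_of_nonneg (Real.exp_nonneg _),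
        ENNReal.ofReal_rpow_of_pos hbj, hMm, ← ENNReal.ofReal_mul (Real.exp_nonneg _),
        ← ENNReal.ofReal_mul (Real.exp_nonneg _), ← ENNReal.ofReal_mul hmpos.le]
      congr 1
      rw [← mul_assoc, ← Real.exp_add, h j haj, Real.exp_add, mul_comm (r / s.toReal - 1),
        ← Real.rpow_def_of_pos hbj, Real.rpow_sub hbj, Real.rpow_one]
      have h2 : Real.exp ((1 - θ) * α j + θ * β j) * ‖a j‖ = m * b j := by
        rw [hb]; field_simp
      calc _ = Real.exp ((1 - θ) * α j + θ * β j) * ‖a j‖ * (b j ^ (r / s.toReal) / b j) := by ring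
        _ = _ := by rw [h2]; field_simp
    rw [wNorm]
    simp only [h1]
    rw [elq_const_mul hs, elq_of_ne_top hst]
    have h3 : ∀ j, (ENNReal.ofReal (b j) ^ (r / s.toReal)) ^ s.toReal = ENNReal.ofReal (b j) ^ r :=
      fun j => by rw [← ENNReal.rpow_mul, div_mul_cancel₀ _ hrs.ne']
    simp only [h3]
    rw [hsum, ENNReal.one_rpow, mul_one]
  refine interpENorm_le_of_wNorm_le θ L hq₀ hqt₀ hq₁ hqt₁ hMt ?_ ?_
  · simp only [← neg_mul]
    refine hgen hq₀ hqt₀ fun j _ => ?_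
    rw [hL]
    change _ = _ + (r / r₀ - 1) * _
    linear_combination (-Real.log (b j)) * hid
  · refine hgen hq₁ hqt₁ fun j _ => ?_
    rw [hL]
    change _ = _ + (r / r₁ - 1) * _
    linear_combination (-Real.log (b j)) * hid

end Upper

/-! ### Weighted sequence spaces: the lower bound for the interpolation norm -/

section Lower

variable {B : Type*} [NormedAddCommGroup B] {q q₀ q₁ : ℝ≥0∞} {α β : ℕ → ℝ}

theorem enorm_le_wNorm (hq : 0 < q) (x : ℕ → B) (j : ℕ) :
    ‖x j‖ₑ ≤ ENNReal.ofReal (Real.exp (-α j)) * wNorm q α x := by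
  have h1 := le_elq hq (fun j => ENNReal.ofReal (Real.exp (α j)) * ‖x j‖ₑ) j
  calc ‖x j‖ₑ = ENNReal.ofReal (Real.exp (-α j)) * (ENNReal.ofReal (Real.exp (α j)) * ‖x j‖ₑ) := by
        rw [← mul_assoc, ← ENNReal.ofReal_mul (Real.exp_nonneg _), ← Real.exp_add, neg_add_cancel,
          Real.exp_zero, ENNReal.ofReal_one, one_mul]
    _ ≤ _ := mul_le_mul_right h1 _

/-- Coordinates are continuous on the sum space, so each coordinate of a Calderón function is an
ordinary bounded analytic function on the strip. -/
theorem enorm_le_sumENorm (hq₀ : 0 < q₀) (hq₁ : 0 < q₁) (x : ℕ → B) (j : ℕ) :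
    ‖x j‖ₑ ≤ (ENNReal.ofReal (Real.exp (-α j)) + ENNReal.ofReal (Real.exp (-β j))) *
      sumENorm (wNorm q₀ α) (wNorm q₁ β) x := by
  have h0 : ENNReal.ofReal (Real.exp (-α j)) + ENNReal.ofReal (Real.exp (-β j)) ≠ 0 := by
    simp [Real.exp_pos]
  rw [sumENorm, ENNReal.mul_iInf_of_ne h0 (by simp)]
  refine le_iInf fun b => ?_
  calc ‖x j‖ₑ = ‖b j + (x - b) j‖ₑ := by rw [Pi.sub_apply, add_sub_cancel]
    _ ≤ ‖b j‖ₑ + ‖(x - b) j‖ₑ := enorm_add_le _ _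
    _ ≤ ENNReal.ofReal (Real.exp (-α j)) * wNorm q₀ α b +
        ENNReal.ofReal (Real.exp (-β j)) * wNorm q₁ β (x - b) :=
        add_le_add (enorm_le_wNorm hq₀ b j) (enorm_le_wNorm hq₁ (x - b) j)
    _ ≤ _ := by
        rw [mul_add]
        gcongr
        · exact le_self_add
        · exact le_add_self

/-- Hölder's inequality in the form needed for the duality argument. -/
theorem sum_mul_rpow_le {r r₀ : ℝ} (hr₀ : 1 ≤ r₀) (F : Finset ℕ) {x y : ℕ → ℝ} (hx : ∀ j, 0 ≤ x j)
    (hy : ∀ j ∈ F, 0 < y j) {K : ℝ} (hK : 0 ≤ K) (hxK : ∑ j ∈ F, x j ^ r₀ ≤ K ^ r₀) :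
    ∑ j ∈ F, x j * y j ^ (r * (1 - r₀⁻¹)) ≤ K * (∑ j ∈ F, y j ^ r) ^ (1 - r₀⁻¹) := by
  have hr0 : 0 < r₀ := by linarith
  -- Weighted Hölder with weights `y_j^r` and entries `x_j y_j^{-r/r₀}`; this form also covers `r₀ =
  -- 1`. The absolute values only make nonnegativity hold off `F`.
  have h := Real.inner_le_weight_mul_Lp_of_nonneg F hr₀ (fun j => |y j| ^ r)
    (fun j => x j * |y j| ^ (-(r * r₀⁻¹))) (fun j => by positivity)
    (fun j => mul_nonneg (hx j) (by positivity))
  have h1 : ∑ j ∈ F, |y j| ^ r * (x j * |y j| ^ (-(r * r₀⁻¹)))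
      = ∑ j ∈ F, x j * y j ^ (r * (1 - r₀⁻¹)) := by
    refine Finset.sum_congr rfl fun j hj => ?_
    rw [abs_of_pos (hy j hj), mul_left_comm, ← Real.rpow_add (hy j hj)]
    congr 2
    ring
  have h2 : ∑ j ∈ F, |y j| ^ r * (x j * |y j| ^ (-(r * r₀⁻¹))) ^ r₀ = ∑ j ∈ F, x j ^ r₀ := by
    refine Finset.sum_congr rfl fun j hj => ?_
    have hyj := hy j hj
    rw [abs_of_pos hyj, Real.mul_rpow (hx j) (by positivity), ← Real.rpow_mul hyj.le,
      mul_left_comm, ← Real.rpow_add hyj]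
    have : r + -(r * r₀⁻¹) * r₀ = 0 := by field_simp; ring
    rw [this, Real.rpow_zero, mul_one]
  have h3 : ∑ j ∈ F, |y j| ^ r = ∑ j ∈ F, y j ^ r :=
    Finset.sum_congr rfl fun j hj => by rw [abs_of_pos (hy j hj)]
  rw [h1, h2, h3] at h
  refine h.trans ?_
  rw [mul_comm]
  have hS : 0 ≤ ∑ j ∈ F, y j ^ r := Finset.sum_nonneg fun j hj => (Real.rpow_pos_of_pos (hy j hj) _).le
  have h4 : (∑ j ∈ F, x j ^ r₀) ^ r₀⁻¹ ≤ K := by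
    calc (∑ j ∈ F, x j ^ r₀) ^ r₀⁻¹ ≤ (K ^ r₀) ^ r₀⁻¹ := by
          refine Real.rpow_le_rpow (Finset.sum_nonneg fun j _ => Real.rpow_nonneg (hx j) _) hxK
            (by positivity)
      _ = K := by rw [← Real.rpow_mul hK, mul_inv_cancel₀ hr0.ne', Real.rpow_one]
  gcongr

theorem sum_rpow_le_of_wNorm_le (hq : 0 < q) (hqt : q ≠ ∞) {x : ℕ → B} {K : ℝ} (hK : 0 ≤ K)
    (h : wNorm q α x ≤ ENNReal.ofReal K) (F : Finset ℕ) :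
    ∑ j ∈ F, (Real.exp (α j) * ‖x j‖) ^ q.toReal ≤ K ^ q.toReal := by
  have hr : 0 < q.toReal := ENNReal.toReal_pos hq.ne' hqt
  have h1 := ENNReal.rpow_le_rpow h hr.le
  rw [wNorm, elq_rpow hq hqt, ENNReal.ofReal_rpow_of_nonneg hK hr.le] at h1
  have h2 := (ENNReal.sum_le_tsum F).trans h1
  have h3 : ∀ j, (ENNReal.ofReal (Real.exp (α j)) * ‖x j‖ₑ) ^ q.toReal
      = ENNReal.ofReal ((Real.exp (α j) * ‖x j‖) ^ q.toReal) := fun j => by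
    rw [← ofReal_norm, ← ENNReal.ofReal_mul (Real.exp_nonneg _),
      ENNReal.ofReal_rpow_of_nonneg (by positivity) hr.le]
  simp only [h3] at h2
  rw [← ENNReal.ofReal_sum_of_nonneg fun j _ => by positivity] at h2
  exact (ENNReal.ofReal_le_ofReal_iff (by positivity)).1 h2

theorem tendsto_enorm_coord (hq₀ : 0 < q₀) (hq₁ : 0 < q₁) {ι : Type*} {l : Filter ι}
    {x : ι → ℕ → B} (h : Tendsto (fun i => sumENorm (wNorm q₀ α) (wNorm q₁ β) (x i)) l (𝓝 0))
    (j : ℕ) : Tendsto (fun i => x i j) l (𝓝 0) := by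
  rw [tendsto_zero_iff_norm_tendsto_zero]
  have h1 := ENNReal.Tendsto.const_mul
    (a := ENNReal.ofReal (Real.exp (-α j)) + ENNReal.ofReal (Real.exp (-β j))) h (Or.inr (by simp))
  rw [mul_zero] at h1
  have h2 : Tendsto (fun i => ‖x i j‖ₑ) l (𝓝 0) :=
    tendsto_of_tendsto_of_tendsto_of_le_of_le tendsto_const_nhds h1 (fun _ => bot_le)
      fun i => enorm_le_sumENorm hq₀ hq₁ (x i) j
  have h3 := (ENNReal.tendsto_toReal ENNReal.zero_ne_top).comp h2
  simpa [Function.comp_def] using h3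

variable [NormedSpace ℂ B]

open Complex.HadamardThreeLines

section Coordinates

variable {f : ℂ → ℕ → B}

theorem IsCalderon.coord_bounded (hq₀ : 0 < q₀) (hq₁ : 0 < q₁)
    (hf : IsCalderon (wNorm q₀ α) (wNorm q₁ β) f) (j : ℕ) :
    ∃ M : ℝ, ∀ z ∈ strip, ‖f z j‖ ≤ M := by
  obtain ⟨M, hM⟩ := hf.bounded
  refine ⟨((Real.toNNReal (Real.exp (-α j)) + Real.toNNReal (Real.exp (-β j))) * M : ℝ≥0),
    fun z hz => ?_⟩
  have h := (enorm_le_sumENorm (α := α) (β := β) hq₀ hq₁ (f z) j).trans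
    (mul_le_mul_right (hM z hz) _)
  rw [ENNReal.ofReal, ENNReal.ofReal, ← ENNReal.coe_add, ← ENNReal.coe_mul, enorm_eq_nnnorm,
    ENNReal.coe_le_coe] at h
  exact h

theorem IsCalderon.coord_continuousOn (hq₀ : 0 < q₀) (hq₁ : 0 < q₁)
    (hf : IsCalderon (wNorm q₀ α) (wNorm q₁ β) f) (j : ℕ) :
    ContinuousOn (fun z => f z j) strip := by
  intro z hz
  have h := tendsto_enorm_coord hq₀ hq₁ (hf.continuous z hz) j
  simp only [Pi.sub_apply] at h
  exact tendsto_sub_nhds_zero_iff.1 h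

theorem IsCalderon.coord_differentiableAt (hq₀ : 0 < q₀) (hq₁ : 0 < q₁)
    (hf : IsCalderon (wNorm q₀ α) (wNorm q₁ β) f) (j : ℕ) {z : ℂ} (h0 : 0 < z.re) (h1 : z.re < 1) :
    DifferentiableAt ℂ (fun z => f z j) z := by
  obtain ⟨g, -, hg⟩ := hf.analytic z h0 h1
  have h := tendsto_enorm_coord hq₀ hq₁ hg j
  refine HasDerivAt.differentiableAt (f' := g j) ?_
  rw [hasDerivAt_iff_tendsto_slope]
  refine (tendsto_sub_nhds_zero_iff.1 h).congr fun w => ?_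
  rw [slope_def_module]
  rfl

end Coordinates

theorem closure_verticalStrip_subset : closure (verticalStrip 0 1) ⊆ strip := by
  have hc : IsClosed strip := (isClosed_le continuous_const Complex.continuous_re).inter
    (isClosed_le Complex.continuous_re continuous_const)
  exact closure_minimal (fun z hz => ⟨hz.1.le, hz.2.le⟩) hc

/-- Duality and the three lines theorem. With functionals norming the entries of `f θ`, the scalar
function `G` equals `s = ∑ y_j^r` at `θ`, while Hölder bounds it on the edges by `K s^{1-1/r₀}` and
`K s^{1-1/r₁}`. Hence `s ≤ K s^{1-1/r}`. A finite index set of nonzero entries keeps logarithms and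
sums harmless. -/
theorem sum_rpow_le_of_isCalderon {θ : ℝ} (hθ₀ : 0 ≤ θ) (hθ₁ : θ ≤ 1) (hq₀ : 1 ≤ q₀)
    (hqt₀ : q₀ ≠ ∞) (hq₁ : 1 ≤ q₁) (hqt₁ : q₁ ≠ ∞) {r : ℝ} (hr : 0 < r)
    (hqq : 1 / r = (1 - θ) / q₀.toReal + θ / q₁.toReal) {f : ℂ → ℕ → B}
    (hf : IsCalderon (wNorm q₀ α) (wNorm q₁ β) f) {K : ℝ} (hK : 0 ≤ K)
    (hK₀ : ∀ t : ℝ, wNorm q₀ α (f (t * Complex.I)) ≤ ENNReal.ofReal K)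
    (hK₁ : ∀ t : ℝ, wNorm q₁ β (f (1 + t * Complex.I)) ≤ ENNReal.ofReal K)
    (F : Finset ℕ) (hF : ∀ j ∈ F, f θ j ≠ 0) :
    ∑ j ∈ F, (Real.exp ((1 - θ) * α j + θ * β j) * ‖f θ j‖) ^ r ≤ K ^ r := by
  have hq₀' : 0 < q₀ := zero_lt_one.trans_le hq₀
  have hq₁' : 0 < q₁ := zero_lt_one.trans_le hq₁
  have hr₀ : 1 ≤ q₀.toReal := by simpa using ENNReal.toReal_mono hqt₀ hq₀
  have hr₁ : 1 ≤ q₁.toReal := by simpa using ENNReal.toReal_mono hqt₁ hq₁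
  have hn₀ : ∀ t : ℝ, ∑ j ∈ F, (Real.exp (α j) * ‖f (t * Complex.I) j‖) ^ q₀.toReal
      ≤ K ^ q₀.toReal := fun t => sum_rpow_le_of_wNorm_le hq₀' hqt₀ hK (hK₀ t) F
  have hn₁ : ∀ t : ℝ, ∑ j ∈ F, (Real.exp (β j) * ‖f (1 + t * Complex.I) j‖) ^ q₁.toReal
      ≤ K ^ q₁.toReal := fun t => sum_rpow_le_of_wNorm_le hq₁' hqt₁ hK (hK₁ t) F
  set r₀ := q₀.toReal
  set r₁ := q₁.toReal
  set y : ℕ → ℝ := fun j => Real.exp ((1 - θ) * α j + θ * β j) * ‖f θ j‖ with hy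
  have hypos : ∀ j ∈ F, 0 < y j := fun j hj => mul_pos (Real.exp_pos _) (norm_pos_iff.2 (hF j hj))
  set s := ∑ j ∈ F, y j ^ r with hS
  rcases F.eq_empty_or_nonempty with hFe | hFne
  · rw [hS, hFe, Finset.sum_empty]
    positivity
  have hSpos : 0 < s := Finset.sum_pos (fun j hj => Real.rpow_pos_of_pos (hypos j hj) _) hFne
  choose ℓ hℓ1 hℓ2 using fun j => exists_dual_vector'' ℂ (f θ j)
  -- `u` and `v` are the logarithms of the extremal dual sequences at the two endpoints; their
  -- affine interpolation gives the extremal one at `θ`.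
  set u : ℕ → ℝ := fun j => α j + r * (1 - r₀⁻¹) * Real.log (y j) with hu
  set v : ℕ → ℝ := fun j => β j + r * (1 - r₁⁻¹) * Real.log (y j) with hv
  set e : ℕ → ℂ → ℂ := fun j z => Complex.exp ((1 - z) * u j + z * v j) with he
  have hed : ∀ j, Differentiable ℂ (e j) := fun j => by
    simp only [he]
    fun_prop
  have henorm : ∀ j z, ‖e j z‖ = Real.exp ((1 - z.re) * u j + z.re * v j) := fun j z => by
    rw [he, Complex.norm_exp]
    simp
  set G : ℂ → ℂ := fun z => ∑ j ∈ F, ℓ j (f z j) * e j z with hG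
  have hℓle : ∀ j x, ‖ℓ j x‖ ≤ ‖x‖ := fun j x => by
    simpa using (ℓ j).le_of_opNorm_le (hℓ1 j) x
  have hGle : ∀ z, ‖G z‖ ≤ ∑ j ∈ F, ‖f z j‖ * Real.exp ((1 - z.re) * u j + z.re * v j) := by
    intro z
    refine (norm_sum_le _ _).trans (Finset.sum_le_sum fun j _ => ?_)
    rw [norm_mul, henorm]
    gcongr
    exact hℓle _ _
  have hGcont : ContinuousOn G strip := continuousOn_finsetSum _ fun j _ =>
    ((ℓ j).continuous.comp_continuousOn (hf.coord_continuousOn hq₀' hq₁' j)).mul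
      (hed j).continuous.continuousOn
  have hdiff : DiffContOnCl ℂ G (verticalStrip 0 1) := by
    refine ⟨fun z hz => ?_, hGcont.mono closure_verticalStrip_subset⟩
    refine DifferentiableAt.differentiableWithinAt (DifferentiableAt.fun_sum fun j _ => ?_)
    exact ((ℓ j).differentiableAt.comp z
      (hf.coord_differentiableAt hq₀' hq₁' j hz.1 hz.2)).mul (hed j z)
  have hBdd : BddAbove ((norm ∘ G) '' verticalClosedStrip 0 1) := by
    choose Mj hMj using hf.coord_bounded hq₀' hq₁'
    refine ⟨∑ j ∈ F, Mj j * Real.exp (|u j| + |v j|), ?_⟩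
    rintro _ ⟨z, hz, rfl⟩
    have hz' : z ∈ strip := hz
    refine (hGle z).trans (Finset.sum_le_sum fun j _ => ?_)
    have h1 := hMj j z hz'
    have h2 : (1 - z.re) * u j + z.re * v j ≤ |u j| + |v j| := by
      refine add_le_add ?_ ?_
      · calc (1 - z.re) * u j ≤ (1 - z.re) * |u j| := by
              gcongr
              · linarith [hz'.2]
              · exact le_abs_self _
          _ ≤ 1 * |u j| := by gcongr; linarith [hz'.1]
          _ = _ := one_mul _
      · calc z.re * v j ≤ z.re * |v j| := by
              gcongr
              · exact hz'.1
              · exact le_abs_self _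
          _ ≤ 1 * |v j| := by gcongr; exact hz'.2
          _ = _ := one_mul _
    gcongr
    exact (norm_nonneg _).trans h1
  have hb₀ : ∀ z ∈ Complex.re ⁻¹' {0}, ‖G z‖ ≤ K * s ^ (1 - r₀⁻¹) := by
    intro z hz
    have hz0 : z.re = 0 := hz
    have hzt : z = (z.im : ℂ) * Complex.I := by
      apply Complex.ext <;> simp [hz0]
    refine (hGle z).trans ?_
    refine le_trans (le_of_eq ?_) (sum_mul_rpow_le (r := r) hr₀ F
      (x := fun j => Real.exp (α j) * ‖f z j‖) (fun j => by positivity) hypos hK ?_)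
    · refine Finset.sum_congr rfl fun j hj => ?_
      rw [hz0, sub_zero, one_mul, zero_mul, add_zero, hu, Real.exp_add, mul_comm _ (Real.log _),
        ← Real.rpow_def_of_pos (hypos j hj)]
      ring
    · rw [hzt]
      exact hn₀ z.im
  have hb₁ : ∀ z ∈ Complex.re ⁻¹' {1}, ‖G z‖ ≤ K * s ^ (1 - r₁⁻¹) := by
    intro z hz
    have hz1 : z.re = 1 := hz
    have hzt : z = 1 + (z.im : ℂ) * Complex.I := by
      apply Complex.ext <;> simp [hz1]
    refine (hGle z).trans ?_
    refine le_trans (le_of_eq ?_) (sum_mul_rpow_le (r := r) hr₁ F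
      (x := fun j => Real.exp (β j) * ‖f z j‖) (fun j => by positivity) hypos hK ?_)
    · refine Finset.sum_congr rfl fun j hj => ?_
      rw [hz1, sub_self, one_mul, zero_mul, zero_add, hv, Real.exp_add, mul_comm _ (Real.log _),
        ← Real.rpow_def_of_pos (hypos j hj)]
      ring
    · rw [hzt]
      exact hn₁ z.im
  have hmain := norm_le_interp_of_mem_verticalClosedStrip₀₁' G (z := (θ : ℂ))
    (show (θ : ℂ) ∈ verticalClosedStrip 0 1 from ⟨by simpa using hθ₀, by simpa using hθ₁⟩)
    hdiff hBdd hb₀ hb₁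
  rw [Complex.ofReal_re] at hmain
  have hexpo : (1 - r₀⁻¹) * (1 - θ) + (1 - r₁⁻¹) * θ = 1 - r⁻¹ := by
    rw [one_div] at hqq
    rw [hqq]
    ring
  have hGθ : G θ = (s : ℂ) := by
    rw [hG, hS, Complex.ofReal_sum]
    refine Finset.sum_congr rfl fun j hj => ?_
    have hyj := hypos j hj
    have hℓθ : ℓ j (f θ j) = ((‖f θ j‖ : ℝ) : ℂ) := hℓ2 j
    rw [hℓθ]
    have h1 : e j θ = ((Real.exp ((1 - θ) * α j + θ * β j) * y j ^ (r - 1) : ℝ) : ℂ) := by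
      rw [Real.rpow_def_of_pos hyj, ← Real.exp_add, Complex.ofReal_exp]
      simp only [he]
      congr 1
      have h2 : r * ((1 - r₀⁻¹) * (1 - θ) + (1 - r₁⁻¹) * θ) = r - 1 := by
        rw [hexpo, mul_sub, mul_inv_cancel₀ hr.ne', mul_one]
      rw [← h2]
      simp only [hu, hv]
      push_cast
      ring
    rw [h1, ← Complex.ofReal_mul]
    congr 1
    have h3 : ‖f θ j‖ * (Real.exp ((1 - θ) * α j + θ * β j) * y j ^ (r - 1))
        = y j * y j ^ (r - 1) := by rw [hy]; ring
    refine h3.trans ?_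
    rw [mul_comm, Real.rpow_sub_one hyj.ne', div_mul_cancel₀ _ hyj.ne']
  have hS_nonneg : ∀ x : ℝ, 0 ≤ s ^ x := fun x => Real.rpow_nonneg hSpos.le x
  rw [hGθ, Complex.norm_of_nonneg hSpos.le, Real.mul_rpow hK (hS_nonneg _), Real.mul_rpow hK (hS_nonneg _),
    ← Real.rpow_mul hSpos.le, ← Real.rpow_mul hSpos.le, mul_mul_mul_comm,
    ← Real.rpow_add_of_nonneg hK (by linarith) hθ₀, ← Real.rpow_add hSpos, hexpo, sub_add_cancel,
    Real.rpow_one, Real.rpow_sub hSpos, Real.rpow_one] at hmain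
  have hp := Real.rpow_pos_of_pos hSpos r⁻¹
  have h5 : s ^ r⁻¹ ≤ K := by
    rw [← mul_div_assoc, le_div_iff₀ hp] at hmain
    nlinarith
  calc s = (s ^ r⁻¹) ^ r := by
        rw [← Real.rpow_mul hSpos.le, inv_mul_cancel₀ hr.ne', Real.rpow_one]
    _ ≤ K ^ r := Real.rpow_le_rpow hp.le h5 hr.le

/-- The interpolation norm of a couple of weighted `ℓ_q` spaces: lower bound. -/
theorem wNorm_le_interpENorm {θ : ℝ} (hθ₀ : 0 ≤ θ) (hθ₁ : θ ≤ 1) (hq₀ : 1 ≤ q₀)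
    (hqt₀ : q₀ ≠ ∞) (hq₁ : 1 ≤ q₁) (hqt₁ : q₁ ≠ ∞) (hq : 0 < q) (hqt : q ≠ ∞)
    (hqq : 1 / q.toReal = (1 - θ) / q₀.toReal + θ / q₁.toReal) (a : ℕ → B) :
    wNorm q (fun j => (1 - θ) * α j + θ * β j) a
      ≤ interpENorm (wNorm q₀ α) (wNorm q₁ β) θ a := by
  refine le_iInf₂ fun f ⟨hf, hfa⟩ => ?_
  set K := max (⨆ t : ℝ, wNorm q₀ α (f (t * Complex.I)))
    (⨆ t : ℝ, wNorm q₁ β (f (1 + t * Complex.I))) with hK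
  by_cases hKt : K = ∞
  · rw [hKt]; exact le_top
  have hr : 0 < q.toReal := ENNReal.toReal_pos hq.ne' hqt
  have hKr : K = ENNReal.ofReal K.toReal := (ENNReal.ofReal_toReal hKt).symm
  have hK₀ : ∀ t : ℝ, wNorm q₀ α (f (t * Complex.I)) ≤ ENNReal.ofReal K.toReal := fun t => by
    rw [← hKr]
    exact (le_iSup (fun t : ℝ => wNorm q₀ α (f (t * Complex.I))) t).trans (le_max_left _ _)
  have hK₁ : ∀ t : ℝ, wNorm q₁ β (f (1 + t * Complex.I)) ≤ ENNReal.ofReal K.toReal := fun t => by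
    rw [← hKr]
    exact (le_iSup (fun t : ℝ => wNorm q₁ β (f (1 + t * Complex.I))) t).trans (le_max_right _ _)
  rw [← ENNReal.rpow_le_rpow_iff hr, wNorm, elq_rpow hq hqt, ENNReal.tsum_eq_iSup_sum]
  refine iSup_le fun F => ?_
  classical
  -- Zero entries contribute nothing and are removed, since the finite estimate uses logarithms.
  have h1 := sum_rpow_le_of_isCalderon hθ₀ hθ₁ hq₀ hqt₀ hq₁ hqt₁ hr hqq hf ENNReal.toReal_nonneg
    hK₀ hK₁ (F.filter fun j => a j ≠ 0) fun j hj => by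
      rw [hfa]; exact (Finset.mem_filter.1 hj).2
  rw [hfa] at h1
  have h2 : ∑ j ∈ F, (ENNReal.ofReal (Real.exp ((1 - θ) * α j + θ * β j)) * ‖a j‖ₑ) ^ q.toReal
      = ENNReal.ofReal (∑ j ∈ F.filter fun j => a j ≠ 0,
        (Real.exp ((1 - θ) * α j + θ * β j) * ‖a j‖) ^ q.toReal) := by
    rw [ENNReal.ofReal_sum_of_nonneg fun j _ => by positivity, Finset.sum_filter]
    refine Finset.sum_congr rfl fun j _ => ?_
    split_ifs with hj
    · rw [← ofReal_norm, ← ENNReal.ofReal_mul (Real.exp_nonneg _),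
        ENNReal.ofReal_rpow_of_nonneg (by positivity) hr.le]
    · rw [not_not.1 hj, enorm_zero, mul_zero, ENNReal.zero_rpow_of_pos hr]
  rw [h2, hKr, ENNReal.ofReal_rpow_of_nonneg ENNReal.toReal_nonneg hr.le]
  exact ENNReal.ofReal_le_ofReal h1

end Lower

/-! ### Functoriality of complex interpolation -/

section Functoriality

variable {V V' : Type*} [AddCommGroup V] [Module ℂ V] [AddCommGroup V'] [Module ℂ V']
  {N₀ N₁ : V → ℝ≥0∞} {N₀' N₁' : V' → ℝ≥0∞} {T : V →ₗ[ℂ] V'} {C : ℝ≥0}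

theorem sumENorm_map_le (hC : C ≠ 0) (h₀ : ∀ x, N₀' (T x) ≤ C * N₀ x)
    (h₁ : ∀ x, N₁' (T x) ≤ C * N₁ x) (x : V) :
    sumENorm N₀' N₁' (T x) ≤ C * sumENorm N₀ N₁ x := by
  rw [sumENorm, sumENorm, ENNReal.mul_iInf_of_ne (by simpa using hC) (by simp)]
  refine le_iInf fun b => (iInf_le _ (T b)).trans ?_
  rw [← map_sub, mul_add]
  exact add_le_add (h₀ b) (h₁ _)

theorem tendsto_zero_of_le_const_mul {ι : Type*} {l : Filter ι} {a b : ι → ℝ≥0∞}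
    (h : Tendsto a l (𝓝 0)) (hab : ∀ i, b i ≤ C * a i) : Tendsto b l (𝓝 0) := by
  have h1 := ENNReal.Tendsto.const_mul (a := (C : ℝ≥0∞)) h (Or.inr (by simp))
  rw [mul_zero] at h1
  exact tendsto_of_tendsto_of_tendsto_of_le_of_le tendsto_const_nhds h1 (fun _ => bot_le) hab

theorem IsCalderon.map (hC : C ≠ 0) (h₀ : ∀ x, N₀' (T x) ≤ C * N₀ x)
    (h₁ : ∀ x, N₁' (T x) ≤ C * N₁ x) {f : ℂ → V} (hf : IsCalderon N₀ N₁ f) :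
    IsCalderon N₀' N₁' fun z => T (f z) := by
  have hs := sumENorm_map_le (T := T) hC h₀ h₁
  refine ⟨?_, fun z hz => ?_, fun z hz0 hz1 => ?_, fun t => ?_, fun t => ?_, fun t => ?_,
    fun t => ?_, ?_, ?_⟩
  · obtain ⟨M, hM⟩ := hf.bounded
    refine ⟨C * M, fun z hz => (hs _).trans ?_⟩
    rw [ENNReal.coe_mul]
    gcongr
    exact hM z hz
  · refine tendsto_zero_of_le_const_mul (C := C) (hf.continuous z hz) fun w => ?_
    rw [← map_sub]
    exact hs _
  · obtain ⟨g, hg, hlim⟩ := hf.analytic z hz0 hz1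
    refine ⟨T g, (hs g).trans_lt (ENNReal.mul_lt_top (by simp) hg), ?_⟩
    refine tendsto_zero_of_le_const_mul (C := C) hlim fun w => ?_
    rw [← map_sub, ← map_smul, ← map_sub]
    exact hs _
  · exact (h₀ _).trans_lt (ENNReal.mul_lt_top (by simp) (hf.finite₀ t))
  · exact (h₁ _).trans_lt (ENNReal.mul_lt_top (by simp) (hf.finite₁ t))
  · refine tendsto_zero_of_le_const_mul (C := C) (hf.continuous₀ t) fun w => ?_
    rw [← map_sub]
    exact h₀ _
  · refine tendsto_zero_of_le_const_mul (C := C) (hf.continuous₁ t) fun w => ?_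
    rw [← map_sub]
    exact h₁ _
  · exact tendsto_zero_of_le_const_mul (C := C) hf.vanish₀ fun w => h₀ _
  · exact tendsto_zero_of_le_const_mul (C := C) hf.vanish₁ fun w => h₁ _

/-- Complex interpolation of linear maps. -/
theorem interpENorm_map_le (hC : C ≠ 0) (h₀ : ∀ x, N₀' (T x) ≤ C * N₀ x)
    (h₁ : ∀ x, N₁' (T x) ≤ C * N₁ x) (θ : ℝ) (a : V) :
    interpENorm N₀' N₁' θ (T a) ≤ C * interpENorm N₀ N₁ θ a := by
  have hC0 : (C : ℝ≥0∞) ≠ 0 := by simpa using hC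
  rw [interpENorm, interpENorm, ENNReal.mul_iInf_of_ne hC0 (by simp)]
  refine le_iInf fun f => ?_
  rw [ENNReal.mul_iInf_of_ne hC0 (by simp)]
  refine le_iInf fun hf => ?_
  refine (iInf₂_le (fun z => T (f z)) ⟨hf.1.map hC h₀ h₁, congrArg T hf.2⟩).trans ?_
  refine max_le (iSup_le fun t => (h₀ _).trans ?_) (iSup_le fun t => (h₁ _).trans ?_)
  · gcongr
    exact (le_iSup (fun t : ℝ => N₀ (f (t * Complex.I))) t).trans (le_max_left _ _)
  · gcongr
    exact (le_iSup (fun t : ℝ => N₁ (f (1 + t * Complex.I))) t).trans (le_max_right _ _)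

theorem exists_interpENorm_map_le (T : V →ₗ[ℂ] V') (h₀ : ∃ C : ℝ≥0, ∀ x, N₀' (T x) ≤ C * N₀ x)
    (h₁ : ∃ C : ℝ≥0, ∀ x, N₁' (T x) ≤ C * N₁ x) :
    ∃ C : ℝ≥0, ∀ (θ : ℝ) a, interpENorm N₀' N₁' θ (T a) ≤ C * interpENorm N₀ N₁ θ a := by
  obtain ⟨C₀, h₀⟩ := h₀
  obtain ⟨C₁, h₁⟩ := h₁
  refine ⟨C₀ + C₁ + 1, interpENorm_map_le (by positivity) (fun x => le_mul_add_one (h₀ x))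
    fun x => ?_⟩
  rw [add_comm C₀]
  exact le_mul_add_one (h₁ x)

theorem EquivENorm.interpENorm {M₀ M₁ : V → ℝ≥0∞} (h₀ : EquivENorm N₀ M₀) (h₁ : EquivENorm N₁ M₁)
    (θ : ℝ) : EquivENorm (interpENorm N₀ N₁ θ) (interpENorm M₀ M₁ θ) := by
  obtain ⟨C₀, -, h₀⟩ := h₀
  obtain ⟨C₁, -, h₁⟩ := h₁
  obtain ⟨C, hC⟩ := exists_interpENorm_map_le LinearMap.id (N₀ := M₀) (N₁ := M₁) (N₀' := N₀)
    (N₁' := N₁) ⟨C₀, fun x => (h₀ x).1⟩ ⟨C₁, fun x => (h₁ x).1⟩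
  obtain ⟨C', hC'⟩ := exists_interpENorm_map_le LinearMap.id (N₀ := N₀) (N₁ := N₁) (N₀' := M₀)
    (N₁' := M₁) ⟨C₀, fun x => (h₀ x).2⟩ ⟨C₁, fun x => (h₁ x).2⟩
  exact equivENorm_of_le ⟨C, hC θ⟩ ⟨C', hC' θ⟩

theorem EquivENorm.symm {W : Type*} {N M : W → ℝ≥0∞} (h : EquivENorm N M) : EquivENorm M N := by
  obtain ⟨C, hC, h⟩ := h
  exact ⟨C, hC, fun f => (h f).symm⟩

theorem EquivENorm.trans {W : Type*} {N M R : W → ℝ≥0∞} (h : EquivENorm N M) (h' : EquivENorm M R) :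
    EquivENorm N R := by
  obtain ⟨C, hC, h⟩ := h
  obtain ⟨C', hC', h'⟩ := h'
  refine ⟨C * C', by positivity, fun f => ⟨(h f).1.trans ?_, (h' f).2.trans ?_⟩⟩
  · rw [ENNReal.coe_mul, mul_assoc]
    gcongr
    exact (h' f).1
  · rw [mul_comm C, ENNReal.coe_mul, mul_assoc]
    gcongr
    exact (h f).2

end Functoriality

/-! ### Interpolation of the scaled sequence spaces -/

section SeqInterp

variable {q q₀ q₁ : ℝ≥0∞} {θ : ℝ}

/-- The value `q = ∞` would force both `θ` and `1 - θ` to vanish; `q = 0` would make the right-hand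
side infinite. -/
theorem interp_exponent (hq₀ : 1 ≤ q₀) (hqt₀ : q₀ ≠ ∞) (hq₁ : 1 ≤ q₁) (hqt₁ : q₁ ≠ ∞)
    (hθ₀ : 0 ≤ θ) (hθ₁ : θ ≤ 1)
    (hqq : 1 / q = ENNReal.ofReal (1 - θ) / q₀ + ENNReal.ofReal θ / q₁) :
    0 < q ∧ q ≠ ∞ ∧ 1 / q.toReal = (1 - θ) / q₀.toReal + θ / q₁.toReal := by
  have hq₀' : q₀ ≠ 0 := (zero_lt_one.trans_le hq₀).ne'
  have hq₁' : q₁ ≠ 0 := (zero_lt_one.trans_le hq₁).ne'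
  have h0t : ENNReal.ofReal (1 - θ) / q₀ ≠ ∞ := ENNReal.div_ne_top ENNReal.ofReal_ne_top hq₀'
  have h1t : ENNReal.ofReal θ / q₁ ≠ ∞ := ENNReal.div_ne_top ENNReal.ofReal_ne_top hq₁'
  refine ⟨?_, ?_, ?_⟩
  · rw [pos_iff_ne_zero]
    rintro rfl
    rw [ENNReal.div_zero one_ne_zero] at hqq
    exact ENNReal.add_ne_top.2 ⟨h0t, h1t⟩ hqq.symm
  · rintro rfl
    rw [ENNReal.div_top, eq_comm, add_eq_zero, ENNReal.div_eq_zero_iff, ENNReal.div_eq_zero_iff,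
      ENNReal.ofReal_eq_zero, ENNReal.ofReal_eq_zero] at hqq
    rcases hqq with ⟨h | h, h' | h'⟩
    · linarith
    · exact hqt₁ h'
    · exact hqt₀ h
    · exact hqt₀ h
  · have h := congrArg ENNReal.toReal hqq
    rw [ENNReal.toReal_add h0t h1t, ENNReal.toReal_div, ENNReal.toReal_div, ENNReal.toReal_div,
      ENNReal.toReal_ofReal (by linarith), ENNReal.toReal_ofReal hθ₀, ENNReal.toReal_one] at h
    exact h

variable {B : Type*} [NormedAddCommGroup B] (S : ScalingTriple)

/-- The logarithm of the weight is linear in `γ`, so interpolating the weights geometrically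
interpolates `γ` affinely. -/
theorem seqENorm_equiv_wNorm (γ : ℝ) (hq : 0 < q) :
    EquivENorm (seqENorm S γ q (B := B)) (wNorm q fun j => -γ / 2 * Real.log (S.sig j)) := by
  obtain ⟨K, hK⟩ := exists_lqENorm_le S.c_pos S.s_pos hq γ
  obtain ⟨K', hK'⟩ := exists_le_lqENorm S.c_pos S.s_pos hq γ
  have h : ∀ x : ℕ → B, wNorm q (fun j => -γ / 2 * Real.log (S.sig j)) x
      = elq q fun j => gw S.c S.s γ j * ‖x j‖ₑ := fun x => by
    simp only [wNorm, S.gw_eq, S.sig_rpow]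
  refine equivENorm_of_le ⟨K, fun x => ?_⟩ ⟨K', fun x => ?_⟩
  · rw [h]
    exact hK _
  · rw [h]
    exact hK' _

/-- Complex interpolation of the scaled sequence spaces. -/
theorem interpENorm_seqENorm_equiv [NormedSpace ℂ B] (γ₀ γ₁ : ℝ) (hq₀ : 1 ≤ q₀) (hqt₀ : q₀ ≠ ∞)
    (hq₁ : 1 ≤ q₁) (hqt₁ : q₁ ≠ ∞) (hθ₀ : 0 ≤ θ) (hθ₁ : θ ≤ 1)
    (hqq : 1 / q = ENNReal.ofReal (1 - θ) / q₀ + ENNReal.ofReal θ / q₁) :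
    EquivENorm (interpENorm (seqENorm S γ₀ q₀ (B := B)) (seqENorm S γ₁ q₁ (B := B)) θ)
      (seqENorm S ((1 - θ) * γ₀ + θ * γ₁) q (B := B)) := by
  obtain ⟨hq, hqt, hr⟩ := interp_exponent hq₀ hqt₀ hq₁ hqt₁ hθ₀ hθ₁ hqq
  have hq₀' : 0 < q₀ := zero_lt_one.trans_le hq₀
  have hq₁' : 0 < q₁ := zero_lt_one.trans_le hq₁
  refine ((seqENorm_equiv_wNorm S γ₀ hq₀').interpENorm (seqENorm_equiv_wNorm S γ₁ hq₁') θ).trans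
    (EquivENorm.trans ?_ (seqENorm_equiv_wNorm S _ hq).symm)
  have hw : (fun j => -((1 - θ) * γ₀ + θ * γ₁) / 2 * Real.log (S.sig j))
      = fun j => (1 - θ) * (-γ₀ / 2 * Real.log (S.sig j)) + θ * (-γ₁ / 2 * Real.log (S.sig j)) := by
    funext j
    ring
  rw [hw]
  refine equivENorm_of_le ⟨Real.toNNReal (Real.exp 1), fun a => ?_⟩ ⟨1, fun a => ?_⟩
  · exact interpENorm_le_wNorm hq₀' hqt₀ hq₁' hqt₁ hq hqt hr a
  · rw [ENNReal.coe_one, one_mul]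
    exact wNorm_le_interpENorm hθ₀ hθ₁ hq₀ hqt₀ hq₁ hqt₁ hq hqt hr a

end SeqInterp

/-! ### The scaled Besov spaces as retracts of sequence spaces -/

section Retract

variable {d : ℕ} (S : ScalingTriple) (φ : LittlewoodPaley d S.c) (p : ℝ≥0∞)

/-- The distributions all of whose blocks lie in `L_p`. -/
def blockSubmodule : Submodule ℂ 𝓢'(E d, ℂ) where
  carrier := {f | ∀ j, MemLp (conv f (φ.block j)) p volume}
  add_mem' := fun hf hg j => (hf j).add (hg j)
  zero_mem' := fun _ => MemLp.zero
  smul_mem' := fun a _ hf j => (hf j).const_smul a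

theorem mem_blockSubmodule {γ : ℝ} {q : ℝ≥0∞} (hq : 0 < q) {f : 𝓢'(E d, ℂ)}
    (hf : scaledBesovENorm S φ γ p q f < ∞) : f ∈ blockSubmodule S φ p :=
  conv_mem_of_scaledBesovENorm_lt_top S φ hq hf

variable {S φ p} in
theorem mem_blockSubmodule_of_sumENorm {γ₀ γ₁ : ℝ} {q₀ q₁ : ℝ≥0∞} (hq₀ : 0 < q₀) (hq₁ : 0 < q₁)
    {f : 𝓢'(E d, ℂ)}
    (h : sumENorm (scaledBesovENorm S φ γ₀ p q₀) (scaledBesovENorm S φ γ₁ p q₁) f < ∞) :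
    f ∈ blockSubmodule S φ p := by
  obtain ⟨b, hb⟩ := iInf_lt_iff.1 h
  rw [ENNReal.add_lt_top] at hb
  rw [← add_sub_cancel b f]
  exact Submodule.add_mem _ (mem_blockSubmodule S φ p hq₀ hb.1) (mem_blockSubmodule S φ p hq₁ hb.2)

/-- Sums over neighbouring entries. -/
def nearSum (m : ℕ) : (ℕ → Lp ℂ p (volume : Measure (E d))) →ₗ[ℂ]
    ℕ → Lp ℂ p (volume : Measure (E d)) where
  toFun x k := ∑ i ∈ nearSet m m k, x i
  map_add' x y := by
    funext k
    simp [Finset.sum_add_distrib]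
  map_smul' a x := by
    funext k
    simp [Finset.smul_sum]

theorem nearSum_apply (m : ℕ) (x : ℕ → Lp ℂ p (volume : Measure (E d))) (k : ℕ) :
    nearSum p m x k = ∑ i ∈ nearSet m m k, x i := rfl

variable [hp : Fact (1 ≤ p)]

/-- The blocks of a distribution as elements of `L_p`. -/
def blockMap : blockSubmodule S φ p →ₗ[ℂ] ℕ → Lp ℂ p (volume : Measure (E d)) where
  toFun f j := (f.2 j).toLp (conv (f : 𝓢'(E d, ℂ)) (φ.block j))
  map_add' f g := by
    funext j
    exact MemLp.toLp_add (f.2 j) (g.2 j)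
  map_smul' a f := by
    funext j
    exact MemLp.toLp_const_smul a (f.2 j)

theorem seqENorm_blockMap (γ : ℝ) (q : ℝ≥0∞) (f : blockSubmodule S φ p) :
    seqENorm S γ q (blockMap S φ p f) = scaledBesovENorm S φ γ p q (f : 𝓢'(E d, ℂ)) := by
  rw [seqENorm, scaledBesovENorm, besovENorm_eq_lqENorm]
  congr 1
  funext j
  rw [Lp.enorm_def]
  exact eLpNorm_congr_ae (f.2 j).coeFn_toLp

/-- The distribution attached to an element of `L_p`. -/
def distLp : Lp ℂ p (volume : Measure (E d)) →ₗ[ℂ] 𝓢'(E d, ℂ) :=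
  (Lp.toTemperedDistributionCLM ℂ (volume : Measure (E d)) p).toLinearMap

theorem distLp_apply (z : Lp ℂ p (volume : Measure (E d))) (g : 𝓢(E d, ℂ)) :
    distLp p z g = ∫ x, g x * z x := by
  change Lp.toTemperedDistribution z g = _
  rw [Lp.toTemperedDistribution_apply]
  simp only [smul_eq_mul]

theorem enorm_distLp_apply_le (z : Lp ℂ p (volume : Measure (E d))) (g : 𝓢(E d, ℂ)) :
    ‖distLp p z g‖ₑ ≤ eLpNorm g (conjExp p) volume * ‖z‖ₑ := by
  rw [distLp_apply, Lp.enorm_def]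
  exact enorm_integral_mul_le (Lp.aestronglyMeasurable z) g hp.out

theorem eLpNorm_conv_distLp_le (z : Lp ℂ p (volume : Measure (E d))) (h : 𝓢(E d, ℂ)) :
    eLpNorm (conv (distLp p z) h) p volume ≤ eLpNorm h 1 volume * ‖z‖ₑ := by
  have h1 : conv (distLp p z) h = fun x => ∫ y, h (x - y) * z y := by
    funext x
    rw [conv, distLp_apply]
    simp only [reflectTranslate_apply]
  rw [h1, Lp.enorm_def]
  exact eLpNorm_integral_mul_le h (Lp.aestronglyMeasurable z) hp.out

theorem distLp_blockMap (f : blockSubmodule S φ p) (j : ℕ) :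
    distLp p (blockMap S φ p f j) = dconv (f : 𝓢'(E d, ℂ)) (φ.block j) := by
  ext g
  rw [distLp_apply, dconv_eq_integral]
  refine integral_congr_ae ?_
  filter_upwards [(f.2 j).coeFn_toLp] with x hx
  change g x * (f.2 j).toLp _ x = _
  rw [hx]

/-- The sequences `z` for which `∑ z_k ∗ φ_k` converges to a tempered distribution. -/
def synthSubmodule : Submodule ℂ (ℕ → Lp ℂ p (volume : Measure (E d))) where
  carrier := {z | ∃ T : 𝓢'(E d, ℂ), ∀ g, Tendsto
    (fun J => ∑ k ∈ Finset.range (J + 1), dconv (distLp p (z k)) (φ.block k) g) atTop (𝓝 (T g))}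
  add_mem' := by
    rintro z z' ⟨T, hT⟩ ⟨T', hT'⟩
    refine ⟨T + T', fun g => ((hT g).add (hT' g)).congr fun J => ?_⟩
    rw [← Finset.sum_add_distrib]
    refine Finset.sum_congr rfl fun k _ => ?_
    rw [Pi.add_apply, map_add]
    rfl
  zero_mem' := by
    refine ⟨0, fun g => tendsto_const_nhds.congr fun J => ?_⟩
    refine (Finset.sum_eq_zero fun k _ => ?_).symm
    rw [Pi.zero_apply, map_zero]
    rfl
  smul_mem' := by
    rintro a z ⟨T, hT⟩
    refine ⟨a • T, fun g => ((hT g).const_smul a).congr fun J => ?_⟩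
    rw [Finset.smul_sum]
    refine Finset.sum_congr rfl fun k _ => ?_
    rw [Pi.smul_apply, map_smul]
    rfl

/-- The synthesis map `z ↦ ∑ z_k ∗ φ_k`. -/
def synthMap : synthSubmodule S φ p →ₗ[ℂ] 𝓢'(E d, ℂ) where
  toFun z := z.2.choose
  map_add' z z' := by
    ext g
    refine tendsto_nhds_unique ((z + z').2.choose_spec g)
      (((z.2.choose_spec g).add (z'.2.choose_spec g)).congr fun J => ?_)
    rw [← Finset.sum_add_distrib]
    refine Finset.sum_congr rfl fun k _ => ?_
    rw [Submodule.coe_add, Pi.add_apply, map_add]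
    rfl
  map_smul' a z := by
    ext g
    refine tendsto_nhds_unique ((a • z).2.choose_spec g)
      (((z.2.choose_spec g).const_smul a).congr fun J => ?_)
    rw [Finset.smul_sum]
    refine Finset.sum_congr rfl fun k _ => ?_
    rw [Submodule.coe_smul, Pi.smul_apply, map_smul]
    rfl

theorem tendsto_synthMap (z : synthSubmodule S φ p) (g : 𝓢(E d, ℂ)) :
    Tendsto (fun J => ∑ k ∈ Finset.range (J + 1),
      dconv (distLp p ((z : ℕ → Lp ℂ p (volume : Measure (E d))) k)) (φ.block k) g) atTop
      (𝓝 (synthMap S φ p z g)) := z.2.choose_spec g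

/-- The entries `z_k` grow at most geometrically, and the rapidly decaying blocks of the test
function make the synthesis series absolutely convergent, with a sum dominated by a continuous
seminorm. -/
theorem mem_synthSubmodule {γ : ℝ} {q : ℝ≥0∞} (hq : 0 < q)
    {z : ℕ → Lp ℂ p (volume : Measure (E d))} (hz : seqENorm S γ q z < ∞) :
    z ∈ synthSubmodule S φ p := by
  obtain ⟨C, A, hA⟩ := S.exists_gw_le_geom (-γ)
  obtain ⟨K, hK⟩ := exists_le_lqENorm S.c_pos S.s_pos hq γ
  obtain ⟨Q, hQ, hQA⟩ := exists_isControl_block φ (one_le_conjExp p) A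
  have hQr : IsControl fun g => Q (refl g) := by
    obtain ⟨r, hr, hrQ⟩ := hQ
    exact ⟨r.comp (reflCLM d).toLinearMap, hr.comp (reflCLM d).continuous, fun g => hrQ (refl g)⟩
  set N := seqENorm S γ q z with hN
  set D : ℝ≥0∞ := K * N * C with hD
  have hDt : D ≠ ∞ := ENNReal.mul_ne_top (ENNReal.mul_ne_top (by simp) hz.ne) (by simp)
  have hz' : ∀ k, ‖z k‖ₑ ≤ D * A ^ k := by
    intro k
    have h1 := (le_elq hq (fun j => gw S.c S.s γ j * ‖z j‖ₑ) k).trans (hK fun j => ‖z j‖ₑ)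
    calc ‖z k‖ₑ = (gw S.c S.s γ k)⁻¹ * (gw S.c S.s γ k * ‖z k‖ₑ) := by
          rw [← mul_assoc, ENNReal.inv_mul_cancel (gw_ne_zero S.c_pos S.s_pos k) (gw_ne_top k),
            one_mul]
      _ ≤ (C * A ^ k) * (K * N) := by
          rw [← S.gw_neg]
          exact mul_le_mul' (hA k) h1
      _ = _ := by rw [hD]; ring
  have hterm : ∀ (g : 𝓢(E d, ℂ)) k, ‖dconv (distLp p (z k)) (φ.block k) g‖ₑ
      ≤ D * Q (refl g) * 2⁻¹ ^ k := by
    intro g k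
    rw [dconv_apply]
    refine (enorm_distLp_apply_le p _ _).trans ?_
    have h1 : eLpNorm (sconv (refl (φ.block k)) g) (conjExp p) volume
        = eLpNorm (conv ((refl g : 𝓢(E d, ℂ)) : 𝓢'(E d, ℂ)) (φ.block k)) (conjExp p) volume := by
      rw [conv_coe, ← eLpNorm_refl, refl_sconv, refl_refl, sconv_comm]
    rw [h1]
    calc _ ≤ eLpNorm (conv ((refl g : 𝓢(E d, ℂ)) : 𝓢'(E d, ℂ)) (φ.block k)) (conjExp p) volume *
          (D * A ^ k) := by gcongr; exact hz' k
      _ = D * (A ^ k * eLpNorm (conv ((refl g : 𝓢(E d, ℂ)) : 𝓢'(E d, ℂ)) (φ.block k))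
          (conjExp p) volume) := by ring
      _ ≤ D * (Q (refl g) * 2⁻¹ ^ k) := mul_le_mul_right (hQA _ _) _
      _ = _ := by ring
  have hgeom : ∑' k : ℕ, (2⁻¹ : ℝ≥0∞) ^ k ≠ ∞ := by
    simp [ENNReal.tsum_geometric]
  have hsumle : ∀ g, ∑' k, ‖dconv (distLp p (z k)) (φ.block k) g‖ₑ
      ≤ (D * ∑' k : ℕ, (2⁻¹ : ℝ≥0∞) ^ k) * Q (refl g) := fun g => by
    refine (ENNReal.tsum_le_tsum (hterm g)).trans (le_of_eq ?_)
    rw [ENNReal.tsum_mul_left]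
    ring
  have hct : D * ∑' k : ℕ, (2⁻¹ : ℝ≥0∞) ^ k ≠ ∞ := ENNReal.mul_ne_top hDt hgeom
  have hsummable : ∀ g, Summable fun k => dconv (distLp p (z k)) (φ.block k) g := fun g => by
    refine Summable.of_enorm (ne_top_of_le_ne_top ?_ (hsumle g))
    exact ENNReal.mul_ne_top hct (hQ.ne_top _)
  let l : 𝓢(E d, ℂ) →ₗ[ℂ] ℂ :=
    { toFun := fun g => ∑' k, dconv (distLp p (z k)) (φ.block k) g
      map_add' := fun g h => by
        simp only [map_add]
        exact (hsummable g).tsum_add (hsummable h)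
      map_smul' := fun a g => by
        simp only [map_smul]
        exact (hsummable g).tsum_const_smul a }
  obtain ⟨T, hT⟩ := exists_temperedDistribution (hQr.const_mul hct) l fun g =>
    (enorm_tsum_le_tsum_enorm).trans (hsumle g)
  refine ⟨T, fun g => ?_⟩
  rw [hT]
  exact (hsummable g).hasSum.tendsto_sum_nat.comp (tendsto_add_atTop_nat 1)

/-- Block `j` annihilates all but the neighbouring terms, so the synthesis series becomes a finite
sum to which the almost diagonal estimate applies. -/
theorem conv_synthMap (z : synthSubmodule S φ p) (j : ℕ) :
    conv (synthMap S φ p z) (φ.block j) = ∑ k ∈ nearSet S.m S.m j,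
      conv (distLp p ((z : ℕ → Lp ℂ p (volume : Measure (E d))) k))
        (sconv (φ.block k) (φ.block j)) := by
  funext x
  rw [Finset.sum_apply]
  refine tendsto_nhds_unique (tendsto_synthMap S φ p z (reflectTranslate (φ.block j) x)) ?_
  have h1 : ∀ k, dconv (distLp p ((z : ℕ → Lp ℂ p (volume : Measure (E d))) k)) (φ.block k)
      (reflectTranslate (φ.block j) x) = conv (distLp p ((z : ℕ → Lp ℂ p
        (volume : Measure (E d))) k)) (sconv (φ.block k) (φ.block j)) x := fun k => by
    rw [← conv_dconv, conv]
  simp only [h1]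
  obtain ⟨J₀, hJ₀⟩ := (nearSet S.m S.m j).bddAbove
  refine tendsto_const_nhds.congr' ?_
  filter_upwards [eventually_ge_atTop J₀] with J hJ
  refine Finset.sum_subset (fun k hk => ?_) fun k _ hk => ?_
  · rw [Finset.mem_range]
    have := hJ₀ hk
    omega
  · have h0 : sconv (φ.block k) (φ.block j) = 0 := by
      by_contra h
      exact hk ((mem_nearSet S.m_spec.1).2
        (near_of_sconv_block_ne_zero (a := S.m) (b := S.m) φ φ h).symm)
    rw [h0, ← zero_smul ℂ (0 : 𝓢(E d, ℂ)), conv_smul_right, zero_smul]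
    rfl

theorem exists_scaledBesovENorm_synthMap_le (γ : ℝ) {q : ℝ≥0∞} (hq : 0 < q) :
    ∃ C : ℝ≥0, ∀ z : synthSubmodule S φ p, scaledBesovENorm S φ γ p q (synthMap S φ p z)
      ≤ C * seqENorm S γ q (z : ℕ → Lp ℂ p (volume : Measure (E d))) := by
  obtain ⟨C, hC⟩ := φ.exists_eLpNorm_block_le
  obtain ⟨D, hD⟩ := S.exists_gw_le_near γ
  have hm := S.m_spec.1
  obtain ⟨K, hK⟩ := exists_lqENorm_le_of_near (C' := C * C) hm hm S.s_pos S.s_pos hq hD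
  refine ⟨K, fun z => ?_⟩
  refine hK (fun j => eLpNorm (conv (synthMap S φ p z) (φ.block j)) p volume)
    (fun k => ‖(z : ℕ → Lp ℂ p (volume : Measure (E d))) k‖ₑ) fun j => ?_
  rw [conv_synthMap, Finset.mul_sum]
  refine (eLpNorm_sum_le (fun k _ => (continuous_conv _ _).aestronglyMeasurable) hp.out).trans
    (Finset.sum_le_sum fun k _ => ?_)
  refine (eLpNorm_conv_sconv_le _ _ _ hp.out).trans ?_
  rw [ENNReal.coe_mul, mul_assoc]
  exact mul_le_mul' (hC j) ((eLpNorm_conv_distLp_le p _ _).trans (mul_le_mul_left (hC k) _))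

theorem exists_seqENorm_nearSum_le (γ : ℝ) {q : ℝ≥0∞} (hq : 0 < q) :
    ∃ C : ℝ≥0, ∀ x : ℕ → Lp ℂ p (volume : Measure (E d)),
      seqENorm S γ q (nearSum p S.m x) ≤ C * seqENorm S γ q x := by
  obtain ⟨D, hD⟩ := S.exists_gw_le_near γ
  have hm := S.m_spec.1
  obtain ⟨K, hK⟩ := exists_lqENorm_le_of_near (C' := 1) hm hm S.s_pos S.s_pos hq hD
  refine ⟨K, fun x => hK _ _ fun k => ?_⟩
  rw [ENNReal.coe_one, one_mul, nearSum_apply]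
  exact enorm_sum_le _ _

/-- Summing neighbouring blocks before synthesis is what inverts analysis: `∑_{i near k} φ_i ∗ φ_k =
kap d • φ_k` gives one factor `kap d`, and the Littlewood-Paley decomposition of `f` the other. -/
theorem tendsto_synth_nearSum_blockMap (f : blockSubmodule S φ p) (g : 𝓢(E d, ℂ)) :
    Tendsto (fun J => ∑ k ∈ Finset.range (J + 1),
      dconv (distLp p (nearSum p S.m (blockMap S φ p f) k)) (φ.block k) g) atTop
      (𝓝 (((kap d * kap d) • (f : 𝓢'(E d, ℂ))) g)) := by
  have h1 : ∀ k, dconv (distLp p (nearSum p S.m (blockMap S φ p f) k)) (φ.block k) g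
      = kap d * dconv (f : 𝓢'(E d, ℂ)) (φ.block k) g := by
    intro k
    have h2 : ∑ i ∈ nearSet S.m S.m k, sconv (φ.block i) (φ.block k) = kap d • φ.block k := by
      simp only [sconv_comm _ (φ.block k)]
      exact sum_nearSet_sconv_block (m := S.m) φ k
    rw [← dconv_smul_right, ← h2, dconv_sum_right, nearSum_apply, map_sum, dconv_apply]
    simp only [distLp_blockMap]
    have h3 : ∀ (s : Finset ℕ) (u : 𝓢(E d, ℂ)), (∑ i ∈ s, dconv (f : 𝓢'(E d, ℂ)) (φ.block i)) u
        = ∑ i ∈ s, dconv (f : 𝓢'(E d, ℂ)) (φ.block i) u := fun s u => by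
      rw [sum_apply]
    rw [h3]
    exact Finset.sum_congr rfl fun i _ => (dconv_sconv _ _ _ _).symm
  simp only [h1]
  have h4 := (tendsto_sum_dconv_block φ (f : 𝓢'(E d, ℂ)) g).const_mul (kap d)
  have h5 : ((kap d * kap d) • (f : 𝓢'(E d, ℂ))) g = kap d * (kap d * (f : 𝓢'(E d, ℂ)) g) := by
    rw [← mul_assoc]
    rfl
  rw [h5]
  exact h4.congr fun J => by rw [Finset.mul_sum]

/-- The scaled Besov spaces are retracts of the scaled sequence spaces. -/
theorem exists_retract : ∃ (I : 𝓢'(E d, ℂ) →ₗ[ℂ] ℕ → Lp ℂ p (volume : Measure (E d)))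
    (R : (ℕ → Lp ℂ p (volume : Measure (E d))) →ₗ[ℂ] 𝓢'(E d, ℂ)),
    (∀ f ∈ blockSubmodule S φ p, R (I f) = f) ∧
    (∀ f ∈ blockSubmodule S φ p, ∀ (γ : ℝ) (q : ℝ≥0∞),
      seqENorm S γ q (I f) = scaledBesovENorm S φ γ p q f) ∧
    ∀ (γ : ℝ) (q : ℝ≥0∞), 0 < q → ∃ C : ℝ≥0, ∀ x,
      scaledBesovENorm S φ γ p q (R x) ≤ C * seqENorm S γ q x := by
  -- Functoriality is formulated for linear maps on the ambient spaces, so analysis and synthesis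
  -- are extended algebraically. The extensions are arbitrary, but only their values at elements of
  -- finite norm matter.
  obtain ⟨I, hI⟩ := LinearMap.exists_extend (blockMap S φ p)
  obtain ⟨R₁, hR₁⟩ := LinearMap.exists_extend (synthMap S φ p)
  have hI' : ∀ f : blockSubmodule S φ p, I f = blockMap S φ p f := fun f =>
    LinearMap.congr_fun hI f
  have hR' : ∀ z : synthSubmodule S φ p, R₁ z = synthMap S φ p z := fun z =>
    LinearMap.congr_fun hR₁ z
  have hk := kap_ne_zero d
  refine ⟨I, ((kap d * kap d)⁻¹ : ℂ) • (R₁ ∘ₗ nearSum p S.m), fun f hf => ?_,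
    fun f hf γ q => ?_, fun γ q hq => ?_⟩
  · have h1 := tendsto_synth_nearSum_blockMap S φ p ⟨f, hf⟩
    have hmem : nearSum p S.m (blockMap S φ p ⟨f, hf⟩) ∈ synthSubmodule S φ p := ⟨_, h1⟩
    have h2 : synthMap S φ p ⟨_, hmem⟩ = (kap d * kap d) • f := by
      ext g
      exact tendsto_nhds_unique (tendsto_synthMap S φ p ⟨_, hmem⟩ g) (h1 g)
    have h3 : I f = blockMap S φ p ⟨f, hf⟩ := hI' ⟨f, hf⟩
    have h4 : R₁ (nearSum p S.m (blockMap S φ p ⟨f, hf⟩)) = (kap d * kap d) • f :=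
      (hR' ⟨_, hmem⟩).trans h2
    rw [LinearMap.smul_apply, LinearMap.comp_apply, h3, h4]
    ext g
    change (kap d * kap d)⁻¹ * ((kap d * kap d) * f g) = f g
    field_simp
  · have h3 : I f = blockMap S φ p ⟨f, hf⟩ := hI' ⟨f, hf⟩
    rw [h3, seqENorm_blockMap]
  · obtain ⟨C, hC⟩ := exists_scaledBesovENorm_synthMap_le S φ p γ hq
    obtain ⟨D, hD⟩ := exists_seqENorm_nearSum_le (d := d) S p γ hq
    refine ⟨‖(kap d * kap d)⁻¹‖₊ * (C * D + 1), fun x => ?_⟩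
    rw [LinearMap.smul_apply, scaledBesovENorm_smul S φ γ p hq, ENNReal.coe_mul, mul_assoc,
      enorm_eq_nnnorm]
    gcongr
    -- At infinite norm the extension is uncontrolled; the `+ 1` in the constant makes the
    -- right-hand side infinite even if `C * D = 0`.
    by_cases hx : seqENorm S γ q x = ∞
    · rw [hx, ENNReal.mul_top (by simp)]
      exact le_top
    have hmem : nearSum p S.m x ∈ synthSubmodule S φ p := mem_synthSubmodule S φ p (γ := γ) hq
      ((hD x).trans_lt (ENNReal.mul_lt_top (by simp) (Ne.lt_top hx)))
    have h4 : R₁ (nearSum p S.m x) = synthMap S φ p ⟨_, hmem⟩ := hR' ⟨_, hmem⟩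
    rw [LinearMap.comp_apply, h4]
    refine (hC ⟨_, hmem⟩).trans ?_
    rw [ENNReal.coe_add, ENNReal.coe_mul, add_mul, mul_assoc]
    exact le_add_right (mul_le_mul_right (hD x) _)

/-- Complex interpolation of the scaled Besov spaces. -/
theorem interpENorm_scaledBesovENorm_equiv {q q₀ q₁ : ℝ≥0∞} {θ : ℝ} (γ₀ γ₁ : ℝ) (hq₀ : 1 ≤ q₀)
    (hqt₀ : q₀ ≠ ∞) (hq₁ : 1 ≤ q₁) (hqt₁ : q₁ ≠ ∞) (hθ₀ : 0 ≤ θ) (hθ₁ : θ ≤ 1)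
    (hqq : 1 / q = ENNReal.ofReal (1 - θ) / q₀ + ENNReal.ofReal θ / q₁) :
    EquivENorm (interpENorm (scaledBesovENorm S φ γ₀ p q₀) (scaledBesovENorm S φ γ₁ p q₁) θ)
      (scaledBesovENorm S φ ((1 - θ) * γ₀ + θ * γ₁) p q) := by
  obtain ⟨hq, -, -⟩ := interp_exponent hq₀ hqt₀ hq₁ hqt₁ hθ₀ hθ₁ hqq
  have hq₀' : 0 < q₀ := zero_lt_one.trans_le hq₀
  have hq₁' : 0 < q₁ := zero_lt_one.trans_le hq₁
  obtain ⟨I, R, hRI, hI, hR⟩ := exists_retract S φ p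
  obtain ⟨C, hCpos, hC⟩ := interpENorm_seqENorm_equiv (B := Lp ℂ p (volume : Measure (E d))) S γ₀ γ₁
    hq₀ hqt₀ hq₁ hqt₁ hθ₀ hθ₁ hqq
  obtain ⟨D, hD⟩ := exists_interpENorm_map_le R (hR γ₀ q₀ hq₀') (hR γ₁ q₁ hq₁')
  have hI1 : ∀ (γ : ℝ) (r : ℝ≥0∞), 0 < r → ∀ f, seqENorm S γ r (I f)
      ≤ (1 : ℝ≥0) * scaledBesovENorm S φ γ p r f := by
    intro γ r hr f
    rw [ENNReal.coe_one, one_mul]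
    by_cases hf : scaledBesovENorm S φ γ p r f = ∞
    · rw [hf]; exact le_top
    · rw [hI f (mem_blockSubmodule S φ p hr (Ne.lt_top hf))]
  have hmapI := interpENorm_map_le (T := I) one_ne_zero (hI1 γ₀ q₀ hq₀') (hI1 γ₁ q₁ hq₁') θ
  set γ := (1 - θ) * γ₀ + θ * γ₁ with hγ
  refine equivENorm_of_le ⟨D * C + 1, fun f => ?_⟩ ⟨C + 1, fun f => ?_⟩
  · by_cases hf : scaledBesovENorm S φ γ p q f = ∞
    · rw [hf, ENNReal.mul_top (by simp)]
      exact le_top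
    have hmem := mem_blockSubmodule S φ p hq (Ne.lt_top hf)
    have h1 := hD θ (I f)
    rw [hRI f hmem] at h1
    refine h1.trans ?_
    rw [ENNReal.coe_add, ENNReal.coe_mul, add_mul, mul_assoc]
    refine le_add_right (mul_le_mul_right ?_ _)
    rw [← hI f hmem]
    exact (hC (I f)).1
  · by_cases hf : interpENorm (scaledBesovENorm S φ γ₀ p q₀) (scaledBesovENorm S φ γ₁ p q₁) θ f = ∞
    · rw [hf, ENNReal.mul_top (by simp)]
      exact le_top
    -- A finite interpolation norm provides a Calderón function through `f`. Its boundedness places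
    -- `f` in the sum space, hence among the distributions with blocks in `L_p`, where `I` preserves
    -- norms.
    obtain ⟨F, hF⟩ := iInf_lt_iff.1 (Ne.lt_top hf)
    obtain ⟨⟨hFC, hFθ⟩, -⟩ := iInf_lt_iff.1 hF
    obtain ⟨M, hM⟩ := hFC.bounded
    have hM' := hM θ ⟨by simpa using hθ₀, by simpa using hθ₁⟩
    rw [hFθ] at hM'
    have hmem := mem_blockSubmodule_of_sumENorm hq₀' hq₁' (hM'.trans_lt ENNReal.coe_lt_top)
    rw [← hI f hmem γ q]
    refine (hC (I f)).2.trans ?_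
    have h1 := hmapI f
    rw [ENNReal.coe_one, one_mul] at h1
    rw [ENNReal.coe_add, add_mul]
    exact le_add_right (mul_le_mul_right h1 _)

end Retract

end ScaledBesov

end

theorem proposition4p3 {d : ℕ} (hd : 1 ≤ d) (S : ScalingTriple) (φ : LittlewoodPaley d S.c)
    (γ : ℝ) :
    -- (i)
    (∀ ζ : LittlewoodPaley d 2, ∀ p q : ℝ≥0∞, 1 ≤ p → 0 < q → ∃ N : ℝ≥0, 0 < N ∧
      ∀ f : 𝓢'(E d, ℂ),
        (N : ℝ≥0∞)⁻¹ * classicalBesovENorm ζ (min (S.θ₀ * γ) (S.θ₁ * γ)) p q f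
            ≤ seqLpENorm S γ p q (blocks φ f) ∧
        seqLpENorm S γ p q (blocks φ f) = scaledBesovENorm S φ γ p q f ∧
        scaledBesovENorm S φ γ p q f
            ≤ N * classicalBesovENorm ζ (max (S.θ₀ * γ) (S.θ₁ * γ)) p q f) ∧
    -- (ii)
    (∀ p q : ℝ≥0∞, 1 ≤ p → 0 < q →
      (∃ K : ℝ≥0, IsQuasiBanachWith K (scaledBesovENorm S φ γ p q)) ∧
      (1 ≤ q → IsQuasiBanachWith 1 (scaledBesovENorm S φ γ p q))) ∧
    -- (iii)
    (∀ p q : ℝ≥0∞, 1 ≤ p → 0 < q →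
      (∀ f : E d → ℂ, IsCTilde f → ∃ T ∈ scaledBesovSpace S φ γ p q,
        ∀ g : 𝓢(E d, ℂ), T g = ∫ x, g x * f x) ∧
      (p ≠ ∞ → q ≠ ∞ → ∀ f ∈ scaledBesovSpace S φ γ p q, ∀ ε : ℝ≥0∞, 0 < ε →
        ∃ g : 𝓢(E d, ℂ), HasCompactSupport g ∧
          scaledBesovENorm S φ γ p q (f - (g : 𝓢'(E d, ℂ))) < ε)) ∧
    -- (iv)
    (∀ p q : ℝ≥0∞, 1 ≤ p → 0 < q → ∀ ϑ : LittlewoodPaley d S.c,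
      EquivENorm (scaledBesovENorm S φ γ p q) (scaledBesovENorm S ϑ γ p q)) ∧
    -- (v)
    (∀ p : ℝ≥0∞, 1 ≤ p → p ≠ ∞ → ∀ f : 𝓢'(E d, ℂ),
      (∀ (q : ℝ≥0∞) (γ₁ γ₂ : ℝ), 0 < q → γ₁ ≤ γ₂ →
        scaledBesovENorm S φ γ₁ p q f
          ≤ ENNReal.ofReal (max 1 (S.s ((S.c : ℝ)⁻¹) ^ ((γ₂ - γ₁) / 2)))
            * scaledBesovENorm S φ γ₂ p q f) ∧
      (∀ q₁ q₂ : ℝ≥0∞, 0 < q₁ → q₁ ≤ q₂ →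
        scaledBesovENorm S φ γ p q₂ f ≤ scaledBesovENorm S φ γ p q₁ f)) ∧
    -- (vi)
    (∀ p q : ℝ≥0∞, 1 ≤ p → p ≠ ∞ → 1 ≤ q → q ≠ ∞ →
      ∃ J : scaledBesovDual S φ γ p q →ₗ[ℂ] 𝓢'(E d, ℂ), Function.Injective J ∧
        ∀ (l : scaledBesovDual S φ γ p q) (g : 𝓢(E d, ℂ)),
          ∃ hg : (g : 𝓢'(E d, ℂ)) ∈ scaledBesovSpace S φ γ p q,
            J l g = (l : scaledBesovSpace S φ γ p q →ₗ[ℂ] ℂ) ⟨(g : 𝓢'(E d, ℂ)), hg⟩) ∧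
    -- (vii)
    (∀ (B : Type*) [NormedAddCommGroup B] [NormedSpace ℂ B] [CompleteSpace B]
      (q₀ q₁ q : ℝ≥0∞) (γ₀ γ₁ θ : ℝ), 1 ≤ q₀ → q₀ ≠ ∞ → 1 ≤ q₁ → q₁ ≠ ∞ → 0 ≤ θ → θ ≤ 1 →
      1 / q = ENNReal.ofReal (1 - θ) / q₀ + ENNReal.ofReal θ / q₁ →
      EquivENorm
        (interpENorm (seqENorm S γ₀ q₀ (B := B)) (seqENorm S γ₁ q₁ (B := B)) θ)
        (seqENorm S ((1 - θ) * γ₀ + θ * γ₁) q (B := B))) ∧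
    -- (viii)
    (∀ (p q₀ q₁ q : ℝ≥0∞) (γ₀ γ₁ θ : ℝ), 1 ≤ p → 1 ≤ q₀ → q₀ ≠ ∞ → 1 ≤ q₁ → q₁ ≠ ∞ →
      0 ≤ θ → θ ≤ 1 →
      1 / q = ENNReal.ofReal (1 - θ) / q₀ + ENNReal.ofReal θ / q₁ →
      EquivENorm
        (interpENorm (scaledBesovENorm S φ γ₀ p q₀) (scaledBesovENorm S φ γ₁ p q₁) θ)
        (scaledBesovENorm S φ ((1 - θ) * γ₀ + θ * γ₁) p q)) := by
  refine ⟨fun ζ p q hp hq => ?_, fun p q hp hq => ⟨?_, ?_⟩, fun p q hp hq => ⟨fun f hf => ?_, ?_⟩,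
    fun p q hp hq ϑ => scaledBesovENorm_equiv S φ ϑ γ hp hq, fun p _ _ f => ⟨?_, ?_⟩,
    fun p q hp hpt hq hqt => ?_, ?_, ?_⟩
  · obtain ⟨N, hN, h⟩ := scaledBesovENorm_classical S φ ζ γ hp hq
    exact ⟨N, hN, fun f => ⟨(h f).1, rfl, (h f).2⟩⟩
  · exact isQuasiBanachWith_scaledBesovENorm S φ γ hp hq
  · exact fun hq => isBanach_scaledBesovENorm S φ γ hp hq
  · exact exists_mem_scaledBesovSpace_of_isCTilde S φ γ hp hq hf
  · exact fun hpt hqt f hf ε hε => exists_hasCompactSupport_near S φ γ hp hpt hq hqt hf hε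
  · exact fun q γ₁ γ₂ hq h => scaledBesovENorm_mono_smoothness S φ p hq h f
  · exact fun q₁ q₂ h₁ h => scaledBesovENorm_anti_exponent S φ γ p h₁ h f
  · exact exists_injective_dual S φ γ hp hpt (zero_lt_one.trans_le hq) hqt
  · intro B _ _ _ q₀ q₁ q γ₀ γ₁ θ hq₀ hqt₀ hq₁ hqt₁ hθ₀ hθ₁ hqq
    exact interpENorm_seqENorm_equiv S γ₀ γ₁ hq₀ hqt₀ hq₁ hqt₁ hθ₀ hθ₁ hqq
  · intro p q₀ q₁ q γ₀ γ₁ θ hp hq₀ hqt₀ hq₁ hqt₁ hθ₀ hθ₁ hqq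
    have : Fact (1 ≤ p) := ⟨hp⟩
    exact interpENorm_scaledBesovENorm_equiv S φ p γ₀ γ₁ hq₀ hqt₀ hq₁ hqt₁ hθ₀ hθ₁ hqq
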